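/- **Setting.** Let $\mathfrak g$ be a finite-dimensional Lie algebra of compact type, realized by hermitean $n\times n$ matrices with bracket $i[\cdot,\cdot]$, and let $\pi$ be a finite-dimensional unitary representation of $\mathfrak g$ (by hermitean matrices). Let $c^\mu$ be a real vector-valued distribution on $\mathbb R^{1,3}$ with $\partial_\mu c^\mu=\delta$, and $I_c^\mu(v_\mu)(x)=\int d^4y\,c^\mu(y)v_\mu(x+y)$ the string integration. Fix a space $\mathcal S$ of smooth real scalar functions and a space $\mathcal V$ of smooth real vector functions that decay sufficiently rapidly with respect to $c$: the string integral of every $v\in\mathcal V$ converges (with cutoffs $h(y/R)$, $R\to\infty$, locally uniformly in $x$) to an element of $\mathcal S$; the pairing of $R^{-1}h(y/R)s(x+y)$ with each $c^\mu$ tends to $0$ for $s\in\mathcal S$ and all test functions $h$; $\mathcal S$ is a (non-unital) algebra, $\partial\mathcal S\subset\mathcal V$, $\mathcal S\mathcal V\subset\mathcal V$, $\partial_\mu\mathcal V\subset\mathcal V$, and components of elements of $\mathcal V$ lie in $\mathcal S$. All fields are formal power series in the coupling constant $g$; gauge potentials $A_\mu$ are $\mathfrak g$-valued with real coefficients in $\mathcal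 V$, scalar fields are $\mathfrak g$-valued with coefficients in $\mathcal S$, quark fields $\psi$ are smooth. Group-valued fields are $\theta=e^{iX}$ with $X$ a $\mathfrak g$-valued scalar field of order $g$, and $\pi(\theta)=e^{i\pi(X)}$. Put $$A^\theta=\theta^{-1}(A+ig^{-1}\partial)\theta,\qquad \psi^\theta=\pi(\theta)^{-1}\psi .$$ A *dressing field* is a group-valued functional $u[A]$ with $u[A^\theta]=\theta^{-1}u[A]$ for all potentials $A$ and all group-valued $\theta$; its dressed fields are $A^u=u^{-1}(A+ig^{-1}\partial)u$ and $\psi^u=\pi(u)^{-1}\psi$. Let $V^{\mathfrak g}$ be the smallest real space of vector functionals of $A$ containing $A_\nu$ and $\partial_\nu s$ ($s\in S^{\mathfrak g}$) and closed under $\mathrm{ad}_{is}=i[s,\cdot\,]$, where $S^{\mathfrak g}$ is the span of the $I_c^\nu(v_\nu)$, $v\in V^{\mathfrak g}$. Let $\gamma\in gS^{\mathfrak g}[[g]]$ be such that $W(c)=e^{i\gamma}$ satisfies $$I_c^\mu\big(W(c)(gA_\mu+i\partial_\mu)W(c)^{-1}\big)=0 .$$ For $\alpha\in gV^{\mathfrak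 g}[[g]]$ and $\beta\in gS^{\mathfrak g}[[g]]$, let $\omega$ be the tree-level obstruction map $\omega(X)(x)=i\int d^4x'\,O_\mu\big(U^\mu(x')+\widetilde U^\mu(x'),X(x)\big)$ of the mediator fields $U^\mu=\langle F^{\mu\nu}|\alpha_\nu\rangle$, $\widetilde U^\mu=\overline\psi\gamma^\mu\pi(\beta)\psi$, with $O_\mu(Y',X)=T\partial'_\mu Y'\cdot X-\partial'_\mu TY'\cdot X$ computed by Wick's theorem from the propagators of the free gauge potential in Feynman gauge and of the free Dirac field, the fields $\alpha,\beta$ being inert as factors of $Y$; fields are identified with functionals of the classical $A,\psi$. Let $A_\mu(c)=I_c^\nu(\partial_\mu A_\nu-\partial_\nu A_\mu)$. **Statement.** Such a $\gamma$ exists, and its values on gauge potentials are unique. The group-valued functional $u=W(c)^{-1}$ is a dressing field. There are $\alpha\in gV^{\mathfrak g}[[g]]$ and $\beta\in gS^{\mathfrak g}[[g]]$ such that the dressed fields in the sense of sQFT are $$e^{\omega}(A_\mu(c))=W(c)\big(A_\mu+ig^{-1}\partial_\mu\big)W(c)^{-1},\qquad e^{\omega}(\psi)=\pi(W(c))\psi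 ;$$ they coincide with the dressed fields $A^u_\mu$ and $\psi^u$, and they are invariant under all classical gauge transformations $(A,\psi)\mapsto(A^\theta,\psi^\theta)$. -/

import Mathlib

open scoped Distributions LineDeriv ContDiff
open Filter Topology

noncomputable section

namespace SQFT

/-! ### Spacetime, distributions, and their extension to functions of rapid decay -/

/-- Spacetime `ℝ^{1,3}` as a real vector space; the index `0` is time. -/
abbrev Spacetime : Type := EuclideanSpace ℝ (Fin 4)

/-- The coordinate vector `e_μ`. -/
def e (μ : Fin 4) : Spacetime := EuclideanSpace.single μ 1

/-- The diagonal entries of the Minkowski metric `η = diag(1, -1, -1, -1)`. -/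
def η (μ : Fin 4) : ℝ := if μ = 0 then 1 else -1

/-- Distributions on spacetime with values in `F` (where `F = ℝ` or `F = ℂ`). -/
abbrev Distr (F : Type) [NormedAddCommGroup F] [NormedSpace ℝ F] : Type :=
  𝓓'((⊤ : TopologicalSpace.Opens Spacetime), F)

/-- Test functions on spacetime. -/
abbrev Test : Type := 𝓓((⊤ : TopologicalSpace.Opens Spacetime), ℝ)

/-- The partial derivative `∂_μ T` of a distribution. -/
def pd {F : Type} [NormedAddCommGroup F] [NormedSpace ℝ F] (μ : Fin 4) (T : Distr F) : Distr F :=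
  ∂_{e μ} T

/-- The test function `y ↦ h(y / (k+1)) f(x + y)`, for a test function `h` and a smooth `f`. -/
def cutoff (h : Test) (k : ℕ) {f : Spacetime → ℝ} (hf : ContDiff ℝ ∞ f) (x : Spacetime) : Test where
  toFun y := h (((k : ℝ) + 1)⁻¹ • y) * f (x + y)
  contDiff' := by
    have h1 : ContDiff ℝ ∞ (fun y : Spacetime => h (((k : ℝ) + 1)⁻¹ • y)) :=
      h.contDiff.comp (contDiff_const_smul _)
    have h2 : ContDiff ℝ ∞ (fun y : Spacetime => f (x + y)) :=
      hf.comp (contDiff_const.add contDiff_id)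
    exact h1.mul h2
  hasCompactSupport' := by
    have hk : ((k : ℝ) + 1)⁻¹ ≠ 0 := by positivity
    exact (h.hasCompactSupport.comp_smul hk).mul_right
  tsupport_subset' := by simp

/-- `I(x) = ∫ d⁴y ∑_μ T^μ(y) v_μ(x + y)` for a vector of distributions `T` and a vector `v` of smooth
functions of sufficiently rapid decay: for every test function `h`, the pairing of `T^μ` with
`h(y / R) v_μ(x + y)` converges to `h(0) I(x)` as `R → ∞`, locally uniformly in `x`. -/
def IsPairing {F : Type} [NormedAddCommGroup F] [NormedSpace ℝ F] (T : Fin 4 → Distr F)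
    (v : Fin 4 → Spacetime → ℝ) (I : Spacetime → F) : Prop :=
  ∃ hv : ∀ μ, ContDiff ℝ ∞ (v μ), ∀ h : Test,
    TendstoLocallyUniformly (fun (k : ℕ) (x : Spacetime) => ∑ μ, T μ (cutoff h k (hv μ) x))
      (fun x => h 0 • I x) atTop

open Classical in
/-- The value of `∫ d⁴y ∑_μ T^μ(y) v_μ(x + y)` (zero if it does not exist). -/
def pairingReal (T : Fin 4 → Distr ℂ) (v : Fin 4 → Spacetime → ℝ) : Spacetime → ℂ :=
  if h : ∃ I, IsPairing T v I then h.choose else 0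

/-- The extension of the pairing to complex functions. -/
def pairingComplex (T : Fin 4 → Distr ℂ) (v : Fin 4 → Spacetime → ℂ) : Spacetime → ℂ := fun x =>
  pairingReal T (fun μ y => (v μ y).re) x + Complex.I * pairingReal T (fun μ y => (v μ y).im) x

/-- A real distribution, regarded as a complex one. -/
def toComplex (T : Distr ℝ) : Distr ℂ := Distribution.mapCLM Complex.ofRealCLM T

/-- `∂_μ c^μ = δ`: the condition on a string function `c`. -/
def IsStringFunction (c : Fin 4 → Distr ℝ) : Prop :=
  ∑ μ, pd μ (c μ) = Distribution.delta (0 : Spacetime)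

/-- Spaces `𝓢` of smooth scalar functions and `𝓥` of smooth vector functions on which the string
integration `I_c(v)(x) = ∫ d⁴y c^μ(y) v_μ(x + y)` and its iterations are defined. The elements of `𝓢`
vanish at infinity (weakly, along the string); the elements of `𝓥` decay rapidly
enough for the string integral to converge. No commutation rule of `I_c` is required. -/
structure FieldSpace (c : Fin 4 → Distr ℝ) where
  /-- scalar functions -/
  scalars : NonUnitalSubalgebra ℝ (Spacetime → ℝ)
  /-- vector functions -/
  vectors : Submodule ℝ (Fin 4 → Spacetime → ℝ)
  smooth : ∀ s ∈ scalars, ContDiff ℝ ∞ s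
  decay : ∀ s (hs : s ∈ scalars) (μ : Fin 4) (h : Test) (x : Spacetime),
    Tendsto (fun k : ℕ => ((k : ℝ) + 1)⁻¹ * c μ (cutoff h k (smooth s hs) x)) atTop (𝓝 0)
  component_mem : ∀ v ∈ vectors, ∀ μ, v μ ∈ scalars
  gradient_mem : ∀ s ∈ scalars, (fun μ x => fderiv ℝ s x (e μ)) ∈ vectors
  deriv_mem : ∀ v ∈ vectors, ∀ μ, (fun ν x => fderiv ℝ (v ν) x (e μ)) ∈ vectors
  mul_mem : ∀ s ∈ scalars, ∀ v ∈ vectors, (fun μ x => s x * v μ x) ∈ vectors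
  string_mem : ∀ v ∈ vectors, ∃ I ∈ scalars, IsPairing c v I

/-! ### Formal power series of matrix-valued fields -/

/-- Formal power series in the coupling constant `g` of complex functions on spacetime. -/
abbrev Series : Type := PowerSeries (Spacetime → ℂ)

/-- Formal power series in `g` of matrix-valued functions on spacetime. -/
abbrev MatField (p q : ℕ) : Type := Matrix (Fin p) (Fin q) Series

/-- The matrix `X_N(x)`, where `X = ∑_N g^N X_N`. -/
def value {p q : ℕ} (X : MatField p q) (N : ℕ) (x : Spacetime) : Matrix (Fin p) (Fin q) ℂ :=
  Matrix.of fun i j => PowerSeries.coeff N (X i j) x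

/-- The coupling constant. -/
def g : Series := PowerSeries.X

/-- `g⁻¹ X` for `X = O(g)`. -/
def gdiv {p q : ℕ} (X : MatField p q) : MatField p q :=
  X.map fun f => PowerSeries.mk fun N => PowerSeries.coeff (N + 1) f

/-- `∑_k g^{k+1} X_k`. -/
def gsum {p q : ℕ} (X : ℕ → MatField p q) : MatField p q :=
  Matrix.of fun i j => PowerSeries.mk fun N =>
    ∑ k ∈ Finset.range N, PowerSeries.coeff (N - (k + 1)) (X k i j)

/-- The partial derivative `∂_μ`. -/
def partialD {p q : ℕ} (μ : Fin 4) (X : MatField p q) : MatField p q :=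
  X.map fun f => PowerSeries.mk fun N => fun x => fderiv ℝ (PowerSeries.coeff N f) x (e μ)

/-- The exponential series `∑_k X^k / k!` of `X = O(g)`; as `X^k = O(g^k)`, the terms `k > N` do not
contribute to the order `g^N`. -/
def fexp {p : ℕ} (X : MatField p p) : MatField p p :=
  Matrix.of fun i j => PowerSeries.mk fun N =>
    ∑ k ∈ Finset.range (N + 1), ((k.factorial : ℂ)⁻¹) • PowerSeries.coeff N ((X ^ k) i j)

/-- `∫ d⁴y ∑_μ T^μ(y) v_μ(x + y)` for power series, order by order. -/
def pairing (T : Fin 4 → Distr ℂ) (v : Fin 4 → Series) : Series :=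
  PowerSeries.mk fun N => pairingComplex T fun μ => PowerSeries.coeff N (v μ)

/-- A vector field `V_μ`, with matrix-valued components. -/
abbrev Pot (n : ℕ) : Type := Fin 4 → MatField n n

/-- String integration `I_c^μ(V_μ)(x) = ∫ d⁴y c^μ(y) V_μ(x + y)`. -/
def stringInt {n : ℕ} (c : Fin 4 → Distr ℝ) (V : Pot n) : MatField n n :=
  Matrix.of fun i j => pairing (fun μ => toComplex (c μ)) fun μ => V μ i j

/-! ### Gauge algebra, formal gauge group, representations -/

/-- A Lie algebra of compact type, realized by hermitean matrices with the bracket `i[·,·]`. -/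
structure GaugeAlgebra (n : ℕ) where
  carrier : Submodule ℝ (Matrix (Fin n) (Fin n) ℂ)
  hermitian : ∀ X ∈ carrier, X.IsHermitian
  bracket_mem : ∀ X ∈ carrier, ∀ Y ∈ carrier, Complex.I • (X * Y - Y * X) ∈ carrier

/-- A unitary representation: the generators are represented by hermitean matrices. -/
structure UnitaryRep {n : ℕ} (𝔤 : GaugeAlgebra n) (m : ℕ) where
  toLin : 𝔤.carrier →ₗ[ℝ] Matrix (Fin m) (Fin m) ℂ
  hermitian : ∀ X, (toLin X).IsHermitian
  map_bracket : ∀ X Y : 𝔤.carrier,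
    toLin ⟨Complex.I • ((X : Matrix (Fin n) (Fin n) ℂ) * Y - Y * X),
      𝔤.bracket_mem X X.2 Y Y.2⟩ = Complex.I • (toLin X * toLin Y - toLin Y * toLin X)

variable {n m : ℕ} (𝔤 : GaugeAlgebra n) {c : Fin 4 → Distr ℝ} (𝓕 : FieldSpace c)

/-- `𝔤`-valued scalar fields. -/
def IsScalarField (X : MatField n n) : Prop :=
  ∀ N, (∀ x, value X N x ∈ 𝔤.carrier) ∧ ∀ i j,
    (fun x => (PowerSeries.coeff N (X i j) x).re) ∈ 𝓕.scalars ∧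
    (fun x => (PowerSeries.coeff N (X i j) x).im) ∈ 𝓕.scalars

/-- `𝔤`-valued vector fields, in particular gauge potentials. -/
def IsVectorField (V : Pot n) : Prop :=
  ∀ N, (∀ μ x, value (V μ) N x ∈ 𝔤.carrier) ∧ ∀ i j,
    (fun μ x => (PowerSeries.coeff N (V μ i j) x).re) ∈ 𝓕.vectors ∧
    (fun μ x => (PowerSeries.coeff N (V μ i j) x).im) ∈ 𝓕.vectors

/-- `X ∈ g 𝔤[[g]]`: a `𝔤`-valued scalar field without term of order `g^0`. -/
def IsSmallScalarField (X : MatField n n) : Prop :=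
  IsScalarField 𝔤 𝓕 X ∧ ∀ x, value X 0 x = 0

/-- Group-valued fields `θ = e^{iX}`, `X ∈ g 𝔤[[g]]`, as formal power series in `g`. -/
def IsGroupField (θ : MatField n n) : Prop :=
  ∃ X, IsSmallScalarField 𝔤 𝓕 X ∧ θ = fexp (Complex.I • X)

variable {𝔤}

open Classical in
/-- `π(X)` for a `𝔤`-valued field `X`. -/
def lieRep (π : UnitaryRep 𝔤 m) (X : MatField n n) : MatField m m :=
  Matrix.of fun a b => PowerSeries.mk fun N x =>
    if h : value X N x ∈ 𝔤.carrier then π.toLin ⟨value X N x, h⟩ a b else 0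

open Classical in
/-- `π(θ) = e^{iπ(X)}` for a group-valued field `θ = e^{iX}`. -/
def groupRep (π : UnitaryRep 𝔤 m) (θ : MatField n n) : MatField m m :=
  if h : ∃ X, IsSmallScalarField 𝔤 𝓕 X ∧ θ = fexp (Complex.I • X)
  then fexp (Complex.I • lieRep π h.choose) else 1

/-- A configuration `(A, ψ)` of gauge potential and quark field; the column index of `ψ` is the spinor
index, the row index is that of the representation `π`. -/
abbrev Config (n m : ℕ) : Type := Pot n × MatField m 4

/-- The classical field configurations: `A` is a `𝔤`-valued potential, `ψ` is smooth. -/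
def IsConfig (𝔤 : GaugeAlgebra n) (Φ : Config n m) : Prop :=
  IsVectorField 𝔤 𝓕 Φ.1 ∧ ∀ a i N, ContDiff ℝ ∞ (PowerSeries.coeff N (Φ.2 a i))

/-- `A^θ = θ⁻¹ (A + i g⁻¹ ∂) θ`. This is the gauge transformation if `θ` is a group-valued function, and
the dressing of `A` if `θ = u[A]` is a dressing field. -/
def gaugeA (θ : MatField n n) (A : Pot n) : Pot n := fun μ =>
  θ⁻¹ * A μ * θ + Complex.I • gdiv (θ⁻¹ * partialD μ θ)

/-- `ψ^θ = π(θ)⁻¹ ψ`. -/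
def gaugePsi (π : UnitaryRep 𝔤 m) (θ : MatField n n) (ψ : MatField m 4) : MatField m 4 :=
  (groupRep 𝓕 π θ)⁻¹ * ψ

/-- The gauge transformation of a configuration. -/
def gauge (π : UnitaryRep 𝔤 m) (θ : MatField n n) (Φ : Config n m) : Config n m :=
  (gaugeA θ Φ.1, gaugePsi 𝓕 π θ Φ.2)

/-- Invariance of a functional under classical gauge transformations. -/
def IsGaugeInvariant (π : UnitaryRep 𝔤 m) {Y : Type} (X : Config n m → Y) : Prop :=
  ∀ Φ, IsConfig 𝓕 𝔤 Φ → ∀ θ, IsGroupField 𝔤 𝓕 θ → X (gauge 𝓕 π θ Φ) = X Φ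

variable (𝔤) in
/-- Dressing fields: group-valued functionals `u[A]` with `u[A^θ] = θ⁻¹ u[A]`. -/
def IsDressingField (u : Pot n → MatField n n) : Prop :=
  ∀ A, IsVectorField 𝔤 𝓕 A → IsGroupField 𝔤 𝓕 (u A) ∧
    ∀ θ, IsGroupField 𝔤 𝓕 θ → IsVectorField 𝔤 𝓕 (gaugeA θ A) ∧ u (gaugeA θ A) = θ⁻¹ * u A

/-! ### The functionals `S` and `V` of the potential, and the dressing factor -/

mutual

/-- The space of vector functionals spanned by `A_ν` and `∂_ν s`, and closed under the action of the
scalar functionals by `ad_{is} = i[s, ·]`. -/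
inductive IsV (c : Fin 4 → Distr ℝ) : (Pot n → Pot n) → Prop
  | potential : IsV c (fun A => A)
  | gradient (s : Pot n → MatField n n) : IsS c s → IsV c (fun A μ => partialD μ (s A))
  | ad (s : Pot n → MatField n n) (v : Pot n → Pot n) : IsS c s → IsV c v →
      IsV c (fun A μ => Complex.I • (s A * v A μ - v A μ * s A))
  | add (v w : Pot n → Pot n) : IsV c v → IsV c w → IsV c (fun A μ => v A μ + w A μ)
  | smul (r : ℝ) (v : Pot n → Pot n) : IsV c v → IsV c (fun A μ => r • v A μ)

/-- The space of scalar functionals spanned by the string integrals `I_c^ν(v_ν)`. (The string integral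
of a gradient `∂_ν s` is `-s` and adds nothing.) -/
inductive IsS (c : Fin 4 → Distr ℝ) : (Pot n → MatField n n) → Prop
  | string (v : Pot n → Pot n) : IsV c v → IsS c (fun A => stringInt c (v A))
  | add (s t : Pot n → MatField n n) : IsS c s → IsS c t → IsS c (fun A => s A + t A)
  | smul (r : ℝ) (s : Pot n → MatField n n) : IsS c s → IsS c (fun A => r • s A)

end

/-- Elements of `g S[[g]]`. -/
def InGS (c : Fin 4 → Distr ℝ) (γ : Pot n → MatField n n) : Prop :=
  ∃ s : ℕ → Pot n → MatField n n, (∀ k, IsS c (s k)) ∧ ∀ A, γ A = gsum fun k => s k A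

/-- Elements of `g V[[g]]`. -/
def InGV (c : Fin 4 → Distr ℝ) (α : Pot n → Pot n) : Prop :=
  ∃ v : ℕ → Pot n → Pot n, (∀ k, IsV c (v k)) ∧ ∀ A μ, α A μ = gsum fun k => v k A μ

/-- `W = e^{iγ}`. -/
def dressingFactor (γ : Pot n → MatField n n) (A : Pot n) : MatField n n :=
  fexp (Complex.I • γ A)

variable (𝔤) in
/-- `γ ∈ g S[[g]]` is the exponent of the dressing factor `W = e^{iγ}`, which is characterized by
`I_c^μ(W (g A_μ + i ∂_μ) W⁻¹) = 0`. -/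
structure IsDressingExponent (γ : Pot n → MatField n n) : Prop where
  mem : InGS c γ
  string_eq : ∀ A, IsVectorField 𝔤 𝓕 A →
    stringInt c (fun μ => g • (dressingFactor γ A * A μ * (dressingFactor γ A)⁻¹) +
      Complex.I • (dressingFactor γ A * partialD μ (dressingFactor γ A)⁻¹)) = 0

/-! ### Propagators, two-point obstructions and the obstruction map

All two-point quantities depend on `x' - x`, and are written as distributions in this variable. -/

/-- `T` is a propagator of the Klein-Gordon equation: `(□ + M²) T = -i δ`. -/
def IsPropagator (M : ℝ) (T : Distr ℂ) : Prop :=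
  ∀ h : Test, (∑ μ, η μ • pd μ (pd μ T)) h + (M : ℂ) ^ 2 * T h = -Complex.I * h 0

/-- The propagator `⟨T A_μ(x') A^κ(x)⟩ = -δ_μ^κ T₀(x' - x)` of the gauge potential. -/
def propAA (T₀ : Distr ℂ) (μ κ : Fin 4) : Distr ℂ := if μ = κ then -T₀ else 0

/-- The propagator `⟨T F_{μν}(x') A^κ(x)⟩`, where `F_{μν} = ∂_μ A_ν - ∂_ν A_μ`. -/
def propFA (T₀ : Distr ℂ) (μ ν κ : Fin 4) : Distr ℂ :=
  pd μ (propAA T₀ ν κ) - pd ν (propAA T₀ μ κ)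

/-- The propagator `⟨T N(x') A^κ(x)⟩`, where `N = ∂_μ A^μ`. -/
def propNA (T₀ : Distr ℂ) (κ : Fin 4) : Distr ℂ := ∑ μ, η μ • pd μ (propAA T₀ μ κ)

/-- The two-point obstruction
`O_μ(F^{μν}(x'), A^κ(x)) = ⟨T ∂'_μ F^{μν}(x') A^κ(x)⟩ - ∂'_μ ⟨T F^{μν}(x') A^κ(x)⟩`,
where `∂_μ F^{μν} = -∂^ν N` is the field equation. -/
def obstrFA (T₀ : Distr ℂ) (ν κ : Fin 4) : Distr ℂ :=
  -(η ν • pd ν (propNA T₀ κ)) - ∑ μ, (η μ * η ν) • pd μ (propFA T₀ μ ν κ)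

/-- Dirac matrices: `γ^μ γ^ν + γ^ν γ^μ = 2 η^{μν}`. -/
def IsDirac (Γ : Fin 4 → Matrix (Fin 4) (Fin 4) ℂ) : Prop :=
  ∀ μ ν, Γ μ * Γ ν + Γ ν * Γ μ = if μ = ν then (2 * η μ : ℂ) • 1 else 0

/-- The propagator `⟨T ψ_j(x) \bar ψ_i(x')⟩` of the Dirac field of mass `M`, in terms of the scalar
propagator `T` of mass `M`. -/
def propDirac (Γ : Fin 4 → Matrix (Fin 4) (Fin 4) ℂ) (M : ℝ) (T : Distr ℂ) (j i : Fin 4) : Distr ℂ :=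
  -(∑ μ, (Complex.I * Γ μ j i) • pd μ T) + (if j = i then M • T else 0)

/-- The two-point obstruction
`⟨T ψ_j(x) ∂'_μ(\bar ψ γ^μ)_i(x')⟩ - ∂'_μ ⟨T ψ_j(x) (\bar ψ γ^μ)_i(x')⟩`, where
`∂_μ \bar ψ γ^μ = i M \bar ψ` is the field equation. -/
def obstrDirac (Γ : Fin 4 → Matrix (Fin 4) (Fin 4) ℂ) (M : ℝ) (T : Distr ℂ) (j i : Fin 4) : Distr ℂ :=
  (Complex.I * M) • propDirac Γ M T j i -
    ∑ μ, ∑ k, Γ μ k i • pd μ (propDirac Γ M T j k)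

/-- The data of the free quantum fields that enter the obstruction map: the massless propagator, and for
the quarks the Dirac matrices, the mass, and the scalar propagator of this mass. -/
structure FreeFields where
  T₀ : Distr ℂ
  gluon : IsPropagator 0 T₀
  Γ : Fin 4 → Matrix (Fin 4) (Fin 4) ℂ
  dirac : IsDirac Γ
  M : ℝ
  T : Distr ℂ
  quark : IsPropagator M T

/-- The values `ω(A_κ)` and `ω(ψ)` on the generating fields of the obstruction map
`ω(X)(x) = i ∫ d⁴x' O_μ(U^μ(x') + Ũ^μ(x'), X(x))` with mediator fields `U^μ = ⟨F^{μν} | α_ν⟩` and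
`Ũ^μ = \bar ψ γ^μ π(β) ψ`: the fields `α`, `β` are inert, hence
`ω(A^κ)(x) = i ∫ d⁴x' α_ν(x') O_μ(F^{μν}(x'), A^κ(x))`, and `ω(ψ)` arises by the contractions of `ψ` with
the factor `\bar ψ γ^μ` of `Ũ^μ`. -/
def obstrGen (Q : FreeFields) (π : UnitaryRep 𝔤 m) (α : Pot n → Pot n) (β : Pot n → MatField n n)
    (Φ : Config n m) : Config n m :=
  (fun κ => η κ • Matrix.of fun i j =>
      pairing (fun ν => Complex.I • obstrFA Q.T₀ ν κ) fun ν => α Φ.1 ν i j,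
    Matrix.of fun a j =>
      pairing (fun i => Complex.I • obstrDirac Q.Γ Q.M Q.T j i) fun i => (lieRep π (β Φ.1) * Φ.2) a i)

/-- The obstruction map `ω`. By the tree-level Wick expansion, `ω(X)` is obtained from a functional `X` of
the fields by substituting successively each factor `A_κ`, `ψ` (also under derivatives and string
integrals) by `ω(A_κ)`, `ω(ψ)`, i.e., it is the functional derivative of `X` in the direction of the
latter. It is used for `A(c)`, `ψ` and the fields generated by its iteration on them, in which the
combinations `□ A` and `∂_μ A^μ`, affected by field equations, do not occur. -/
def obstr (Q : FreeFields) (π : UnitaryRep 𝔤 m) (α : Pot n → Pot n) (β : Pot n → MatField n n)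
    {p q : ℕ} (X : Config n m → MatField p q) : Config n m → MatField p q := fun Φ =>
  Matrix.of fun i j => PowerSeries.mk fun N x =>
    deriv (fun t : ℝ => PowerSeries.coeff N (X (Φ + t • obstrGen Q π α β Φ) i j) x) 0

/-- The dressed field `e^ω(X) = ∑_k ω^k(X) / k!`; as `α` and `β` are of order `g`, the terms `k > N` do not
contribute to the order `g^N`. -/
def dressed (Q : FreeFields) (π : UnitaryRep 𝔤 m) (α : Pot n → Pot n) (β : Pot n → MatField n n)
    {p q : ℕ} (X : Config n m → MatField p q) : Config n m → MatField p q := fun Φ =>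
  Matrix.of fun i j => PowerSeries.mk fun N =>
    ∑ k ∈ Finset.range (N + 1),
      ((k.factorial : ℂ)⁻¹) • PowerSeries.coeff N (((obstr Q π α β)^[k] X) Φ i j)

/-- The string-localized potential `A_μ(c) = I_c^ν(F_{μν})`, `F_{μν} = ∂_μ A_ν - ∂_ν A_μ`. -/
def stringPot (c : Fin 4 → Distr ℝ) (μ : Fin 4) (Φ : Config n m) : MatField n n :=
  stringInt c fun ν => partialD μ (Φ.1 ν) - partialD ν (Φ.1 μ)

/-- The quark field `ψ`. -/
def quark (Φ : Config n m) : MatField m 4 := Φ.2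

end SQFT

end

open Finset.HasAntidiagonal (antidiagonal mem_antidiagonal)

noncomputable section

namespace SQFT

/-! ### Differentiating the pairing of a distribution with a translated function -/

-- Multiply potentials by g: a gauge transformation acts on a = gA by a ↦ V a V⁻¹ + i V ∂V⁻¹
-- (`gact`), without negative powers of g. From ∂c = δ one gets I_c(∂X) = -X by integration by parts
-- (`realInt_gradient`), and string integration commutes with derivatives (`fderiv_realInt`). The
-- rest is algebra, with convergence understood g-adically.
--
-- Dressing factor. For W = e^{iX} the defining condition reads X = `exponentStep` X, and this map
-- gains a power of g on differences (`RepS.exponentStep_sub`). Iteration from 0 converges, within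
-- the functionals generated from A by string integrals, gradients and brackets
-- (`exists_fixedPoint`). For uniqueness, if a factor 1 + O(g^k) maps a potential with vanishing
-- string integral to another one, then the string integral shows that it is 1 + O(g^{k+1})
-- (`eq_one_of_stringInt_gact`). Since W[A]θ solves the condition for A^θ, uniqueness gives W[A^θ] =
-- W[A]θ, which is the dressing field property and the source of all invariance. For quarks this
-- relation is carried to π without the Baker-Campbell-Hausdorff formula: logarithmic derivatives
-- with respect to g are 𝔤-valued and given by brackets, and they determine the group element
-- (`fexp_lieRep_mul`).
--
-- Obstruction map. The two-point obstructions are delta functions, so ω(A) = α and ω(ψ) = iπ(β)ψ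
-- (`obstrFA_eq`, `obstrDirac_eq`); take β = γ. Put P B = B + ∂I_c(B), so that gA(c) = P(gA), and
-- let D = W(gA + i∂)W⁻¹, G = gA(c) - D, Y = W(gα)W⁻¹. If I_c(Y) = 0, then W also solves the
-- condition at A + tα, hence γ is constant in this direction (`IsDressingExponent.apply_add`). It
-- follows that ω^k(ψ) = (iπ(γ))^k ψ, which sums to π(W)ψ. With x = P(Ad(W⁻¹) - 1), an operator
-- depending on γ only, one has ω(D) = Y, ω(gA(c)) = P(W⁻¹YW) = (1 + x)Y and ω(G) = xY.
--
-- The ansatz Y = φ(x)G turns ω into multiplication by xφ(x) on series in x applied to G, so that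
-- e^ω(gA(c)) = gA(c) + x⁻¹(e^{xφ(x)} - 1)(1 + x)G. This equals D = gA(c) - G precisely for
-- e^{xφ(x)} = (1 + x)⁻¹, that is φ(x) = -log(1 + x)/x (`logQuot`). The series makes sense because x
-- raises the order in g. Since A(c) and the dressed potential agree to leading order, G = O(g²),
-- hence α = O(g) as required (`rep_gap`, `rep_dir`).

theorem natCast_le_infty (n : ℕ) : (n : WithTop ℕ∞) ≤ ∞ := by exact_mod_cast le_top

section Translation

variable {E : Type} [NormedAddCommGroup E] [NormedSpace ℝ E]

theorem fderiv_fderiv_apply_comm {F : Type} [NormedAddCommGroup F] [NormedSpace ℝ F] {f : E → F}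
    (hf : ContDiff ℝ ∞ f) (w : E) :
    fderiv ℝ (fun y => fderiv ℝ f y w) = fun y => fderiv ℝ (fderiv ℝ f) y w := by
  funext y
  ext v
  have h1 : DifferentiableAt ℝ (fderiv ℝ f) y :=
    ((hf.fderiv_right (m := 1) (natCast_le_infty 2)).differentiable
      one_ne_zero) y
  have h2 : IsSymmSndFDerivAt ℝ f y := hf.contDiffAt.isSymmSndFDerivAt
    (by simpa using natCast_le_infty 2)
  rw [fderiv_clm_apply h1 (differentiableAt_const w)]
  simpa using h2 v w

/-- Symmetry of the second derivative lets w pass through one derivative at a time. The codomain is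
quantified inside the statement because the induction step replaces f by its derivative. -/
theorem iteratedFDeriv_fderiv_apply (w : E) (j : ℕ) :
    ∀ {F : Type} [NormedAddCommGroup F] [NormedSpace ℝ F] {f : E → F}, ContDiff ℝ ∞ f → ∀ z,
      iteratedFDeriv ℝ j (fun y => fderiv ℝ f y w) z = fderiv ℝ (iteratedFDeriv ℝ j f) z w := by
  induction j with
  | zero =>
    intro F _ _ f hf z
    ext m
    have h0 : iteratedFDeriv ℝ 0 f = fun x => (continuousMultilinearCurryFin0 ℝ E F).symm (f x) := by
      funext x; rw [iteratedFDeriv_zero_eq_comp]; rfl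
    have hd : DifferentiableAt ℝ f z := (hf.differentiable (by simp)) z
    rw [iteratedFDeriv_zero_apply, h0]
    have := ((continuousMultilinearCurryFin0 ℝ E F).symm.toContinuousLinearEquiv.toContinuousLinearMap.hasFDerivAt.comp z
      hd.hasFDerivAt).fderiv
    rw [show (fun x => (continuousMultilinearCurryFin0 ℝ E F).symm (f x)) = (⇑((continuousMultilinearCurryFin0 ℝ E F).symm.toContinuousLinearEquiv.toContinuousLinearMap) ∘ f) from rfl, this]
    simp
  | succ j ih =>
    intro F _ _ f hf z
    have hf' : ContDiff ℝ ∞ (fderiv ℝ f) := hf.fderiv_right (by simp)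
    have hd : DifferentiableAt ℝ (iteratedFDeriv ℝ j (fderiv ℝ f)) z :=
      (hf'.differentiable_iteratedFDeriv (by exact_mod_cast WithTop.coe_lt_top j)) z
    have h1 : ∀ {h : E → F}, iteratedFDeriv ℝ (j + 1) h =
        fun x => (continuousMultilinearCurryRightEquiv' ℝ j E F).symm
          (iteratedFDeriv ℝ j (fderiv ℝ h) x) := by
      intro h; funext x; rw [iteratedFDeriv_succ_eq_comp_right]; rfl
    have := (((continuousMultilinearCurryRightEquiv' ℝ j E F).symm.toContinuousLinearEquiv.toContinuousLinearMap).hasFDerivAt.comp z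
      hd.hasFDerivAt).fderiv
    rw [h1, h1, fderiv_fderiv_apply_comm hf]
    beta_reduce
    rw [ih hf' z]
    rw [show (fun x => (continuousMultilinearCurryRightEquiv' ℝ j E F).symm
          (iteratedFDeriv ℝ j (fderiv ℝ f) x)) = (⇑((continuousMultilinearCurryRightEquiv' ℝ j E F).symm.toContinuousLinearEquiv.toContinuousLinearMap) ∘ (iteratedFDeriv ℝ j (fderiv ℝ f))) from rfl, this]
    rfl

/-- Difference quotients of `C¹` functions converge uniformly on compact sets. -/
theorem eventually_norm_diffQuot_le {F : Type} [NormedAddCommGroup F] [NormedSpace ℝ F] {G : E → F}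
    (hG : ContDiff ℝ 1 G) {K : Set E} (hK : IsCompact K) (w : E) {ε : ℝ} (hε : 0 < ε) :
    ∀ᶠ t in 𝓝[≠] (0 : ℝ), ∀ z ∈ K, ‖t⁻¹ • (G (z + t • w) - G z) - fderiv ℝ G z w‖ ≤ ε := by
  have key : ∀ᶠ t in 𝓝 (0 : ℝ), ∀ z ∈ K,
      ‖G (z + t • w) - G z - t • fderiv ℝ G z w‖ ≤ ε * |t| := by
    refine hK.eventually_forall_of_forall_eventually fun y _ => ?_
    obtain ⟨δ, hδ, hδε⟩ : ∃ δ > 0, δ * ‖w‖ + δ * ‖w‖ ≤ ε := by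
      refine ⟨ε / (2 * (‖w‖ + 1)), by positivity, ?_⟩
      have : ε / (2 * (‖w‖ + 1)) * (2 * (‖w‖ + 1)) = ε := by field_simp
      have h2 : 0 < ε / (2 * (‖w‖ + 1)) := by positivity
      nlinarith
    have h1 := (hG.contDiffAt (x := y)).hasStrictFDerivAt one_ne_zero
    have h2 := h1.isLittleO.def hδ
    have h3 : Tendsto (fun z : ℝ × E => (z.2 + z.1 • w, z.2)) (𝓝 (0, y)) (𝓝 (y, y)) := by
      have : Continuous (fun z : ℝ × E => (z.2 + z.1 • w, z.2)) := by fun_prop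
      simpa using this.tendsto (0, y)
    have h4 : ∀ᶠ z : ℝ × E in 𝓝 (0, y), ‖fderiv ℝ G z.2 - fderiv ℝ G y‖ < δ := by
      have hc : Continuous (fun z : ℝ × E => ‖fderiv ℝ G z.2 - fderiv ℝ G y‖) :=
        (((hG.continuous_fderiv one_ne_zero).comp continuous_snd).sub continuous_const).norm
      have := hc.tendsto (0, y)
      exact this.eventually (gt_mem_nhds (by simpa using hδ))
    filter_upwards [h3.eventually h2, h4] with z hz hz'
    have e1 : G (z.2 + z.1 • w) - G z.2 - z.1 • fderiv ℝ G z.2 w =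
      (G (z.2 + z.1 • w) - G z.2 - fderiv ℝ G y (z.2 + z.1 • w - z.2)) -
        (fderiv ℝ G z.2 - fderiv ℝ G y) (z.1 • w) := by
      simp only [add_sub_cancel_left, map_smul, sub_apply, smul_sub]
      abel
    rw [e1]
    refine (norm_sub_le _ _).trans ?_
    have h5 := ContinuousLinearMap.le_of_opNorm_le (fderiv ℝ G z.2 - fderiv ℝ G y) hz'.le (z.1 • w)
    simp only [add_sub_cancel_left, norm_smul, Real.norm_eq_abs] at hz h5 ⊢
    nlinarith [abs_nonneg z.1]
  filter_upwards [nhdsWithin_le_nhds key, self_mem_nhdsWithin] with t ht ht0 z hz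
  have ht0' : t ≠ 0 := ht0
  have : t⁻¹ • (G (z + t • w) - G z) - fderiv ℝ G z w =
      t⁻¹ • (G (z + t • w) - G z - t • fderiv ℝ G z w) := by
    rw [smul_sub t⁻¹ (G (z + t • w) - G z), smul_smul, inv_mul_cancel₀ ht0', one_smul]
  rw [this, norm_smul, norm_inv, Real.norm_eq_abs]
  have h6 := ht z hz
  have h7 : 0 < |t| := abs_pos.mpr ht0'
  calc |t|⁻¹ * _ ≤ |t|⁻¹ * (ε * |t|) := by gcongr
    _ = ε := by field_simp

end Translation

theorem contDiff_fderiv_apply {f : Spacetime → ℝ} (hf : ContDiff ℝ ∞ f) (w : Spacetime) :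
    ContDiff ℝ ∞ (fun y => fderiv ℝ f y w) :=
  (hf.fderiv_right (by simp)).clm_apply contDiff_const

theorem cutoff_apply (h : Test) (k : ℕ) {f : Spacetime → ℝ} (hf : ContDiff ℝ ∞ f) (x y : Spacetime) :
    cutoff h k hf x y = h (((k : ℝ) + 1)⁻¹ • y) * f (x + y) := rfl

/-- The difference quotients of the translated function, times the fixed cutoff, converge in the
topology of test functions supported in one compact set; then continuity of T applies. -/
theorem hasDerivAt_cutoff {F : Type} [NormedAddCommGroup F] [NormedSpace ℝ F] (T : Distr F) (h : Test)
    (k : ℕ) {f : Spacetime → ℝ} (hf : ContDiff ℝ ∞ f) (x w : Spacetime) :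
    HasDerivAt (fun t : ℝ => T (cutoff h k hf (x + t • w)))
      (T (cutoff h k (contDiff_fderiv_apply hf w) x)) 0 := by
  set χ : Spacetime → ℝ := fun y => h (((k : ℝ) + 1)⁻¹ • y) with hχ
  have hχs : ContDiff ℝ ∞ χ := h.contDiff.comp (contDiff_const_smul _)
  have hk : ((k : ℝ) + 1)⁻¹ ≠ 0 := by positivity
  have hχc : HasCompactSupport χ := h.hasCompactSupport.comp_smul hk
  -- The cutoff depends on y and not on x, so this compact set serves for all t.
  let K : TopologicalSpace.Compacts Spacetime := ⟨tsupport χ, hχc⟩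
  let B : ∀ q : Spacetime → ℝ, ContDiff ℝ ∞ q → 𝓓_{K}(Spacetime, ℝ) := fun q hq =>
    ContDiffMapSupportedIn.of_support_subset (f := fun y => χ y * q y) (hχs.mul hq)
      ((Function.support_mul_subset_left _ _).trans (subset_tsupport χ))
  let Ψ : 𝓓_{K}(Spacetime, ℝ) →L[ℝ] F :=
    (show 𝓓((⊤ : TopologicalSpace.Opens Spacetime), ℝ) →L[ℝ] F from T).comp
      (TestFunction.ofSupportedInCLM ℝ (by simp))
  have htr : ∀ {f : Spacetime → ℝ}, ContDiff ℝ ∞ f → ∀ x, ContDiff ℝ ∞ (fun y => f (x + y)) :=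
    fun hf x => hf.comp (contDiff_const.add contDiff_id)
  have hΨ : ∀ {f : Spacetime → ℝ} (hf : ContDiff ℝ ∞ f) x,
      T (cutoff h k hf x) = Ψ (B _ (htr hf x)) := fun hf x => rfl
  simp only [hΨ]
  rw [hasDerivAt_iff_tendsto_slope]
  have hs : slope (fun t : ℝ => Ψ (B _ (htr hf (x + t • w)))) 0 =
      fun t : ℝ => Ψ (t⁻¹ • (B _ (htr hf (x + t • w)) - B _ (htr hf (x + (0 : ℝ) • w)))) := by
    funext t
    rw [slope_def_module, map_smul, map_sub, sub_zero]
  rw [hs]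
  refine (Ψ.continuous.tendsto _).comp ?_
  rw [(ContDiffMapSupportedIn.withSeminorms ℝ Spacetime ℝ ⊤ K).tendsto_nhds]
  intro n ε hε
  have hdf := contDiff_fderiv_apply hf w
  have hbd : ∀ i : ℕ, ∃ M : ℝ, 0 ≤ M ∧ ∀ y ∈ tsupport χ, ‖iteratedFDeriv ℝ i χ y‖ ≤ M := by
    intro i
    obtain ⟨M, hM⟩ := hχc.isCompact.exists_bound_of_continuousOn
      ((hχs.continuous_iteratedFDeriv (m := i) (by exact_mod_cast le_top)).continuousOn)
    exact ⟨|M|, abs_nonneg _, fun y hy => (hM y hy).trans (le_abs_self M)⟩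
  choose M hM0 hM using hbd
  set S : ℝ := ∑ i ∈ Finset.range (n + 1), (n.choose i : ℝ) * M i with hS
  have hS0 : 0 ≤ S := Finset.sum_nonneg fun i _ => mul_nonneg (by positivity) (hM0 i)
  -- S collects the Leibniz constants of the n-th seminorm; with this δ the error S * δ stays below
  -- ε.
  set δ : ℝ := ε / 2 / (S + 1) with hδdef
  have hδ : 0 < δ := by positivity
  have hev : ∀ᶠ t in 𝓝[≠] (0 : ℝ), ∀ j ∈ Finset.range (n + 1), ∀ z ∈ (fun y => x + y) '' tsupport χ,
      ‖t⁻¹ • (iteratedFDeriv ℝ j f (z + t • w) - iteratedFDeriv ℝ j f z) -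
        fderiv ℝ (iteratedFDeriv ℝ j f) z w‖ ≤ δ := by
    rw [Finset.eventually_all]
    intro j _
    refine eventually_norm_diffQuot_le ?_ (hχc.isCompact.image (by fun_prop)) w hδ
    exact hf.iteratedFDeriv_right (m := 1) (by exact_mod_cast le_top)
  filter_upwards [hev] with t ht
  let q : Spacetime → ℝ := fun y => t⁻¹ • (f (x + t • w + y) - f (x + y)) - fderiv ℝ f (x + y) w
  have hq1 : ContDiff ℝ ∞ (fun y => f (x + t • w + y) - f (x + y)) :=
    (htr hf (x + t • w)).sub (htr hf x)
  have hq : ContDiff ℝ ∞ q := (hq1.const_smul t⁻¹).sub (htr hdf x)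
  have hBq : t⁻¹ • (B _ (htr hf (x + t • w)) - B _ (htr hf (x + (0 : ℝ) • w))) - B _ (htr hdf x) =
      B q hq := by
    ext y
    change t⁻¹ * (χ y * f (x + t • w + y) - χ y * f (x + (0 : ℝ) • w + y)) -
      χ y * fderiv ℝ f (x + y) w = χ y * (t⁻¹ * (f (x + t • w + y) - f (x + y)) - fderiv ℝ f (x + y) w)
    rw [zero_smul, add_zero]
    ring
  rw [hBq]
  refine lt_of_le_of_lt (b := S * δ) ?_ ?_
  · rw [ContDiffMapSupportedIn.seminorm_top_le_iff ℝ (by positivity)]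
    intro y hy
    have hy' : y ∈ tsupport χ := hy
    have hle := norm_iteratedFDeriv_mul_le hχs hq y (n := n) (by exact_mod_cast le_top)
    refine hle.trans ?_
    rw [hS, Finset.sum_mul]
    refine Finset.sum_le_sum fun i hi => ?_
    have hj : n - i ∈ Finset.range (n + 1) := by simp
    have hqj : iteratedFDeriv ℝ (n - i) q y = t⁻¹ • (iteratedFDeriv ℝ (n - i) f (x + y + t • w) -
        iteratedFDeriv ℝ (n - i) f (x + y)) - fderiv ℝ (iteratedFDeriv ℝ (n - i) f) (x + y) w := by
      have hle' := natCast_le_infty (n - i)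
      have a1 : ContDiffAt ℝ (n - i : ℕ) (fun y => t⁻¹ • (f (x + t • w + y) - f (x + y))) y :=
        ((hq1.const_smul t⁻¹).of_le hle').contDiffAt
      have a2 : ContDiffAt ℝ (n - i : ℕ) (fun y => fderiv ℝ f (x + y) w) y :=
        ((htr hdf x).of_le hle').contDiffAt
      have a3 := ((htr hf (x + t • w)).of_le hle').contDiffAt (x := y)
      have a4 := ((htr hf x).of_le hle').contDiffAt (x := y)
      rw [show q = fun y => t⁻¹ • (f (x + t • w + y) - f (x + y)) - fderiv ℝ f (x + y) w from rfl,
        fun_iteratedFDeriv_sub_apply a1 a2,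
        iteratedFDeriv_const_smul_apply' ((hq1.of_le hle').contDiffAt),
        fun_iteratedFDeriv_sub_apply a3 a4, iteratedFDeriv_comp_add_left, iteratedFDeriv_comp_add_left,
        iteratedFDeriv_comp_add_left (f := fun y => fderiv ℝ f y w),
        iteratedFDeriv_fderiv_apply w _ hf, add_right_comm]
    have h2 := ht _ hj (x + y) ⟨y, hy', rfl⟩
    rw [← hqj] at h2
    have h3 := hM i y hy'
    have h4 := hM0 i
    gcongr
  · rw [hδdef]
    have : S * (ε / 2 / (S + 1)) ≤ ε / 2 := by
      rw [mul_div_assoc', div_le_iff₀ (by positivity)]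
      nlinarith
    linarith

/-! ### Uniqueness and linearity of the pairing -/

theorem exists_test_eq_one : ∃ h : Test, h 0 = 1 := by
  let b : ContDiffBump (0 : Spacetime) := ⟨1, 2, one_pos, one_lt_two⟩
  refine ⟨⟨b, b.contDiff, b.hasCompactSupport, by simp⟩, ?_⟩
  exact b.one_of_mem_closedBall (by simp [b.rIn_pos.le])

section Pairing

variable {F : Type} [NormedAddCommGroup F] [NormedSpace ℝ F]

theorem IsPairing.tendsto {T : Fin 4 → Distr F} {v : Fin 4 → Spacetime → ℝ} {I : Spacetime → F}
    (hI : IsPairing T v I) (hv : ∀ μ, ContDiff ℝ ∞ (v μ)) (h : Test) (x : Spacetime) :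
    Tendsto (fun k : ℕ => ∑ μ, T μ (cutoff h k (hv μ) x)) atTop (𝓝 (h 0 • I x)) := by
  obtain ⟨hv', hI⟩ := hI
  exact (tendstoLocallyUniformlyOn_univ.2 (hI h)).tendsto_at (Set.mem_univ x)

/-- A test function with h(0) = 1 recovers I as a limit, so the chosen value in `pairingReal` is
canonical. -/
theorem IsPairing.eq {T : Fin 4 → Distr F} {v : Fin 4 → Spacetime → ℝ} {I I' : Spacetime → F}
    (hI : IsPairing T v I) (hI' : IsPairing T v I') : I = I' := by
  obtain ⟨h, hh⟩ := exists_test_eq_one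
  obtain ⟨hv, _⟩ := id hI
  funext x
  have := tendsto_nhds_unique (hI.tendsto hv h x) (hI'.tendsto hv h x)
  simpa [hh] using this

theorem cutoff_add (h : Test) (k : ℕ) {f f' : Spacetime → ℝ} (hf : ContDiff ℝ ∞ f)
    (hf' : ContDiff ℝ ∞ f') (hs : ContDiff ℝ ∞ (f + f')) (x : Spacetime) :
    cutoff h k hs x = cutoff h k hf x + cutoff h k hf' x := by
  ext y
  change _ * (f (x + y) + f' (x + y)) = _ * f (x + y) + _ * f' (x + y)
  ring

theorem cutoff_smul (h : Test) (k : ℕ) {f : Spacetime → ℝ} (hf : ContDiff ℝ ∞ f) (r : ℝ)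
    (hs : ContDiff ℝ ∞ (r • f)) (x : Spacetime) :
    cutoff h k hs x = r • cutoff h k hf x := by
  ext y
  change _ * (r * f (x + y)) = r * (_ * f (x + y))
  ring

theorem IsPairing.add {T : Fin 4 → Distr F} {v v' : Fin 4 → Spacetime → ℝ} {I I' : Spacetime → F}
    (hI : IsPairing T v I) (hI' : IsPairing T v' I') : IsPairing T (v + v') (I + I') := by
  obtain ⟨hv, hI⟩ := hI
  obtain ⟨hv', hI'⟩ := hI'
  refine ⟨fun μ => (hv μ).add (hv' μ), fun h => ?_⟩
  have := (hI h).add (hI' h)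
  convert this using 1
  · funext k x
    simp only [Pi.add_apply]
    rw [← Finset.sum_add_distrib]
    refine Finset.sum_congr rfl fun μ _ => ?_
    rw [← map_add, ← cutoff_add]
  · funext x; simp

theorem IsPairing.smul {T : Fin 4 → Distr F} {v : Fin 4 → Spacetime → ℝ} {I : Spacetime → F}
    (r : ℝ) (hI : IsPairing T v I) : IsPairing T (r • v) (r • I) := by
  obtain ⟨hv, hI⟩ := hI
  refine ⟨fun μ => (hv μ).const_smul r, fun h => ?_⟩
  have := UniformContinuous.comp_tendstoLocallyUniformly
    (uniformContinuous_const_smul (X := F) r) (hI h)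
  convert this using 1
  · funext k x
    simp only [Function.comp, Finset.smul_sum]
    refine Finset.sum_congr rfl fun μ _ => ?_
    rw [← map_smul, ← cutoff_smul]
  · funext x; simp [smul_comm r]

theorem IsPairing.toComplex {T : Fin 4 → Distr ℝ} {v : Fin 4 → Spacetime → ℝ} {I : Spacetime → ℝ}
    (hI : IsPairing T v I) : IsPairing (fun μ => toComplex (T μ)) v (fun x => (I x : ℂ)) := by
  obtain ⟨hv, hI⟩ := hI
  refine ⟨hv, fun h => ?_⟩
  have := UniformContinuous.comp_tendstoLocallyUniformly
    (Complex.ofRealCLM.uniformContinuous) (hI h)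
  convert this using 1
  · funext k x
    simp [SQFT.toComplex]
  · funext x; simp

theorem pairingReal_eq {T : Fin 4 → Distr ℂ} {v : Fin 4 → Spacetime → ℝ} {I : Spacetime → ℂ}
    (hI : IsPairing T v I) : pairingReal T v = I := by
  have h : ∃ I, IsPairing T v I := ⟨I, hI⟩
  rw [pairingReal, dif_pos h]
  exact h.choose_spec.eq hI

/-- For multiples of δ the cutoff pairings do not depend on the cutoff radius, so no decay of v is
needed; smoothness suffices. This allows quark fields without decay. -/
theorem isPairing_of_delta {T : Fin 4 → Distr ℂ} {a : Fin 4 → ℂ} (hT : ∀ μ (h : Test), T μ h = a μ * h 0)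
    {v : Fin 4 → Spacetime → ℝ} (hv : ∀ μ, ContDiff ℝ ∞ (v μ)) :
    IsPairing T v (fun x => ∑ μ, a μ * v μ x) := by
  refine ⟨hv, fun h => ?_⟩
  have : (fun (k : ℕ) (x : Spacetime) => ∑ μ, T μ (cutoff h k (hv μ) x)) =
      fun _ x => h 0 • ∑ μ, a μ * (v μ x : ℂ) := by
    funext k x
    rw [Finset.smul_sum]
    refine Finset.sum_congr rfl fun μ _ => ?_
    rw [hT, cutoff_apply]
    simp
    ring
  rw [this]
  exact fun u hu x => ⟨Set.univ, by simp, Eventually.of_forall fun _ _ _ => refl_mem_uniformity hu⟩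

theorem pairingComplex_of_delta {T : Fin 4 → Distr ℂ} {a : Fin 4 → ℂ}
    (hT : ∀ μ (h : Test), T μ h = a μ * h 0) {v : Fin 4 → Spacetime → ℂ}
    (hv : ∀ μ, ContDiff ℝ ∞ (v μ)) :
    pairingComplex T v = fun x => ∑ μ, a μ * v μ x := by
  funext x
  have h1 : ∀ μ, ContDiff ℝ ∞ (fun y => (v μ y).re) := fun μ => Complex.reCLM.contDiff.comp (hv μ)
  have h2 : ∀ μ, ContDiff ℝ ∞ (fun y => (v μ y).im) := fun μ => Complex.imCLM.contDiff.comp (hv μ)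
  rw [pairingComplex, pairingReal_eq (isPairing_of_delta hT h1),
    pairingReal_eq (isPairing_of_delta hT h2), Finset.mul_sum, ← Finset.sum_add_distrib]
  refine Finset.sum_congr rfl fun μ _ => ?_
  conv_rhs => rw [← Complex.re_add_im (v μ x)]
  ring

end Pairing

/-! ### String integration of real functions -/

variable {c : Fin 4 → Distr ℝ} (𝓕 : FieldSpace c)

theorem FieldSpace.contDiff_vectors {v : Fin 4 → Spacetime → ℝ} (hv : v ∈ 𝓕.vectors) (μ : Fin 4) :
    ContDiff ℝ ∞ (v μ) := 𝓕.smooth _ (𝓕.component_mem v hv μ)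

/-- The string integration of real vector functions. -/
def FieldSpace.realInt : 𝓕.vectors →ₗ[ℝ] Spacetime → ℝ where
  toFun v := (𝓕.string_mem v v.2).choose
  map_add' v w := (𝓕.string_mem _ (v + w).2).choose_spec.2.eq
    ((𝓕.string_mem v v.2).choose_spec.2.add (𝓕.string_mem w w.2).choose_spec.2)
  map_smul' r v := (𝓕.string_mem _ (r • v).2).choose_spec.2.eq
    ((𝓕.string_mem v v.2).choose_spec.2.smul r)

theorem FieldSpace.realInt_mem (v : 𝓕.vectors) : 𝓕.realInt v ∈ 𝓕.scalars :=
  (𝓕.string_mem v v.2).choose_spec.1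

theorem FieldSpace.isPairing_realInt (v : 𝓕.vectors) : IsPairing c v (𝓕.realInt v) :=
  (𝓕.string_mem v v.2).choose_spec.2

variable {𝓕}

/-- Product rule: the derivative on the rescaled cutoff costs a factor 1/R, which is the boundary
term that `FieldSpace.decay` controls. -/
theorem lineDeriv_cutoff (h : Test) (k : ℕ) {f : Spacetime → ℝ} (hf : ContDiff ℝ ∞ f) (x w : Spacetime) :
    (∂_{w} (cutoff h k hf x) : Test) =
      ((k : ℝ) + 1)⁻¹ • cutoff (∂_{w} h : Test) k hf x + cutoff h k (contDiff_fderiv_apply hf w) x := by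
  ext y
  have hd : ∀ (φ : Test) (z : Spacetime), (∂_{w} φ : Test) z = fderiv ℝ φ z w := by
    intro φ z
    rw [TestFunction.lineDerivOp_eq_lineDerivCLM ℝ, TestFunction.lineDerivCLM_eq_fderivCLM]
    simp
  rw [hd]
  change fderiv ℝ (fun y => h (((k : ℝ) + 1)⁻¹ • y) * f (x + y)) y w =
    ((k : ℝ) + 1)⁻¹ * ((∂_{w} h : Test) (((k : ℝ) + 1)⁻¹ • y) * f (x + y)) +
      h (((k : ℝ) + 1)⁻¹ • y) * fderiv ℝ f (x + y) w
  rw [hd]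
  have hh : DifferentiableAt ℝ h (((k : ℝ) + 1)⁻¹ • y) := (h.contDiff.differentiable (by simp)) _
  have hf' : DifferentiableAt ℝ f (x + y) := (hf.differentiable (by simp)) _
  have h1 : HasFDerivAt (fun y : Spacetime => h (((k : ℝ) + 1)⁻¹ • y))
      ((fderiv ℝ h (((k : ℝ) + 1)⁻¹ • y)).comp (((k : ℝ) + 1)⁻¹ • ContinuousLinearMap.id ℝ Spacetime)) y :=
    hh.hasFDerivAt.comp y ((((k : ℝ) + 1)⁻¹ • ContinuousLinearMap.id ℝ Spacetime).hasFDerivAt)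
  have h2 : HasFDerivAt (fun y : Spacetime => f (x + y))
      ((fderiv ℝ f (x + y)).comp (ContinuousLinearMap.id ℝ Spacetime)) y :=
    hf'.hasFDerivAt.comp y ((hasFDerivAt_id y).const_add x)
  rw [(h1.fun_mul h2).fderiv]
  simp
  ring

/-- Integration by parts against ∂c = δ; the terms where the derivative hits the cutoff tend to zero
by `FieldSpace.decay`. -/
theorem realInt_gradient (hc : IsStringFunction c) {s : Spacetime → ℝ} (hs : s ∈ 𝓕.scalars) :
    𝓕.realInt ⟨_, 𝓕.gradient_mem s hs⟩ = -s := by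
  obtain ⟨h, hh⟩ := exists_test_eq_one
  have hsm := 𝓕.smooth s hs
  funext x
  have h1 := (𝓕.isPairing_realInt ⟨_, 𝓕.gradient_mem s hs⟩).tendsto
    (fun μ => contDiff_fderiv_apply hsm (e μ)) h x
  have h2 : ∀ k : ℕ, ∑ μ, c μ (cutoff h k (contDiff_fderiv_apply hsm (e μ)) x) =
      -s x - ∑ μ, ((k : ℝ) + 1)⁻¹ * c μ (cutoff (∂_{e μ} h : Test) k hsm x) := by
    intro k
    have h3 := congrArg (fun T : Distr ℝ => T (cutoff h k hsm x)) hc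
    simp only [Distribution.delta_apply, cutoff_apply, smul_zero, hh, one_mul, add_zero] at h3
    rw [← h3, sum_apply, ← Finset.sum_neg_distrib, ← Finset.sum_sub_distrib]
    refine Finset.sum_congr rfl fun μ _ => ?_
    rw [pd, Distribution.lineDerivOp_apply_apply, map_neg, lineDeriv_cutoff, map_add, map_smul,
      smul_eq_mul]
    ring
  have h4 : Tendsto (fun k : ℕ => -s x - ∑ μ, ((k : ℝ) + 1)⁻¹ * c μ (cutoff (∂_{e μ} h : Test) k hsm x))
      atTop (𝓝 (-s x - ∑ μ : Fin 4, 0)) :=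
    tendsto_const_nhds.sub (tendsto_finsetSum _ fun μ _ => 𝓕.decay s hs μ _ x)
  simp only [h2] at h1
  have := tendsto_nhds_unique h1 h4
  simpa [hh] using this

/-- Locally uniform convergence of the pairings with both v and its derivative allows
differentiating the limit along the line x + t e_μ. -/
theorem fderiv_realInt (v : 𝓕.vectors) (μ : Fin 4) :
    (fun x => fderiv ℝ (𝓕.realInt v) x (e μ)) = 𝓕.realInt ⟨_, 𝓕.deriv_mem v v.2 μ⟩ := by
  obtain ⟨h, hh⟩ := exists_test_eq_one
  have hv := 𝓕.contDiff_vectors v.2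
  have hdv : ∀ ν, ContDiff ℝ ∞ (fun y => fderiv ℝ ((v : Fin 4 → Spacetime → ℝ) ν) y (e μ)) :=
    fun ν => contDiff_fderiv_apply (hv ν) _
  funext x
  obtain ⟨_, hL⟩ := 𝓕.isPairing_realInt v
  obtain ⟨_, hL'⟩ := 𝓕.isPairing_realInt ⟨_, 𝓕.deriv_mem v v.2 μ⟩
  have hline : Continuous (fun t : ℝ => x + t • e μ) := by fun_prop
  have key : HasDerivAt (fun t : ℝ => 𝓕.realInt v (x + t • e μ))
      (𝓕.realInt ⟨_, 𝓕.deriv_mem v v.2 μ⟩ (x + (0 : ℝ) • e μ)) 0 := by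
    refine hasDerivAt_of_tendstoLocallyUniformlyOn (l := atTop) (s := Set.univ) isOpen_univ
      (f := fun (k : ℕ) (t : ℝ) => ∑ ν, c ν (cutoff h k (hv ν) (x + t • e μ)))
      (f' := fun (k : ℕ) (t : ℝ) => ∑ ν, c ν (cutoff h k (hdv ν) (x + t • e μ)))
      (g' := fun t : ℝ => 𝓕.realInt ⟨_, 𝓕.deriv_mem v v.2 μ⟩ (x + t • e μ)) ?_ ?_ ?_ (Set.mem_univ _)
    · rw [tendstoLocallyUniformlyOn_univ]
      have := (hL' h).comp _ hline
      simpa [hh, Function.comp_def] using this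
    · refine Eventually.of_forall fun k t _ => HasDerivAt.fun_sum fun ν _ => ?_
      have h1 := hasDerivAt_cutoff (c ν) h k (hv ν) (x + t • e μ) (e μ)
      have h2 := HasDerivAt.comp t (h := fun r : ℝ => r - t) (h₂ := fun r : ℝ =>
        c ν (cutoff h k (hv ν) (x + t • e μ + r • e μ))) (by simpa using h1) ((hasDerivAt_id t).sub_const t)
      simp only [Function.comp_def, mul_one] at h2
      have h3 : ∀ r : ℝ, x + t • e μ + (r - t) • e μ = x + r • e μ := fun r => by module
      simpa only [h3] using h2
    · intro t _
      have := (tendstoLocallyUniformlyOn_univ.2 (hL h)).tendsto_at (Set.mem_univ (x + t • e μ))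
      simpa [hh] using this
  have hd : DifferentiableAt ℝ (𝓕.realInt v) (x + (0 : ℝ) • e μ) :=
    ((𝓕.smooth _ (𝓕.realInt_mem v)).differentiable (by simp)) _
  have h3 : HasDerivAt (fun t : ℝ => x + t • e μ) (e μ) 0 := by
    simpa using ((hasDerivAt_id (0 : ℝ)).smul_const (e μ)).const_add x
  have h4 := hd.hasFDerivAt.comp_hasDerivAt (0 : ℝ) h3
  have := h4.unique key
  simpa using this

/-! ### Two-point obstructions -/

section

variable {F : Type} [NormedAddCommGroup F] [NormedSpace ℝ F]

theorem pd_apply (μ : Fin 4) (T : Distr F) (h : Test) : pd μ T h = -T (∂_{e μ} h) := by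
  rw [pd, Distribution.lineDerivOp_apply_apply, map_neg]

theorem lineDeriv_test_apply (φ : Test) (w z : Spacetime) : (∂_{w} φ : Test) z = fderiv ℝ φ z w := by
  rw [TestFunction.lineDerivOp_eq_lineDerivCLM ℝ, TestFunction.lineDerivCLM_eq_fderivCLM]
  simp

theorem pd_comm (μ ν : Fin 4) (T : Distr F) : pd μ (pd ν T) = pd ν (pd μ T) := by
  ext h
  rw [pd_apply, pd_apply, pd_apply, pd_apply]
  congr 3
  ext z
  have h0 : ∀ w : Spacetime, ((∂_{w} h : Test) : Spacetime → ℝ) = fun y => fderiv ℝ h y w :=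
    fun w => funext fun y => lineDeriv_test_apply h w y
  have hs : IsSymmSndFDerivAt ℝ h z := h.contDiff.contDiffAt.isSymmSndFDerivAt
    (by simpa using natCast_le_infty 2)
  rw [lineDeriv_test_apply, lineDeriv_test_apply, h0, h0, fderiv_fderiv_apply_comm h.contDiff,
    fderiv_fderiv_apply_comm h.contDiff]
  exact hs _ _

theorem pd_neg (μ : Fin 4) (T : Distr F) : pd μ (-T) = -pd μ T := by
  ext h; simp [pd_apply]

theorem pd_add (μ : Fin 4) (T S : Distr F) : pd μ (T + S) = pd μ T + pd μ S := by
  ext h; simp [pd_apply]; abel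

theorem pd_sub (μ : Fin 4) (T S : Distr F) : pd μ (T - S) = pd μ T - pd μ S := by
  ext h; simp [pd_apply]; abel

theorem pd_sum {ι : Type} (s : Finset ι) (μ : Fin 4) (T : ι → Distr F) :
    pd μ (∑ i ∈ s, T i) = ∑ i ∈ s, pd μ (T i) := by
  ext h; simp [pd_apply]

theorem pd_zero (μ : Fin 4) : pd μ (0 : Distr F) = 0 := by
  ext h; simp [pd_apply]

theorem pd_smul (μ : Fin 4) (r : ℝ) (T : Distr F) : pd μ (r • T) = r • pd μ T := by
  ext h; simp [pd_apply]

theorem pd_csmul (μ : Fin 4) (a : ℂ) (T : Distr ℂ) : pd μ (a • T) = a • pd μ T := by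
  ext h; simp [pd_apply]

end

theorem η_mul_self (μ : Fin 4) : η μ * η μ = 1 := by
  unfold η; split_ifs <;> norm_num

theorem pd_propAA (T : Distr ℂ) (μ ν κ : Fin 4) :
    pd μ (propAA T ν κ) = if ν = κ then -pd μ T else 0 := by
  unfold propAA; split_ifs
  · exact pd_neg _ _
  · exact pd_zero _

/-- The mixed derivatives ∂_ν∂_κ T₀ from the field equation and from ∂^μ F_{μν} cancel, leaving □T₀
= -iδ on the diagonal. The metric sign is compensated by the one in `obstrGen`. -/
theorem obstrFA_eq {T₀ : Distr ℂ} (hT : IsPropagator 0 T₀) (ν κ : Fin 4) (h : Test) :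
    (Complex.I • obstrFA T₀ ν κ) h = (if ν = κ then (η κ : ℂ) else 0) * h 0 := by
  have hbox := hT h
  have h1 : propNA T₀ κ = -(η κ • pd κ T₀) := by
    simp [propNA, pd_propAA]
  have h2 : ∑ μ, (η μ * η ν) • pd μ (propFA T₀ μ ν κ) =
      (if ν = κ then -(η ν • ∑ μ, η μ • pd μ (pd μ T₀)) else 0) +
        (η κ * η ν) • pd κ (pd ν T₀) := by
    simp only [propFA, pd_propAA, pd_sub, smul_sub, Finset.sum_sub_distrib]
    rw [sub_eq_add_neg]
    congr 1
    · split_ifs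
      · rw [Finset.smul_sum, ← Finset.sum_neg_distrib]
        refine Finset.sum_congr rfl fun μ _ => ?_
        rw [pd_neg, smul_neg, smul_smul, mul_comm]
      · simp [pd_zero]
    · rw [← Finset.sum_neg_distrib, Finset.sum_eq_single κ]
      · simp [pd_neg]
      · intro b _ hb; simp [hb, pd_zero]
      · simp
  rw [obstrFA, h1, h2, pd_neg, pd_smul, pd_comm κ ν, smul_neg, neg_neg, smul_smul, mul_comm (η ν)]
  split_ifs with hνκ
  · subst hνκ
    simp only [sub_apply, add_apply, neg_apply, smul_apply, sum_apply, Complex.ofReal_zero,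
      Finset.smul_sum] at hbox ⊢
    simp only [ne_eq, OfNat.ofNat_ne_zero, not_false_eq_true, zero_pow, zero_mul, add_zero] at hbox
    rw [← Finset.smul_sum, hbox]
    simp only [smul_eq_mul, Complex.real_smul]
    linear_combination (-(η ν : ℂ) * h 0) * Complex.I_mul_I
  · simp

/-- Against a symmetric D only the symmetrized product of Dirac matrices contributes, which is the
Clifford relation. -/
theorem sum_dirac {Γ : Fin 4 → Matrix (Fin 4) (Fin 4) ℂ} (hΓ : IsDirac Γ) (D : Fin 4 → Fin 4 → ℂ)
    (hD : ∀ μ ν, D μ ν = D ν μ) (j i : Fin 4) :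
    ∑ μ, ∑ ν, (Γ ν * Γ μ) j i * D μ ν = if j = i then ∑ μ, (η μ : ℂ) * D μ μ else 0 := by
  have h1 : ∑ μ, ∑ ν, (Γ ν * Γ μ) j i * D μ ν = ∑ μ, ∑ ν, (Γ μ * Γ ν) j i * D μ ν := by
    rw [Finset.sum_comm]
    refine Finset.sum_congr rfl fun μ _ => Finset.sum_congr rfl fun ν _ => ?_
    rw [hD]
  have h2 : ∑ μ, ∑ ν, (Γ ν * Γ μ) j i * D μ ν + ∑ μ, ∑ ν, (Γ μ * Γ ν) j i * D μ ν =
      ∑ μ, ∑ ν, (if μ = ν then (2 * η μ : ℂ) • (1 : Matrix (Fin 4) (Fin 4) ℂ) else 0) j i * D μ ν := by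
    rw [← Finset.sum_add_distrib]
    refine Finset.sum_congr rfl fun μ _ => ?_
    rw [← Finset.sum_add_distrib]
    refine Finset.sum_congr rfl fun ν _ => ?_
    rw [← hΓ μ ν, Matrix.add_apply]
    ring
  have h3 : ∀ μ, ∑ ν, (if μ = ν then (2 * η μ : ℂ) • (1 : Matrix (Fin 4) (Fin 4) ℂ) else 0) j i * D μ ν =
      2 * (if j = i then (η μ : ℂ) * D μ μ else 0) := by
    intro μ
    rw [Finset.sum_eq_single μ]
    · simp [Matrix.one_apply]; split_ifs <;> ring
    · intro ν _ hν; simp [hν.symm]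
    · simp
  simp only [h3] at h2
  rw [← h1, ← Finset.mul_sum] at h2
  have h4 : ∑ μ, ∑ ν, (Γ ν * Γ μ) j i * D μ ν = ∑ μ, (if j = i then (η μ : ℂ) * D μ μ else 0) := by
    linear_combination h2 / 2
  rw [h4]
  split_ifs <;> simp

/-- The Dirac operator applied to the Dirac propagator gives the Klein-Gordon operator on T: the
first-order terms cancel and i(□ + M²)T δ_{ji} remains. -/
theorem obstrDirac_eq {Γ : Fin 4 → Matrix (Fin 4) (Fin 4) ℂ} (hΓ : IsDirac Γ) {M : ℝ} {T : Distr ℂ}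
    (hT : IsPropagator M T) (j i : Fin 4) (h : Test) :
    (Complex.I • obstrDirac Γ M T j i) h = (if i = j then Complex.I else 0) * h 0 := by
  have hbox := hT h
  simp only [sum_apply, smul_apply] at hbox
  have hp : ∀ (μ k : Fin 4), pd μ (propDirac Γ M T j k) h =
      -(∑ ν, (Complex.I * Γ ν j k) * pd μ (pd ν T) h) + (if j = k then (M : ℂ) * pd μ T h else 0) := by
    intro μ k
    unfold propDirac
    rw [pd_add, pd_neg, pd_sum]
    simp only [pd_csmul]
    split_ifs
    · simp [pd_smul]
    · simp [pd_zero]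
  have h1 : ∑ μ, ∑ k, Γ μ k i * pd μ (propDirac Γ M T j k) h =
      -Complex.I * (∑ μ, ∑ ν, (Γ ν * Γ μ) j i * pd μ (pd ν T) h) + M * ∑ μ, Γ μ j i * pd μ T h := by
    simp only [hp, mul_add, Finset.sum_add_distrib]
    congr 1
    · rw [Finset.mul_sum]
      refine Finset.sum_congr rfl fun μ _ => ?_
      simp only [mul_neg, Finset.mul_sum, Finset.sum_neg_distrib, neg_mul]
      rw [Finset.sum_comm]
      congr 1
      refine Finset.sum_congr rfl fun ν _ => ?_
      rw [Matrix.mul_apply, Finset.sum_mul, Finset.mul_sum]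
      refine Finset.sum_congr rfl fun k _ => ?_
      ring
    · rw [Finset.mul_sum]
      refine Finset.sum_congr rfl fun μ _ => ?_
      rw [Finset.sum_eq_single j]
      · simp; ring
      · intro k _ hk; simp [hk.symm]
      · simp
  have h2 : propDirac Γ M T j i h = -Complex.I * (∑ μ, Γ μ j i * pd μ T h) +
      (if j = i then (M : ℂ) * T h else 0) := by
    unfold propDirac
    split_ifs
    · simp [Finset.mul_sum, mul_assoc]
    · simp [Finset.mul_sum, mul_assoc]
  rw [sum_dirac hΓ (fun μ ν => pd μ (pd ν T) h) (fun μ ν => by rw [pd_comm])] at h1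
  have h3 : (Complex.I • obstrDirac Γ M T j i) h = Complex.I * ((Complex.I * M) * propDirac Γ M T j i h -
      ∑ μ, ∑ k, Γ μ k i * pd μ (propDirac Γ M T j k) h) := by
    simp [obstrDirac]
  rw [h3, h1, h2]
  simp only [eq_comm (a := i)]
  split_ifs
  · simp only [Complex.real_smul] at hbox
    linear_combination (-1 : ℂ) * hbox + (M * M * T h +  (∑ μ, (η μ : ℂ) * pd μ (pd μ T) h) - Complex.I * M * (∑ μ, Γ μ j i * pd μ T h) ) * Complex.I_mul_I
  · linear_combination (- Complex.I * M * (∑ μ, Γ μ j i * pd μ T h) ) * Complex.I_mul_I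

/-! ### Orders in the coupling constant, and convergent sums -/

section Order

variable {p q r : ℕ}

/-- The matrix of the coefficients of order `g^N`. -/
def cf (N : ℕ) : MatField p q →ₗ[ℂ] Matrix (Fin p) (Fin q) (Spacetime → ℂ) where
  toFun X := Matrix.of fun i j => PowerSeries.coeff N (X i j)
  map_add' X Y := by ext; simp
  map_smul' a X := by ext; simp

theorem cf_apply (N : ℕ) (X : MatField p q) (i : Fin p) (j : Fin q) :
    cf N X i j = PowerSeries.coeff N (X i j) := rfl

theorem ext_cf {X Y : MatField p q} (h : ∀ N, cf N X = cf N Y) : X = Y := by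
  refine Matrix.ext fun i j => PowerSeries.ext fun N => ?_
  exact congrFun (congrFun (h N) i) j

theorem cf_real_smul (N : ℕ) (t : ℝ) (X : MatField p q) : cf N (t • X) = t • cf N X := by
  ext; simp [cf_apply]

theorem cf_mul (N : ℕ) (X : MatField p q) (Y : MatField q r) :
    cf N (X * Y) = ∑ ab ∈ antidiagonal N, cf ab.1 X * cf ab.2 Y := by
  ext i j : 2
  rw [cf_apply, Matrix.mul_apply, map_sum, Matrix.sum_apply]
  simp only [PowerSeries.coeff_mul, Matrix.mul_apply, cf_apply]
  rw [Finset.sum_comm]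

theorem cf_one_zero : cf 0 (1 : MatField p p) = 1 := by
  ext i j : 2
  rw [cf_apply, Matrix.one_apply, Matrix.one_apply]
  split_ifs <;> simp

theorem cf_one_succ (N : ℕ) : cf (N + 1) (1 : MatField p p) = 0 := by
  ext i j : 2
  rw [cf_apply, Matrix.one_apply]
  split_ifs <;> simp [PowerSeries.coeff_one]

theorem cf_g_smul_zero (X : MatField p q) : cf 0 (g • X) = 0 := by
  ext i j : 2
  simp [cf_apply, g]

theorem cf_g_smul_succ (N : ℕ) (X : MatField p q) : cf (N + 1) (g • X) = cf N X := by
  ext i j : 2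
  simp [cf_apply, g, PowerSeries.coeff_succ_X_mul]

theorem cf_gdiv (N : ℕ) (X : MatField p q) : cf N (gdiv X) = cf (N + 1) X := by
  ext i j : 2
  simp [cf_apply, gdiv]

/-- Identities for potentials are proved after multiplication by g, where the g⁻¹ of gauge
transformations disappears. -/
theorem g_smul_injective {X Y : MatField p q} (h : g • X = g • Y) : X = Y := by
  refine ext_cf fun N => ?_
  rw [← cf_g_smul_succ, h, cf_g_smul_succ]

/-- `X = O(g^k)`. -/
def Ord (k : ℕ) (X : MatField p q) : Prop := ∀ N < k, cf N X = 0

theorem Ord.of_zero (X : MatField p q) : Ord 0 X := fun _ h => absurd h (Nat.not_lt_zero _)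

theorem ord_zero (k : ℕ) : Ord k (0 : MatField p q) := fun _ _ => map_zero _

theorem Ord.mono {k l : ℕ} {X : MatField p q} (h : Ord k X) (hl : l ≤ k) : Ord l X :=
  fun N hN => h N (hN.trans_le hl)

theorem Ord.add {k : ℕ} {X Y : MatField p q} (hX : Ord k X) (hY : Ord k Y) : Ord k (X + Y) :=
  fun N hN => by rw [map_add, hX N hN, hY N hN, add_zero]

theorem Ord.neg {k : ℕ} {X : MatField p q} (hX : Ord k X) : Ord k (-X) :=
  fun N hN => by rw [map_neg, hX N hN, neg_zero]

theorem Ord.sub {k : ℕ} {X Y : MatField p q} (hX : Ord k X) (hY : Ord k Y) : Ord k (X - Y) :=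
  fun N hN => by rw [map_sub, hX N hN, hY N hN, sub_zero]

theorem Ord.smul {k : ℕ} {X : MatField p q} (a : ℂ) (hX : Ord k X) : Ord k (a • X) :=
  fun N hN => by rw [map_smul, hX N hN, smul_zero]

theorem Ord.real_smul {k : ℕ} {X : MatField p q} (a : ℝ) (hX : Ord k X) : Ord k (a • X) :=
  fun N hN => by rw [cf_real_smul, hX N hN, smul_zero]

theorem Ord.sum {ι : Type} {k : ℕ} {s : Finset ι} {X : ι → MatField p q} (hX : ∀ i ∈ s, Ord k (X i)) :
    Ord k (∑ i ∈ s, X i) :=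
  fun N hN => by rw [map_sum]; exact Finset.sum_eq_zero fun i hi => hX i hi N hN

theorem Ord.g_smul {k : ℕ} {X : MatField p q} (hX : Ord k X) : Ord (k + 1) (g • X) := by
  intro N hN
  cases N with
  | zero => exact cf_g_smul_zero X
  | succ N => rw [cf_g_smul_succ]; exact hX N (by omega)

theorem g_smul_gdiv {X : MatField p q} (hX : Ord 1 X) : g • gdiv X = X := by
  refine ext_cf fun N => ?_
  cases N with
  | zero => rw [cf_g_smul_zero, hX 0 one_pos]
  | succ N => rw [cf_g_smul_succ, cf_gdiv]

theorem Ord.mul {k l : ℕ} {X : MatField p q} {Y : MatField q r} (hX : Ord k X) (hY : Ord l Y) :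
    Ord (k + l) (X * Y) := by
  intro N hN
  rw [cf_mul]
  refine Finset.sum_eq_zero fun ab hab => ?_
  rw [mem_antidiagonal] at hab
  rcases lt_or_ge ab.1 k with h | h
  · rw [hX _ h, Matrix.zero_mul]
  · rw [hY _ (by omega), Matrix.mul_zero]

theorem Ord.mul_left {l : ℕ} (X : MatField p q) {Y : MatField q r} (hY : Ord l Y) : Ord l (X * Y) := by
  simpa using (Ord.of_zero X).mul hY

theorem Ord.mul_right {l : ℕ} {X : MatField p q} (hX : Ord l X) (Y : MatField q r) : Ord l (X * Y) := by
  simpa using hX.mul (Ord.of_zero Y)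

theorem Ord.pow {X : MatField p p} (hX : Ord 1 X) (k : ℕ) : Ord k (X ^ k) := by
  induction k with
  | zero => exact Ord.of_zero _
  | succ k ih => rw [pow_succ]; exact ih.mul hX

theorem eq_zero_of_ord {X : MatField p q} (h : ∀ k, Ord k X) : X = 0 :=
  ext_cf fun N => by rw [h (N + 1) N (Nat.lt_succ_self N), map_zero]

/-- The sum `∑_k F_k` of a series with `F_k = O(g^k)`. -/
def fsum (F : ℕ → MatField p q) : MatField p q :=
  Matrix.of fun i j => PowerSeries.mk fun N =>
    ∑ k ∈ Finset.range (N + 1), PowerSeries.coeff N (F k i j)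

theorem cf_fsum (F : ℕ → MatField p q) (N : ℕ) :
    cf N (fsum F) = ∑ k ∈ Finset.range (N + 1), cf N (F k) := by
  ext i j : 2
  simp [cf_apply, fsum, Matrix.sum_apply]

theorem cf_fsum_of_le {F : ℕ → MatField p q} (hF : ∀ k, Ord k (F k)) {N M : ℕ} (h : N ≤ M) :
    cf N (fsum F) = ∑ k ∈ Finset.range (M + 1), cf N (F k) := by
  rw [cf_fsum]
  refine Finset.sum_subset (by simpa using h) fun k _ hk => hF k N ?_
  simpa using hk

theorem ord_fsum_sub {F : ℕ → MatField p q} (hF : ∀ k, Ord k (F k)) (N : ℕ) :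
    Ord (N + 1) (fsum F - ∑ k ∈ Finset.range (N + 1), F k) := by
  intro M hM
  rw [map_sub, map_sum, cf_fsum_of_le hF (Nat.lt_succ_iff.mp hM), sub_self]

theorem eq_fsum {F : ℕ → MatField p q} {X : MatField p q}
    (h : ∀ N, Ord (N + 1) (X - ∑ k ∈ Finset.range (N + 1), F k)) : X = fsum F := by
  refine ext_cf fun N => ?_
  have := h N N (Nat.lt_succ_self N)
  rwa [map_sub, sub_eq_zero, map_sum, ← cf_fsum] at this

theorem Ord.fsum {m : ℕ} {F : ℕ → MatField p q} (hF : ∀ k, Ord m (F k)) : Ord m (fsum F) := by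
  intro N hN
  rw [cf_fsum]
  exact Finset.sum_eq_zero fun k _ => hF k N hN

/-- Additive maps that do not lower the order commute with convergent sums. -/
theorem map_fsum {p' q' : ℕ} (D : MatField p q → MatField p' q') (S : AddSubgroup (MatField p q))
    (hadd : ∀ X ∈ S, ∀ Y ∈ S, D (X + Y) = D X + D Y) (hord : ∀ X ∈ S, ∀ k, Ord k X → Ord k (D X))
    {F : ℕ → MatField p q} (hF : ∀ k, Ord k (F k)) (hS : ∀ k, F k ∈ S) (hS' : SQFT.fsum F ∈ S) :
    D (SQFT.fsum F) = SQFT.fsum fun k => D (F k) := by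
  have h0 : D 0 = 0 := by simpa using hadd 0 S.zero_mem 0 S.zero_mem
  have hsum : ∀ N, (∑ k ∈ Finset.range N, F k ∈ S) ∧
      D (∑ k ∈ Finset.range N, F k) = ∑ k ∈ Finset.range N, D (F k) := by
    intro N
    refine ⟨S.sum_mem fun k _ => hS k, ?_⟩
    induction N with
    | zero => simpa using h0
    | succ N ih =>
      rw [Finset.sum_range_succ, hadd _ (S.sum_mem fun k _ => hS k) _ (hS N), ih, Finset.sum_range_succ]
  refine eq_fsum fun N => ?_
  have h1 := hadd _ (S.sub_mem hS' (hsum (N + 1)).1) _ (hsum (N + 1)).1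
  rw [sub_add_cancel] at h1
  rw [h1, (hsum (N + 1)).2, add_sub_cancel_right]
  exact hord _ (S.sub_mem hS' (hsum (N + 1)).1) _ (ord_fsum_sub hF N)

theorem mul_fsum (B : MatField p q) {F : ℕ → MatField q r} (hF : ∀ k, Ord k (F k)) :
    B * fsum F = fsum fun k => B * F k :=
  map_fsum (fun X : MatField q r => B * X) ⊤ (fun _ _ _ _ => Matrix.mul_add _ _ _) (fun _ _ _ h => h.mul_left B) hF
    (fun _ => trivial) trivial

theorem fsum_mul (B : MatField q r) {F : ℕ → MatField p q} (hF : ∀ k, Ord k (F k)) :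
    fsum F * B = fsum fun k => F k * B :=
  map_fsum (fun X : MatField p q => X * B) ⊤ (fun _ _ _ _ => Matrix.add_mul _ _ _) (fun _ _ _ h => h.mul_right B) hF
    (fun _ => trivial) trivial

/-- At each order only finitely many (i, j) contribute, so the double series may be summed along
antidiagonals. -/
theorem fsum_fsum {H : ℕ → ℕ → MatField p q} (hH : ∀ i j, Ord (i + j) (H i j)) :
    fsum (fun i => fsum (H i)) = fsum fun N => ∑ ab ∈ antidiagonal N, H ab.1 ab.2 := by
  refine ext_cf fun N => ?_
  rw [cf_fsum, cf_fsum]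
  have h1 : ∀ M, cf N (∑ ab ∈ antidiagonal M, H ab.1 ab.2) =
      ∑ k ∈ Finset.range (M + 1), cf N (H k (M - k)) := by
    intro M
    rw [map_sum, Finset.Nat.sum_antidiagonal_eq_sum_range_succ (fun a b => cf N (H a b))]
  simp only [h1]
  rw [Finset.sum_range_diag_flip (N + 1) (fun a b => cf N (H a b))]
  refine Finset.sum_congr rfl fun i _ => ?_
  rw [cf_fsum]
  symm
  refine Finset.sum_subset (by simp) fun k _ hk => hH i k N ?_
  simp at hk
  omega

theorem fsum_mul_fsum {F : ℕ → MatField p q} {G : ℕ → MatField q r} (hF : ∀ k, Ord k (F k))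
    (hG : ∀ k, Ord k (G k)) :
    fsum F * fsum G = fsum fun N => ∑ ab ∈ antidiagonal N, F ab.1 * G ab.2 := by
  rw [fsum_mul _ hF, ← fsum_fsum fun i j => (hF i).mul (hG j)]
  congr 1
  funext k
  rw [mul_fsum _ hG]

theorem fsum_shift {F : ℕ → MatField p q} (h0 : F 0 = 0) (hF : ∀ k, Ord k (F k)) :
    fsum F = fsum fun k => F (k + 1) := by
  refine ext_cf fun N => ?_
  rw [cf_fsum_of_le hF (Nat.le_succ N), cf_fsum, Finset.sum_range_succ', h0, map_zero, add_zero]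

theorem fsum_eq_single {F : ℕ → MatField p q} (h : ∀ k, F (k + 1) = 0) : fsum F = F 0 := by
  refine ext_cf fun N => ?_
  rw [cf_fsum, Finset.sum_range_succ']
  simp [h]

theorem fsum_add (F G : ℕ → MatField p q) : fsum F + fsum G = fsum fun k => F k + G k := by
  refine ext_cf fun N => ?_
  simp [cf_fsum, Finset.sum_add_distrib]

theorem fsum_smul (a : ℂ) (F : ℕ → MatField p q) : a • fsum F = fsum fun k => a • F k := by
  refine ext_cf fun N => ?_
  simp [cf_fsum, Finset.smul_sum]

theorem fsum_real_smul (a : ℝ) (F : ℕ → MatField p q) : a • fsum F = fsum fun k => a • F k := by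
  refine ext_cf fun N => ?_
  simp [cf_fsum, Finset.smul_sum]

end Order

/-! ### Exponentials -/

/-- `ad_Z B = [Z, B]`. -/
def adm {A : Type} [Ring A] (Z B : A) : A := Z * B - B * Z

theorem iterate_adm_one {A : Type} [Ring A] (Z : A) (N : ℕ) : (adm Z)^[N + 1] 1 = 0 := by
  have h : ∀ N, (adm Z)^[N] (0 : A) = 0 := fun N => by
    induction N with
    | zero => rfl
    | succ N ih => rw [Function.iterate_succ_apply']; simp [ih, adm]
  rw [Function.iterate_succ_apply, show adm Z 1 = 0 by simp [adm], h]

section Exponential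

variable {A : Type} [Ring A] [Algebra ℂ A]

/-- The term `Z^k / k!` of the exponential series. -/
def expTerm (Z : A) (k : ℕ) : A := ((k.factorial : ℂ)⁻¹) • Z ^ k

theorem expTerm_zero (Z : A) : expTerm Z 0 = 1 := by simp [expTerm]

theorem succ_smul_inv_factorial (k : ℕ) (Y : A) :
    ((k : ℂ) + 1) • ((((k + 1).factorial : ℕ) : ℂ)⁻¹ • Y) = ((k.factorial : ℂ)⁻¹) • Y := by
  rw [smul_smul, Nat.factorial_succ]
  congr 1
  have h1 : ((k : ℂ) + 1) ≠ 0 := by exact_mod_cast Nat.succ_ne_zero k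
  have h2 : (k.factorial : ℂ) ≠ 0 := by exact_mod_cast Nat.factorial_ne_zero k
  push_cast
  field_simp

theorem succ_smul_expTerm (Z : A) (k : ℕ) : ((k : ℂ) + 1) • expTerm Z (k + 1) = Z * expTerm Z k := by
  rw [expTerm, succ_smul_inv_factorial, expTerm, pow_succ', mul_smul_comm]

theorem succ_smul_expTerm' (Z : A) (k : ℕ) : ((k : ℂ) + 1) • expTerm Z (k + 1) = expTerm Z k * Z := by
  rw [expTerm, succ_smul_inv_factorial, expTerm, pow_succ, smul_mul_assoc]

/-- The Leibniz rule for d/dt on the product of two generating series in t, read off at order t^N.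
-/
theorem succ_smul_sum_antidiagonal (f : ℕ → ℕ → A) (N : ℕ) :
    ((N : ℂ) + 1) • ∑ ab ∈ antidiagonal (N + 1), f ab.1 ab.2 =
      ∑ ab ∈ antidiagonal N, (((ab.1 : ℂ) + 1) • f (ab.1 + 1) ab.2 +
        ((ab.2 : ℂ) + 1) • f ab.1 (ab.2 + 1)) := by
  have h1 : ((N : ℂ) + 1) • ∑ ab ∈ antidiagonal (N + 1), f ab.1 ab.2 =
      ∑ ab ∈ antidiagonal (N + 1), (ab.1 : ℂ) • f ab.1 ab.2 +
        ∑ ab ∈ antidiagonal (N + 1), (ab.2 : ℂ) • f ab.1 ab.2 := by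
    rw [Finset.smul_sum, ← Finset.sum_add_distrib]
    refine Finset.sum_congr rfl fun ab hab => ?_
    rw [mem_antidiagonal] at hab
    rw [← add_smul]
    congr 1
    exact_mod_cast hab.symm
  rw [h1, Finset.Nat.sum_antidiagonal_succ, Finset.Nat.sum_antidiagonal_succ', Finset.sum_add_distrib]
  simp

theorem adm_smul (Z B : A) (a : ℂ) : adm Z (a • B) = a • adm Z B := by
  simp [adm, smul_sub]

/-- The recursion says that the generating series of h solves y' = [Z, y] with y(0) = B. -/
theorem eq_iterate_adm {Z B : A} {h : ℕ → A} (h0 : h 0 = B)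
    (hs : ∀ N : ℕ, ((N : ℂ) + 1) • h (N + 1) = adm Z (h N)) (N : ℕ) :
    h N = ((N.factorial : ℂ)⁻¹) • (adm Z)^[N] B := by
  induction N with
  | zero => simp [h0]
  | succ N ih =>
    have h1 : ((N : ℂ) + 1) ≠ 0 := by exact_mod_cast Nat.succ_ne_zero N
    refine smul_right_injective A h1 ?_
    beta_reduce
    rw [hs, ih, Function.iterate_succ_apply', succ_smul_inv_factorial, adm_smul]

/-- The order t^N of e^{tZ} B e^{-tZ} = e^{t ad Z} B. -/
theorem sum_expTerm_conj (Z B : A) (N : ℕ) :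
    ∑ ab ∈ antidiagonal N, expTerm Z ab.1 * B * expTerm (-Z) ab.2 =
      ((N.factorial : ℂ)⁻¹) • (adm Z)^[N] B := by
  refine eq_iterate_adm (h := fun N => ∑ ab ∈ antidiagonal N,
    expTerm Z ab.1 * B * expTerm (-Z) ab.2) (by simp [expTerm_zero]) (fun N => ?_) N
  rw [succ_smul_sum_antidiagonal (fun a b => expTerm Z a * B * expTerm (-Z) b), adm, Finset.mul_sum,
    Finset.sum_mul, ← Finset.sum_sub_distrib]
  refine Finset.sum_congr rfl fun ab _ => ?_
  rw [← smul_mul_assoc, ← smul_mul_assoc, succ_smul_expTerm, ← mul_smul_comm, succ_smul_expTerm']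
  noncomm_ring

theorem sum_expTerm_mul_neg (Z : A) (N : ℕ) :
    ∑ ab ∈ antidiagonal (N + 1), expTerm Z ab.1 * expTerm (-Z) ab.2 = 0 := by
  have := sum_expTerm_conj Z 1 (N + 1)
  simpa [iterate_adm_one] using this

/-- The order t^{N+1} of e^{-tZ} D(e^{tZ}), with `DE k` in the role of D(Z^k/k!). This function of t
solves y' = [-Z, y] + D(Z) with y(0) = 0; the recursion is abstract so that it applies to ∂_μ and to
g d/dg alike. -/
theorem sum_expTerm_deriv (Z DZ : A) (DE : ℕ → A) (h0 : DE 0 = 0)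
    (hs : ∀ k : ℕ, ((k : ℂ) + 1) • DE (k + 1) = DE k * Z + expTerm Z k * DZ) (N : ℕ) :
    ∑ ab ∈ antidiagonal (N + 1), expTerm (-Z) ab.1 * DE ab.2 =
      (((N + 1).factorial : ℂ)⁻¹) • (adm (-Z))^[N] DZ := by
  set f : ℕ → A := fun N => ∑ ab ∈ antidiagonal N, expTerm (-Z) ab.1 * DE ab.2 with hf
  have hrec : ∀ N : ℕ, ((N : ℂ) + 1) • f (N + 1) =
      adm (-Z) (f N) + (∑ ab ∈ antidiagonal N, expTerm (-Z) ab.1 * expTerm Z ab.2) * DZ := by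
    intro N
    rw [hf]
    beta_reduce
    rw [succ_smul_sum_antidiagonal (fun a b => expTerm (-Z) a * DE b), adm, Finset.mul_sum,
      Finset.sum_mul, Finset.sum_mul, ← Finset.sum_sub_distrib, ← Finset.sum_add_distrib]
    refine Finset.sum_congr rfl fun ab _ => ?_
    rw [← smul_mul_assoc, succ_smul_expTerm, ← mul_smul_comm, hs]
    noncomm_ring
  induction N with
  | zero =>
    have := hrec 0
    simpa [hf, h0, expTerm_zero, adm] using this
  | succ N ih =>
    have h1 : (((N + 1 : ℕ) : ℂ) + 1) ≠ 0 := by exact_mod_cast Nat.succ_ne_zero (N + 1)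
    refine smul_right_injective A h1 ?_
    beta_reduce
    -- The inhomogeneous term is the order t^{N+1} of e^{-tZ} e^{tZ} = 1, hence zero from here on.
    have h2 := sum_expTerm_mul_neg (-Z) N
    rw [neg_neg] at h2
    change _ • f (N + 1 + 1) = _
    rw [hrec, h2, zero_mul, add_zero, succ_smul_inv_factorial, Function.iterate_succ_apply', ← adm_smul]
    exact congrArg _ ih

end Exponential

-- Exponentials of matrix fields of order g

section FExp

variable {p : ℕ}

theorem fexp_eq (Z : MatField p p) : fexp Z = fsum (expTerm Z) := by
  refine ext_cf fun N => ?_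
  rw [cf_fsum]
  ext i j : 2
  simp [cf_apply, fexp, expTerm, Matrix.sum_apply]

theorem ord_expTerm {Z : MatField p p} (hZ : Ord 1 Z) (k : ℕ) : Ord k (expTerm Z k) :=
  (hZ.pow k).smul _

theorem Ord.adm {k l : ℕ} {Z B : MatField p p} (hZ : Ord k Z) (hB : Ord l B) : Ord (k + l) (adm Z B) :=
  (hZ.mul hB).sub (add_comm l k ▸ hB.mul hZ)

theorem ord_iterate_adm {l : ℕ} {Z B : MatField p p} (hZ : Ord 1 Z) (hB : Ord l B) (k : ℕ) :
    Ord (k + l) ((SQFT.adm Z)^[k] B) := by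
  induction k with
  | zero => simpa using hB
  | succ k ih =>
    rw [Function.iterate_succ_apply']
    exact (hZ.adm ih).mono (by omega)

theorem fexp_mul_fexp_neg {Z : MatField p p} (hZ : Ord 1 Z) : fexp Z * fexp (-Z) = 1 := by
  rw [fexp_eq, fexp_eq, fsum_mul_fsum (ord_expTerm hZ) (ord_expTerm hZ.neg), fsum_eq_single]
  · simp [expTerm_zero]
  · exact sum_expTerm_mul_neg Z

theorem fexp_neg_mul_fexp {Z : MatField p p} (hZ : Ord 1 Z) : fexp (-Z) * fexp Z = 1 := by
  simpa using fexp_mul_fexp_neg hZ.neg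

theorem fexp_inv {Z : MatField p p} (hZ : Ord 1 Z) : (fexp Z)⁻¹ = fexp (-Z) :=
  Matrix.inv_eq_right_inv (fexp_mul_fexp_neg hZ)

theorem ord_fexp_sub_one {Z : MatField p p} (hZ : Ord 1 Z) : Ord 1 (fexp Z - 1) := by
  have := ord_fsum_sub (ord_expTerm hZ) 0
  simpa [expTerm_zero, ← fexp_eq] using this

/-- `e^Z B e^{-Z} = e^{ad Z} B`. -/
theorem fexp_conj {Z : MatField p p} (hZ : Ord 1 Z) (B : MatField p p) :
    fexp Z * B * fexp (-Z) = fsum fun k => ((k.factorial : ℂ)⁻¹) • (adm Z)^[k] B := by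
  have h1 : ∀ k, Ord k (expTerm Z k * B) := fun k => (ord_expTerm hZ k).mul_right B
  rw [fexp_eq, fexp_eq, fsum_mul B (ord_expTerm hZ), fsum_mul_fsum h1 (ord_expTerm hZ.neg)]
  congr 1
  funext N
  exact sum_expTerm_conj Z B N

/-- `∑_k ad_Z^k Y / (k+1)!`. -/
def expDer (Z Y : MatField p p) : MatField p p :=
  fsum fun k => (((k + 1).factorial : ℂ)⁻¹) • (adm Z)^[k] Y

/-- `e^{-Z} D(e^Z) = ∑_k ad_{-Z}^k D(Z) / (k+1)!` for a derivation `D`. -/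
theorem fexp_neg_mul_deriv {Z DZ : MatField p p} (hZ : Ord 1 Z) (hDZ : Ord 1 DZ) {DE : ℕ → MatField p p}
    (h0 : DE 0 = 0)
    (hs : ∀ k : ℕ, ((k : ℂ) + 1) • DE (k + 1) = DE k * Z + expTerm Z k * DZ) :
    fexp (-Z) * fsum DE = expDer (-Z) DZ := by
  have hDE : ∀ k, Ord k (DE k) := by
    intro k
    induction k with
    | zero => exact Ord.of_zero _
    | succ k ih =>
      have h1 : ((k : ℂ) + 1) ≠ 0 := by exact_mod_cast Nat.succ_ne_zero k
      have h2 : DE (k + 1) = ((k : ℂ) + 1)⁻¹ • (DE k * Z + expTerm Z k * DZ) := by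
        rw [← hs, smul_smul, inv_mul_cancel₀ h1, one_smul]
      rw [h2]
      exact ((ih.mul hZ).add ((ord_expTerm hZ k).mul hDZ)).smul _
  have h1 : ∀ N, Ord N (∑ ab ∈ antidiagonal N, expTerm (-Z) ab.1 * DE ab.2) := by
    intro N
    refine Ord.sum fun ab hab => ?_
    have := (ord_expTerm hZ.neg ab.1).mul (hDE ab.2)
    rwa [mem_antidiagonal.mp hab] at this
  rw [fexp_eq, fsum_mul_fsum (ord_expTerm hZ.neg) hDE, fsum_shift (by simp [h0]) h1, expDer]
  congr 1
  funext N
  exact sum_expTerm_deriv Z DZ DE h0 hs N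

theorem Ord.expDer {l : ℕ} {Z Y : MatField p p} (hZ : Ord 1 Z) (hY : Ord l Y) : Ord l (expDer Z Y) :=
  Ord.fsum fun k => ((ord_iterate_adm hZ hY k).smul _).mono (by omega)

/-- If Z - Y = O(g^k), then the differences of all higher powers are O(g^{k+1}), so equality of the
exponentials pushes the linear term Z - Y to O(g^{k+1}) too. -/
theorem fexp_injective {Z Y : MatField p p} (hZ : Ord 1 Z) (hY : Ord 1 Y) (h : fexp Z = fexp Y) :
    Z = Y := by
  rw [← sub_eq_zero]
  refine eq_zero_of_ord fun k => ?_
  induction k with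
  | zero => exact Ord.of_zero _
  | succ k ih =>
    have hpow : ∀ m, Ord (k + m) (Z ^ (m + 1) - Y ^ (m + 1)) := by
      intro m
      induction m with
      | zero => simpa using ih
      | succ m ihm =>
        have : Z ^ (m + 1 + 1) - Y ^ (m + 1 + 1) =
            (Z ^ (m + 1) - Y ^ (m + 1)) * Z + Y ^ (m + 1) * (Z - Y) := by
          rw [pow_succ, pow_succ Y]; noncomm_ring
        rw [this]
        exact (ihm.mul hZ).add (((hY.pow (m + 1)).mul ih).mono (by omega))
    have h1 : fexp Z - fexp Y = fsum fun m => expTerm Z m - expTerm Y m := by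
      rw [fexp_eq, fexp_eq, sub_eq_add_neg, ← neg_one_smul ℂ, fsum_smul, fsum_add]
      congr 1; funext m; module
    have hT : ∀ m, Ord (k + m) (expTerm Z (m + 1) - expTerm Y (m + 1)) := fun m => by
      rw [expTerm, expTerm, ← smul_sub]; exact (hpow m).smul _
    have h0 : expTerm Z 0 - expTerm Y 0 = 0 := by simp [expTerm_zero]
    rw [h, sub_self, fsum_shift h0 (fun m => (ord_expTerm hZ m).sub (ord_expTerm hY m))] at h1
    intro N hN
    have h2 := congrArg (cf N) h1
    rw [map_zero, cf_fsum, Finset.sum_range_succ', Finset.sum_eq_zero, zero_add] at h2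
    · simpa [expTerm] using h2.symm
    · intro m _
      exact hT (m + 1) N (by omega)

end FExp

/-! ### String integration of complex functions -/

section Complexification

variable {c : Fin 4 → Distr ℝ} (𝓕 : FieldSpace c)

/-- Complex scalar functions. -/
def FieldSpace.cScalars : Submodule ℂ (Spacetime → ℂ) where
  carrier := {f | (fun x => (f x).re) ∈ 𝓕.scalars ∧ (fun x => (f x).im) ∈ 𝓕.scalars}
  add_mem' hf hg := ⟨add_mem hf.1 hg.1, add_mem hf.2 hg.2⟩
  zero_mem' := ⟨zero_mem 𝓕.scalars, zero_mem 𝓕.scalars⟩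
  smul_mem' a f hf := by
    refine ⟨?_, ?_⟩
    · have := sub_mem (SMulMemClass.smul_mem a.re hf.1) (SMulMemClass.smul_mem a.im hf.2)
      convert this using 1; funext x; simp
    · have := add_mem (SMulMemClass.smul_mem a.re hf.2) (SMulMemClass.smul_mem a.im hf.1)
      convert this using 1; funext x; simp

/-- Complex vector functions. -/
def FieldSpace.cVectors : Submodule ℂ (Fin 4 → Spacetime → ℂ) where
  carrier := {v | (fun μ x => (v μ x).re) ∈ 𝓕.vectors ∧ (fun μ x => (v μ x).im) ∈ 𝓕.vectors}
  add_mem' hf hg := ⟨add_mem hf.1 hg.1, add_mem hf.2 hg.2⟩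
  zero_mem' := ⟨zero_mem 𝓕.vectors, zero_mem 𝓕.vectors⟩
  smul_mem' a f hf := by
    refine ⟨?_, ?_⟩
    · have := sub_mem (𝓕.vectors.smul_mem a.re hf.1) (𝓕.vectors.smul_mem a.im hf.2)
      convert this using 1; funext μ x; simp
    · have := add_mem (𝓕.vectors.smul_mem a.re hf.2) (𝓕.vectors.smul_mem a.im hf.1)
      convert this using 1; funext μ x; simp

variable {𝓕}

theorem contDiff_of_mem_cScalars {f : Spacetime → ℂ} (hf : f ∈ 𝓕.cScalars) : ContDiff ℝ ∞ f := by
  have h1 := Complex.ofRealCLM.contDiff.comp (𝓕.smooth _ hf.1) (n := ∞)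
  have h2 := Complex.ofRealCLM.contDiff.comp (𝓕.smooth _ hf.2) (n := ∞)
  have := h1.add (h2.mul (contDiff_const (c := Complex.I)))
  convert this using 1
  funext x
  simp [Complex.re_add_im]

theorem fderiv_re {f : Spacetime → ℂ} {x : Spacetime} (hf : DifferentiableAt ℝ f x) (w : Spacetime) :
    (fderiv ℝ f x w).re = fderiv ℝ (fun y => (f y).re) x w := by
  have := (Complex.reCLM.hasFDerivAt.comp x hf.hasFDerivAt).fderiv
  rw [show (fun y => (f y).re) = ⇑Complex.reCLM ∘ f from rfl, this]
  rfl

theorem fderiv_im {f : Spacetime → ℂ} {x : Spacetime} (hf : DifferentiableAt ℝ f x) (w : Spacetime) :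
    (fderiv ℝ f x w).im = fderiv ℝ (fun y => (f y).im) x w := by
  have := (Complex.imCLM.hasFDerivAt.comp x hf.hasFDerivAt).fderiv
  rw [show (fun y => (f y).im) = ⇑Complex.imCLM ∘ f from rfl, this]
  rfl

theorem mul_mem_cScalars {f h : Spacetime → ℂ} (hf : f ∈ 𝓕.cScalars) (hh : h ∈ 𝓕.cScalars) :
    f * h ∈ 𝓕.cScalars := by
  refine ⟨?_, ?_⟩
  · have := sub_mem (mul_mem hf.1 hh.1) (mul_mem hf.2 hh.2)
    convert this using 1; funext x; simp
  · have := add_mem (mul_mem hf.1 hh.2) (mul_mem hf.2 hh.1)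
    convert this using 1; funext x; simp

theorem mul_mem_cVectors {f : Spacetime → ℂ} {v : Fin 4 → Spacetime → ℂ} (hf : f ∈ 𝓕.cScalars)
    (hv : v ∈ 𝓕.cVectors) : (fun μ => f * v μ) ∈ 𝓕.cVectors := by
  refine ⟨?_, ?_⟩
  · have := sub_mem (𝓕.mul_mem _ hf.1 _ hv.1) (𝓕.mul_mem _ hf.2 _ hv.2)
    convert this using 1; funext μ x; simp
  · have := add_mem (𝓕.mul_mem _ hf.1 _ hv.2) (𝓕.mul_mem _ hf.2 _ hv.1)
    convert this using 1; funext μ x; simp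

theorem component_mem_cScalars {v : Fin 4 → Spacetime → ℂ} (hv : v ∈ 𝓕.cVectors) (μ : Fin 4) :
    v μ ∈ 𝓕.cScalars := ⟨𝓕.component_mem _ hv.1 μ, 𝓕.component_mem _ hv.2 μ⟩

theorem differentiable_of_mem_cScalars {f : Spacetime → ℂ} (hf : f ∈ 𝓕.cScalars) :
    Differentiable ℝ f := (contDiff_of_mem_cScalars hf).differentiable (by simp)

theorem gradient_mem_cVectors {f : Spacetime → ℂ} (hf : f ∈ 𝓕.cScalars) :
    (fun μ x => fderiv ℝ f x (e μ)) ∈ 𝓕.cVectors := by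
  have hd := differentiable_of_mem_cScalars hf
  refine ⟨?_, ?_⟩
  · simp only [fderiv_re (hd _)]; exact 𝓕.gradient_mem _ hf.1
  · simp only [fderiv_im (hd _)]; exact 𝓕.gradient_mem _ hf.2

theorem deriv_mem_cVectors {v : Fin 4 → Spacetime → ℂ} (hv : v ∈ 𝓕.cVectors) (μ : Fin 4) :
    (fun ν x => fderiv ℝ (v ν) x (e μ)) ∈ 𝓕.cVectors := by
  have hd := fun ν => differentiable_of_mem_cScalars (component_mem_cScalars hv ν)
  refine ⟨?_, ?_⟩
  · simp only [fderiv_re (hd _ _)]; exact 𝓕.deriv_mem _ hv.1 μ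
  · simp only [fderiv_im (hd _ _)]; exact 𝓕.deriv_mem _ hv.2 μ

/-- String integration of complex functions. -/
def cInt (c : Fin 4 → Distr ℝ) (v : Fin 4 → Spacetime → ℂ) : Spacetime → ℂ :=
  pairingComplex (fun μ => toComplex (c μ)) v

theorem cInt_re {v : Fin 4 → Spacetime → ℂ} (hv : v ∈ 𝓕.cVectors) (x : Spacetime) :
    (cInt c v x).re = 𝓕.realInt ⟨_, hv.1⟩ x := by
  rw [cInt, pairingComplex, pairingReal_eq (𝓕.isPairing_realInt ⟨_, hv.1⟩).toComplex,
    pairingReal_eq (𝓕.isPairing_realInt ⟨_, hv.2⟩).toComplex]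
  simp

theorem cInt_im {v : Fin 4 → Spacetime → ℂ} (hv : v ∈ 𝓕.cVectors) (x : Spacetime) :
    (cInt c v x).im = 𝓕.realInt ⟨_, hv.2⟩ x := by
  rw [cInt, pairingComplex, pairingReal_eq (𝓕.isPairing_realInt ⟨_, hv.1⟩).toComplex,
    pairingReal_eq (𝓕.isPairing_realInt ⟨_, hv.2⟩).toComplex]
  simp

theorem cInt_mem {v : Fin 4 → Spacetime → ℂ} (hv : v ∈ 𝓕.cVectors) : cInt c v ∈ 𝓕.cScalars := by
  refine ⟨?_, ?_⟩
  · simp only [cInt_re hv]; exact 𝓕.realInt_mem _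
  · simp only [cInt_im hv]; exact 𝓕.realInt_mem _

theorem cInt_add {v w : Fin 4 → Spacetime → ℂ} (hv : v ∈ 𝓕.cVectors) (hw : w ∈ 𝓕.cVectors) :
    cInt c (v + w) = cInt c v + cInt c w := by
  funext x
  refine Complex.ext ?_ ?_
  · rw [Pi.add_apply, Complex.add_re, cInt_re hv, cInt_re hw, cInt_re (add_mem hv hw), ← Pi.add_apply,
      ← map_add]
    rfl
  · rw [Pi.add_apply, Complex.add_im, cInt_im hv, cInt_im hw, cInt_im (add_mem hv hw), ← Pi.add_apply,
      ← map_add]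
    rfl

theorem realInt_congr {v w : Fin 4 → Spacetime → ℝ} (hv : v ∈ 𝓕.vectors) (hw : w ∈ 𝓕.vectors)
    (h : v = w) (x : Spacetime) : 𝓕.realInt ⟨v, hv⟩ x = 𝓕.realInt ⟨w, hw⟩ x := by
  subst h; rfl

theorem cInt_smul (a : ℂ) {v : Fin 4 → Spacetime → ℂ} (hv : v ∈ 𝓕.cVectors) :
    cInt c (a • v) = a • cInt c v := by
  funext x
  refine Complex.ext ?_ ?_
  · rw [Pi.smul_apply, smul_eq_mul, Complex.mul_re, cInt_re hv, cInt_im hv,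
      cInt_re (𝓕.cVectors.smul_mem a hv)]
    have : (a.re • 𝓕.realInt ⟨_, hv.1⟩ - a.im • 𝓕.realInt ⟨_, hv.2⟩) x =
      a.re * 𝓕.realInt ⟨_, hv.1⟩ x - a.im * 𝓕.realInt ⟨_, hv.2⟩ x := rfl
    rw [← this, ← map_smul, ← map_smul, ← map_sub]
    refine realInt_congr _ _ ?_ x
    funext μ y; simp
  · rw [Pi.smul_apply, smul_eq_mul, Complex.mul_im, cInt_re hv, cInt_im hv,
      cInt_im (𝓕.cVectors.smul_mem a hv)]
    have : (a.re • 𝓕.realInt ⟨_, hv.2⟩ + a.im • 𝓕.realInt ⟨_, hv.1⟩) x =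
      a.re * 𝓕.realInt ⟨_, hv.2⟩ x + a.im * 𝓕.realInt ⟨_, hv.1⟩ x := rfl
    rw [← this, ← map_smul, ← map_smul, ← map_add]
    refine realInt_congr _ _ ?_ x
    funext μ y; simp

/-- Verified directly from the cutoffs, so that string integration preserves orders in g for
arbitrary vector fields, without membership in a function space. -/
theorem cInt_zero : cInt c 0 = 0 := by
  have h : IsPairing (fun μ => toComplex (c μ)) (fun _ _ => 0) (fun _ => 0) := by
    refine ⟨fun _ => contDiff_const, fun h => ?_⟩
    have : (fun (k : ℕ) (x : Spacetime) => ∑ μ, toComplex (c μ)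
        (cutoff h k (contDiff_const : ContDiff ℝ ∞ fun _ : Spacetime => (0 : ℝ)) x)) =
        fun _ x => h 0 • (0 : ℂ) := by
      funext k x
      have h0 : cutoff h k (contDiff_const : ContDiff ℝ ∞ fun _ : Spacetime => (0 : ℝ)) x = 0 := by
        ext y; simp [cutoff_apply]
      simp [h0]
    rw [this]
    exact fun u hu x => ⟨Set.univ, by simp, Eventually.of_forall fun _ _ _ => refl_mem_uniformity hu⟩
  funext x
  simp [cInt, pairingComplex, pairingReal_eq h]

theorem cInt_gradient (hc : IsStringFunction c) {f : Spacetime → ℂ} (hf : f ∈ 𝓕.cScalars) :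
    cInt c (fun μ x => fderiv ℝ f x (e μ)) = -f := by
  have hd := differentiable_of_mem_cScalars hf
  funext x
  refine Complex.ext ?_ ?_
  · rw [cInt_re (gradient_mem_cVectors hf),
      realInt_congr _ (𝓕.gradient_mem _ hf.1) (by funext μ y; exact fderiv_re (hd _) _),
      realInt_gradient hc hf.1]
    simp
  · rw [cInt_im (gradient_mem_cVectors hf),
      realInt_congr _ (𝓕.gradient_mem _ hf.2) (by funext μ y; exact fderiv_im (hd _) _),
      realInt_gradient hc hf.2]
    simp

theorem fderiv_cInt {v : Fin 4 → Spacetime → ℂ} (hv : v ∈ 𝓕.cVectors) (μ : Fin 4) :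
    (fun x => fderiv ℝ (cInt c v) x (e μ)) = cInt c (fun ν x => fderiv ℝ (v ν) x (e μ)) := by
  have hd := fun ν => differentiable_of_mem_cScalars (component_mem_cScalars hv ν)
  have hD := differentiable_of_mem_cScalars (cInt_mem hv)
  funext x
  refine Complex.ext ?_ ?_
  · rw [fderiv_re (hD x), cInt_re (deriv_mem_cVectors hv μ)]
    simp only [cInt_re hv]
    rw [show fderiv ℝ (fun y => 𝓕.realInt ⟨_, hv.1⟩ y) x (e μ) = _ from
      congrFun (fderiv_realInt ⟨_, hv.1⟩ μ) x]
    exact realInt_congr _ _ (by funext ν y; exact (fderiv_re (hd _ _) _).symm) x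
  · rw [fderiv_im (hD x), cInt_im (deriv_mem_cVectors hv μ)]
    simp only [cInt_im hv]
    rw [show fderiv ℝ (fun y => 𝓕.realInt ⟨_, hv.2⟩ y) x (e μ) = _ from
      congrFun (fderiv_realInt ⟨_, hv.2⟩ μ) x]
    exact realInt_congr _ _ (by funext ν y; exact (fderiv_im (hd _ _) _).symm) x

end Complexification

/-! ### Smooth matrix fields -/

section Smooth

variable {p q r : ℕ}

/-- Matrix fields with smooth coefficients. -/
def smoothFields (p q : ℕ) : Submodule ℂ (MatField p q) where
  carrier := {X | ∀ N i j, ContDiff ℝ ∞ (cf N X i j)}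
  add_mem' hX hY N i j := by
    rw [map_add]; exact (hX N i j).add (hY N i j)
  zero_mem' N i j := by rw [map_zero]; exact contDiff_const
  smul_mem' a X hX N i j := by
    rw [map_smul]; exact (hX N i j).const_smul a

theorem mul_mem_smoothFields {X : MatField p q} {Y : MatField q r} (hX : X ∈ smoothFields p q)
    (hY : Y ∈ smoothFields q r) : X * Y ∈ smoothFields p r := by
  intro N i j
  have : cf N (X * Y) i j = fun x => ∑ ab ∈ antidiagonal N, ∑ k, cf ab.1 X i k x * cf ab.2 Y k j x := by
    funext x
    simp [cf_mul, Matrix.sum_apply, Matrix.mul_apply]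
  rw [this]
  exact ContDiff.sum fun ab _ => ContDiff.sum fun k _ => (hX _ _ _).mul (hY _ _ _)

theorem one_mem_smoothFields : (1 : MatField p p) ∈ smoothFields p p := by
  intro N i j
  cases N with
  | zero =>
    rw [cf_one_zero, Matrix.one_apply]
    split_ifs <;> exact contDiff_const
  | succ N => rw [cf_one_succ]; exact contDiff_const

theorem pow_mem_smoothFields {X : MatField p p} (hX : X ∈ smoothFields p p) (k : ℕ) :
    X ^ k ∈ smoothFields p p := by
  induction k with
  | zero => exact one_mem_smoothFields
  | succ k ih => rw [pow_succ]; exact mul_mem_smoothFields ih hX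

theorem fsum_mem_smoothFields {F : ℕ → MatField p q} (hF : ∀ k, F k ∈ smoothFields p q) :
    fsum F ∈ smoothFields p q := by
  intro N i j
  rw [cf_fsum, Matrix.sum_apply]
  have : ∑ k ∈ Finset.range (N + 1), cf N (F k) i j =
      fun x => ∑ k ∈ Finset.range (N + 1), cf N (F k) i j x := by funext x; simp
  rw [this]
  exact ContDiff.sum fun k _ => hF k N i j

theorem expTerm_mem_smoothFields {X : MatField p p} (hX : X ∈ smoothFields p p) (k : ℕ) :
    expTerm X k ∈ smoothFields p p := (smoothFields p p).smul_mem _ (pow_mem_smoothFields hX k)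

theorem fexp_mem_smoothFields {X : MatField p p} (hX : X ∈ smoothFields p p) :
    fexp X ∈ smoothFields p p := by
  rw [fexp_eq]; exact fsum_mem_smoothFields (expTerm_mem_smoothFields hX)

theorem cf_partialD (μ : Fin 4) (X : MatField p q) (N : ℕ) (i : Fin p) (j : Fin q) :
    cf N (partialD μ X) i j = fun x => fderiv ℝ (cf N X i j) x (e μ) := by
  simp [cf_apply, partialD]

theorem cf_differentiable {X : MatField p q} (hX : X ∈ smoothFields p q) (N : ℕ) (i : Fin p) (j : Fin q)
    (x : Spacetime) : DifferentiableAt ℝ (cf N X i j) x := ((hX N i j).differentiable (by simp)) x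

theorem partialD_add (μ : Fin 4) {X Y : MatField p q} (hX : X ∈ smoothFields p q)
    (hY : Y ∈ smoothFields p q) : partialD μ (X + Y) = partialD μ X + partialD μ Y := by
  refine ext_cf fun N => Matrix.ext fun i j => ?_
  rw [map_add, Matrix.add_apply, cf_partialD, cf_partialD, cf_partialD, map_add, Matrix.add_apply]
  funext x
  rw [fderiv_add (cf_differentiable hX N i j x) (cf_differentiable hY N i j x)]
  simp

theorem partialD_smul (μ : Fin 4) (a : ℂ) {X : MatField p q} (hX : X ∈ smoothFields p q) :
    partialD μ (a • X) = a • partialD μ X := by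
  refine ext_cf fun N => Matrix.ext fun i j => ?_
  rw [map_smul, Matrix.smul_apply, cf_partialD, cf_partialD, map_smul, Matrix.smul_apply]
  funext x
  rw [fderiv_const_smul (cf_differentiable hX N i j x)]
  simp

theorem partialD_sub (μ : Fin 4) {X Y : MatField p q} (hX : X ∈ smoothFields p q)
    (hY : Y ∈ smoothFields p q) : partialD μ (X - Y) = partialD μ X - partialD μ Y := by
  rw [sub_eq_add_neg, ← neg_one_smul ℂ, partialD_add μ hX ((smoothFields p q).smul_mem _ hY),
    partialD_smul μ _ hY, neg_one_smul, ← sub_eq_add_neg]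

theorem partialD_one (μ : Fin 4) : partialD μ (1 : MatField p p) = 0 := by
  refine ext_cf fun N => Matrix.ext fun i j => ?_
  rw [cf_partialD]
  cases N with
  | zero =>
    rw [cf_one_zero, Matrix.one_apply]
    split_ifs
    · funext x; rw [show (1 : Spacetime → ℂ) = fun _ => 1 from rfl]; simp
    · funext x; rw [show (0 : Spacetime → ℂ) = fun _ => 0 from rfl]; simp
  | succ N =>
    rw [cf_one_succ]; funext x
    rw [Matrix.zero_apply, show (0 : Spacetime → ℂ) = fun _ => 0 from rfl]; simp

theorem partialD_g_smul (μ : Fin 4) (X : MatField p q) : partialD μ (g • X) = g • partialD μ X := by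
  refine ext_cf fun N => ?_
  cases N with
  | zero =>
    rw [cf_g_smul_zero]
    ext i j x
    rw [cf_partialD, cf_g_smul_zero, Matrix.zero_apply,
      show (0 : Spacetime → ℂ) = fun _ => 0 from rfl]
    simp
  | succ N =>
    rw [cf_g_smul_succ]
    ext i j x
    rw [cf_partialD, cf_g_smul_succ, cf_partialD]

theorem Ord.partialD {k : ℕ} (μ : Fin 4) {X : MatField p q} (hX : Ord k X) : Ord k (partialD μ X) := by
  intro N hN
  ext i j x
  rw [cf_partialD, hX N hN, Matrix.zero_apply, show (0 : Spacetime → ℂ) = fun _ => 0 from rfl]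
  simp

theorem partialD_mul (μ : Fin 4) {X : MatField p q} {Y : MatField q r} (hX : X ∈ smoothFields p q)
    (hY : Y ∈ smoothFields q r) : partialD μ (X * Y) = partialD μ X * Y + X * partialD μ Y := by
  refine ext_cf fun N => Matrix.ext fun i j => ?_
  funext x
  have h1 : cf N (X * Y) i j = fun x => ∑ ab ∈ antidiagonal N, ∑ k, cf ab.1 X i k x * cf ab.2 Y k j x := by
    funext x
    simp [cf_mul, Matrix.sum_apply, Matrix.mul_apply]
  have h2 : HasFDerivAt (cf N (X * Y) i j) (∑ ab ∈ antidiagonal N, ∑ k,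
      (cf ab.1 X i k x • fderiv ℝ (cf ab.2 Y k j) x + cf ab.2 Y k j x • fderiv ℝ (cf ab.1 X i k) x)) x := by
    rw [h1]
    exact HasFDerivAt.fun_sum fun ab _ => HasFDerivAt.fun_sum fun k _ =>
      (cf_differentiable hX ab.1 i k x).hasFDerivAt.fun_mul (cf_differentiable hY ab.2 k j x).hasFDerivAt
  rw [cf_partialD]
  beta_reduce
  rw [h2.fderiv, map_add, cf_mul, cf_mul]
  simp only [Matrix.add_apply, Matrix.sum_apply, Matrix.mul_apply, cf_partialD, Finset.sum_apply,
    Pi.add_apply, Pi.mul_apply, sum_apply, add_apply, smul_apply, smul_eq_mul]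
  rw [← Finset.sum_add_distrib]
  refine Finset.sum_congr rfl fun ab _ => ?_
  rw [← Finset.sum_add_distrib]
  refine Finset.sum_congr rfl fun k _ => ?_
  ring

theorem partialD_fsum (μ : Fin 4) {F : ℕ → MatField p q} (hF : ∀ k, F k ∈ smoothFields p q) :
    partialD μ (fsum F) = fsum fun k => partialD μ (F k) := by
  refine ext_cf fun N => Matrix.ext fun i j => ?_
  rw [cf_partialD, cf_fsum, cf_fsum, Matrix.sum_apply, Matrix.sum_apply]
  simp only [cf_partialD]
  funext x
  rw [fderiv_sum fun k _ => cf_differentiable (hF k) N i j x]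
  simp

theorem fexp_neg_mul_partialD (μ : Fin 4) {Z : MatField p p} (hZ : Ord 1 Z) (hs : Z ∈ smoothFields p p) :
    fexp (-Z) * partialD μ (fexp Z) = expDer (-Z) (partialD μ Z) := by
  rw [fexp_eq Z, partialD_fsum μ (expTerm_mem_smoothFields hs)]
  refine fexp_neg_mul_deriv hZ (hZ.partialD μ) ?_ fun k => ?_
  · rw [expTerm_zero, partialD_one]
  · rw [← partialD_smul μ _ (expTerm_mem_smoothFields hs _), succ_smul_expTerm',
      partialD_mul μ (expTerm_mem_smoothFields hs k) hs]

end Smooth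

/-! ### String integration of matrix fields -/

section MatrixFields

variable {c : Fin 4 → Distr ℝ} (𝓕 : FieldSpace c) {p q n : ℕ}

/-- Matrix fields with coefficients in the complexified space of scalar functions. -/
def FieldSpace.matScalars (p q : ℕ) : Submodule ℂ (MatField p q) where
  carrier := {X | ∀ N i j, cf N X i j ∈ 𝓕.cScalars}
  add_mem' hX hY N i j := by rw [map_add]; exact add_mem (hX N i j) (hY N i j)
  zero_mem' N i j := by rw [map_zero]; exact zero_mem _
  smul_mem' a X hX N i j := by rw [map_smul]; exact 𝓕.cScalars.smul_mem a (hX N i j)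

/-- Vector fields with coefficients in the complexified space of vector functions. -/
def FieldSpace.pots (n : ℕ) : Submodule ℂ (Pot n) where
  carrier := {V | ∀ N i j, (fun μ => cf N (V μ) i j) ∈ 𝓕.cVectors}
  add_mem' hX hY N i j := by
    have := add_mem (hX N i j) (hY N i j)
    convert this using 1
    funext μ
    rw [Pi.add_apply, map_add]
    rfl
  zero_mem' N i j := by
    have := zero_mem 𝓕.cVectors
    convert this using 1
    funext μ
    rw [Pi.zero_apply, map_zero]
    rfl
  smul_mem' a X hX N i j := by
    have := 𝓕.cVectors.smul_mem a (hX N i j)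
    convert this using 1
    funext μ
    rw [Pi.smul_apply, map_smul]
    rfl

variable {𝓕}

theorem matScalars_le_smoothFields : 𝓕.matScalars p q ≤ smoothFields p q :=
  fun _ hX N i j => contDiff_of_mem_cScalars (hX N i j)

theorem mul_mem_matScalars {r : ℕ} {X : MatField p q} {Y : MatField q r} (hX : X ∈ 𝓕.matScalars p q)
    (hY : Y ∈ 𝓕.matScalars q r) : X * Y ∈ 𝓕.matScalars p r := by
  intro N i j
  rw [cf_mul, Matrix.sum_apply]
  refine sum_mem fun ab _ => ?_
  rw [Matrix.mul_apply]
  exact sum_mem fun k _ => mul_mem_cScalars (hX _ _ _) (hY _ _ _)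

theorem mul_mem_pots {X : MatField n n} {V : Pot n} (hX : X ∈ 𝓕.matScalars n n) (hV : V ∈ 𝓕.pots n) :
    (fun μ => X * V μ) ∈ 𝓕.pots n := by
  intro N i j
  have : (fun μ => cf N (X * V μ) i j) =
      ∑ ab ∈ antidiagonal N, ∑ k, fun μ => cf ab.1 X i k * cf ab.2 (V μ) k j := by
    funext μ
    rw [cf_mul, Matrix.sum_apply, Finset.sum_apply]
    refine Finset.sum_congr rfl fun ab _ => ?_
    rw [Matrix.mul_apply, Finset.sum_apply]
  rw [this]
  exact sum_mem fun ab _ => sum_mem fun k _ => mul_mem_cVectors (hX _ _ _) (hV ab.2 k j)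

theorem mul_mem_pots' {X : MatField n n} {V : Pot n} (hX : X ∈ 𝓕.matScalars n n) (hV : V ∈ 𝓕.pots n) :
    (fun μ => V μ * X) ∈ 𝓕.pots n := by
  intro N i j
  have : (fun μ => cf N (V μ * X) i j) =
      ∑ ab ∈ antidiagonal N, ∑ k, fun μ => cf ab.2 X k j * cf ab.1 (V μ) i k := by
    funext μ
    rw [cf_mul, Matrix.sum_apply, Finset.sum_apply]
    refine Finset.sum_congr rfl fun ab _ => ?_
    rw [Matrix.mul_apply, Finset.sum_apply]
    exact Finset.sum_congr rfl fun k _ => mul_comm _ _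
  rw [this]
  exact sum_mem fun ab _ => sum_mem fun k _ => mul_mem_cVectors (hX _ _ _) (hV ab.1 i k)

theorem component_mem_matScalars {V : Pot n} (hV : V ∈ 𝓕.pots n) (μ : Fin 4) :
    V μ ∈ 𝓕.matScalars n n := fun N i j => component_mem_cScalars (hV N i j) μ

theorem gradient_mem_pots {X : MatField n n} (hX : X ∈ 𝓕.matScalars n n) :
    (fun μ => partialD μ X) ∈ 𝓕.pots n := by
  intro N i j
  simp only [cf_partialD]
  exact gradient_mem_cVectors (hX N i j)

theorem deriv_mem_pots {V : Pot n} (hV : V ∈ 𝓕.pots n) (μ : Fin 4) :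
    (fun ν => partialD μ (V ν)) ∈ 𝓕.pots n := by
  intro N i j
  simp only [cf_partialD]
  exact deriv_mem_cVectors (hV N i j) μ

theorem g_smul_mem_pots {V : Pot n} (hV : V ∈ 𝓕.pots n) : (fun μ => g • V μ) ∈ 𝓕.pots n := by
  intro N i j
  cases N with
  | zero => simp only [cf_g_smul_zero]; exact zero_mem 𝓕.cVectors
  | succ N => simp only [cf_g_smul_succ]; exact hV N i j

theorem fsum_mem_pots {F : ℕ → Pot n} (hF : ∀ k, F k ∈ 𝓕.pots n) :
    (fun μ => fsum fun k => F k μ) ∈ 𝓕.pots n := by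
  intro N i j
  have : (fun μ => cf N (fsum fun k => F k μ) i j) =
      ∑ k ∈ Finset.range (N + 1), fun μ => cf N (F k μ) i j := by
    funext μ
    rw [cf_fsum, Matrix.sum_apply, Finset.sum_apply]
  rw [this]
  exact sum_mem fun k _ => hF k N i j

theorem fsum_mem_matScalars {F : ℕ → MatField p q} (hF : ∀ k, F k ∈ 𝓕.matScalars p q) :
    fsum F ∈ 𝓕.matScalars p q := by
  intro N i j
  rw [cf_fsum, Matrix.sum_apply]
  exact sum_mem fun k _ => hF k N i j

/-- The scalar functions form a non-unital algebra, hence the constant term 1 must be removed. -/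
theorem fexp_sub_one_mem_matScalars {X : MatField n n} (hs : X ∈ 𝓕.matScalars n n) :
    fexp X - 1 ∈ 𝓕.matScalars n n := by
  -- The term k = 0 is set to zero instead of shifting the index, so that the truncation at each
  -- order is unchanged.
  have h1 : fexp X - 1 = fsum fun k => if k = 0 then 0 else expTerm X k := by
    refine ext_cf fun N => ?_
    rw [map_sub, fexp_eq, cf_fsum, cf_fsum, Finset.sum_range_succ', Finset.sum_range_succ']
    simp [expTerm_zero]
  have hpow : ∀ k, X ^ (k + 1) ∈ 𝓕.matScalars n n := by
    intro k
    induction k with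
    | zero => simpa using hs
    | succ k ih => rw [pow_succ]; exact mul_mem_matScalars ih hs
  rw [h1]
  refine fsum_mem_matScalars fun k => ?_
  cases k with
  | zero => simp
  | succ k => rw [if_neg (Nat.succ_ne_zero k)]; exact (𝓕.matScalars n n).smul_mem _ (hpow k)

theorem cf_stringInt (V : Pot n) (N : ℕ) (i j : Fin n) :
    cf N (stringInt c V) i j = cInt c fun μ => cf N (V μ) i j := by
  simp [cf_apply, stringInt, pairing, cInt]

theorem stringInt_mem {V : Pot n} (hV : V ∈ 𝓕.pots n) : stringInt c V ∈ 𝓕.matScalars n n := by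
  intro N i j
  rw [cf_stringInt]; exact cInt_mem (hV N i j)

theorem stringInt_add {V W : Pot n} (hV : V ∈ 𝓕.pots n) (hW : W ∈ 𝓕.pots n) :
    stringInt c (V + W) = stringInt c V + stringInt c W := by
  refine ext_cf fun N => Matrix.ext fun i j => ?_
  rw [map_add, Matrix.add_apply, cf_stringInt, cf_stringInt, cf_stringInt,
    ← cInt_add (hV N i j) (hW N i j)]
  rfl

theorem stringInt_smul (a : ℂ) {V : Pot n} (hV : V ∈ 𝓕.pots n) :
    stringInt c (a • V) = a • stringInt c V := by
  refine ext_cf fun N => Matrix.ext fun i j => ?_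
  rw [map_smul, Matrix.smul_apply, cf_stringInt, cf_stringInt, ← cInt_smul a (hV N i j)]
  rfl

theorem real_smul_eq (r : ℝ) (X : MatField p q) : r • X = (r : ℂ) • X := by
  refine ext_cf fun N => ?_
  rw [cf_real_smul, map_smul]
  ext i j x
  simp

theorem real_smul_pot_eq (r : ℝ) (V : Pot n) : r • V = (r : ℂ) • V := by
  funext μ; exact real_smul_eq r (V μ)

theorem stringInt_real_smul (r : ℝ) {V : Pot n} (hV : V ∈ 𝓕.pots n) :
    stringInt c (r • V) = r • stringInt c V := by
  rw [real_smul_pot_eq, real_smul_eq, stringInt_smul _ hV]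

theorem stringInt_sub {V W : Pot n} (hV : V ∈ 𝓕.pots n) (hW : W ∈ 𝓕.pots n) :
    stringInt c (V - W) = stringInt c V - stringInt c W := by
  rw [sub_eq_add_neg, ← neg_one_smul ℂ W, stringInt_add hV ((𝓕.pots n).smul_mem _ hW),
    stringInt_smul _ hW, neg_one_smul, ← sub_eq_add_neg]

variable (c) in
theorem Ord.stringInt {k : ℕ} {V : Pot n} (hV : ∀ μ, Ord k (V μ)) : Ord k (stringInt c V) := by
  intro N hN
  refine Matrix.ext fun i j => ?_
  rw [cf_stringInt]
  have : (fun μ => cf N (V μ) i j) = 0 := by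
    funext μ; rw [hV μ N hN]; rfl
  rw [this, cInt_zero]; rfl

variable (c) in
theorem stringInt_g_smul (V : Pot n) : SQFT.stringInt c (fun μ => g • V μ) = g • SQFT.stringInt c V := by
  refine ext_cf fun N => ?_
  cases N with
  | zero =>
    rw [cf_g_smul_zero]
    exact Ord.stringInt c (fun μ => (Ord.of_zero (V μ)).g_smul) 0 one_pos
  | succ N =>
    rw [cf_g_smul_succ]
    refine Matrix.ext fun i j => ?_
    rw [cf_stringInt, cf_stringInt]
    simp only [cf_g_smul_succ]

theorem stringInt_gradient (hc : IsStringFunction c) {X : MatField n n} (hX : X ∈ 𝓕.matScalars n n) :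
    stringInt c (fun μ => partialD μ X) = -X := by
  refine ext_cf fun N => Matrix.ext fun i j => ?_
  rw [map_neg, Matrix.neg_apply, cf_stringInt]
  simp only [cf_partialD]
  exact cInt_gradient hc (hX N i j)

theorem partialD_stringInt {V : Pot n} (hV : V ∈ 𝓕.pots n) (μ : Fin 4) :
    partialD μ (stringInt c V) = stringInt c fun ν => partialD μ (V ν) := by
  refine ext_cf fun N => Matrix.ext fun i j => ?_
  rw [cf_partialD, cf_stringInt, cf_stringInt]
  simp only [cf_partialD]
  exact fderiv_cInt (hV N i j) μ

/-- String integration commutes with convergent sums. -/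
theorem stringInt_fsum {F : ℕ → Pot n} (hF : ∀ k, F k ∈ 𝓕.pots n) :
    stringInt c (fun μ => fsum fun k => F k μ) = fsum fun k => stringInt c (F k) := by
  have hsum : ∀ (s : Finset ℕ), stringInt c (∑ k ∈ s, F k) = ∑ k ∈ s, stringInt c (F k) := by
    intro s
    induction s using Finset.cons_induction with
    | empty =>
      simpa using stringInt_smul (c := c) 0 (zero_mem (𝓕.pots n))
    | cons a s ha ih =>
      rw [Finset.sum_cons, Finset.sum_cons, stringInt_add (hF a) (sum_mem fun k _ => hF k), ih]
  refine ext_cf fun N => ?_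
  rw [cf_fsum, ← map_sum, ← hsum]
  refine Matrix.ext fun i j => ?_
  rw [cf_stringInt, cf_stringInt]
  congr 1
  funext μ
  rw [cf_fsum, Finset.sum_apply, map_sum]

end MatrixFields

/-! ### Fields with values in the gauge algebra -/

section GaugeValued

variable {n : ℕ} (𝔤 : GaugeAlgebra n) {c : Fin 4 → Distr ℝ} (𝓕 : FieldSpace c)

theorem value_apply {p q : ℕ} (X : MatField p q) (N : ℕ) (x : Spacetime) (i : Fin p) (j : Fin q) :
    value X N x i j = cf N X i j x := rfl

/-- Fields with values in the gauge algebra. -/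
def gaugeFields : Submodule ℝ (MatField n n) where
  carrier := {X | ∀ N x, value X N x ∈ 𝔤.carrier}
  add_mem' {X Y} hX hY N x := by
    have : value (X + Y) N x = value X N x + value Y N x := by
      ext i j; simp [value_apply]
    rw [this]; exact add_mem (hX N x) (hY N x)
  zero_mem' N x := by
    have : value (0 : MatField n n) N x = 0 := by ext i j; simp [value_apply]
    rw [this]; exact zero_mem _
  smul_mem' r X hX N x := by
    have : value (r • X) N x = r • value X N x := by ext i j; simp [value_apply]
    rw [this]; exact 𝔤.carrier.smul_mem r (hX N x)

/-- `𝔤`-valued scalar fields. -/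
def gScalars : Submodule ℝ (MatField n n) := gaugeFields 𝔤 ⊓ (𝓕.matScalars n n).restrictScalars ℝ

/-- `𝔤`-valued vector fields. -/
def gPots : Submodule ℝ (Pot n) where
  carrier := {V | (∀ μ, V μ ∈ gaugeFields 𝔤) ∧ V ∈ 𝓕.pots n}
  add_mem' hV hW := ⟨fun μ => add_mem (hV.1 μ) (hW.1 μ), add_mem hV.2 hW.2⟩
  zero_mem' := ⟨fun _ => zero_mem _, zero_mem _⟩
  smul_mem' r V hV := ⟨fun μ => (gaugeFields 𝔤).smul_mem r (hV.1 μ), by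
    rw [real_smul_pot_eq]; exact (𝓕.pots n).smul_mem _ hV.2⟩

variable {𝔤 𝓕}

theorem mem_gScalars_iff {X : MatField n n} : X ∈ gScalars 𝔤 𝓕 ↔ IsScalarField 𝔤 𝓕 X :=
  ⟨fun h N => ⟨h.1 N, fun i j => h.2 N i j⟩, fun h => ⟨fun N => (h N).1, fun N i j => (h N).2 i j⟩⟩

theorem mem_gPots_iff {V : Pot n} : V ∈ gPots 𝔤 𝓕 ↔ IsVectorField 𝔤 𝓕 V :=
  ⟨fun h N => ⟨fun μ x => h.1 μ N x, fun i j => h.2 N i j⟩,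
    fun h => ⟨fun μ N x => (h N).1 μ x, fun N i j => (h N).2 i j⟩⟩

theorem isSmallScalarField_iff {X : MatField n n} :
    IsSmallScalarField 𝔤 𝓕 X ↔ X ∈ gScalars 𝔤 𝓕 ∧ Ord 1 X := by
  refine and_congr mem_gScalars_iff.symm ⟨fun h N hN => ?_, fun h x => ?_⟩
  · obtain rfl : N = 0 := by omega
    ext i j x
    exact congrFun (congrFun (h x) i) j
  · ext i j
    rw [value_apply, h 0 one_pos]; rfl

theorem value_mul {p q r : ℕ} (X : MatField p q) (Y : MatField q r) (N : ℕ) (x : Spacetime) :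
    value (X * Y) N x = ∑ ab ∈ antidiagonal N, value X ab.1 x * value Y ab.2 x := by
  ext i j
  rw [value_apply, cf_mul, Matrix.sum_apply, Matrix.sum_apply, Finset.sum_apply]
  refine Finset.sum_congr rfl fun ab _ => ?_
  simp [Matrix.mul_apply, value_apply]

theorem adm_I_smul {p : ℕ} (X Y : MatField p p) :
    adm (Complex.I • X) Y = Complex.I • (X * Y - Y * X) := by
  simp [adm, smul_sub]

theorem value_adm {p : ℕ} (X Y : MatField p p) (N : ℕ) (x : Spacetime) :
    value (adm (Complex.I • X) Y) N x = ∑ ab ∈ antidiagonal N,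
      Complex.I • (value X ab.1 x * value Y ab.2 x - value Y ab.2 x * value X ab.1 x) := by
  have h1 : value (adm (Complex.I • X) Y) N x =
      Complex.I • (value (X * Y) N x - value (Y * X) N x) := by
    rw [adm_I_smul]; ext i j; simp [value_apply]
  have h2 : value (Y * X) N x = ∑ ab ∈ antidiagonal N, value Y ab.2 x * value X ab.1 x := by
    rw [value_mul, ← Finset.Nat.sum_antidiagonal_swap]
    rfl
  rw [h1, h2, value_mul, ← Finset.sum_sub_distrib, Finset.smul_sum]

theorem adm_mem_gaugeFields {X Y : MatField n n} (hX : X ∈ gaugeFields 𝔤) (hY : Y ∈ gaugeFields 𝔤) :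
    adm (Complex.I • X) Y ∈ gaugeFields 𝔤 := by
  intro N x
  rw [value_adm]
  exact sum_mem fun ab _ => 𝔤.bracket_mem _ (hX _ _) _ (hY _ _)

theorem fsum_mem_gaugeFields {F : ℕ → MatField n n} (hF : ∀ k, F k ∈ gaugeFields 𝔤) :
    fsum F ∈ gaugeFields 𝔤 := by
  intro N x
  have : value (fsum F) N x = ∑ k ∈ Finset.range (N + 1), value (F k) N x := by
    ext i j
    rw [value_apply, cf_fsum, Matrix.sum_apply, Matrix.sum_apply, Finset.sum_apply]
    rfl
  rw [this]
  exact sum_mem fun k _ => hF k N x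

theorem adm_mem_gPots {X : MatField n n} {V : Pot n} (hX : X ∈ gScalars 𝔤 𝓕) (hV : V ∈ gPots 𝔤 𝓕) :
    (fun μ => adm (Complex.I • X) (V μ)) ∈ gPots 𝔤 𝓕 := by
  refine ⟨fun μ => adm_mem_gaugeFields hX.1 (hV.1 μ), ?_⟩
  have h1 := (𝓕.pots n).smul_mem Complex.I (sub_mem (mul_mem_pots hX.2 hV.2) (mul_mem_pots' hX.2 hV.2))
  convert h1 using 1
  funext μ
  rw [adm_I_smul]; rfl

theorem fsum_mem_gPots {F : ℕ → Pot n} (hF : ∀ k, F k ∈ gPots 𝔤 𝓕) :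
    (fun μ => fsum fun k => F k μ) ∈ gPots 𝔤 𝓕 :=
  ⟨fun μ => fsum_mem_gaugeFields fun k => (hF k).1 μ, fsum_mem_pots fun k => (hF k).2⟩

theorem fsum_mem_gScalars {F : ℕ → MatField n n} (hF : ∀ k, F k ∈ gScalars 𝔤 𝓕) :
    fsum F ∈ gScalars 𝔤 𝓕 :=
  ⟨fsum_mem_gaugeFields fun k => (hF k).1, fsum_mem_matScalars fun k => (hF k).2⟩

theorem gdiv_mem_gPots {V : Pot n} (hV : V ∈ gPots 𝔤 𝓕) : (fun μ => gdiv (V μ)) ∈ gPots 𝔤 𝓕 := by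
  refine ⟨fun μ N x => ?_, fun N i j => ?_⟩
  · have : value (gdiv (V μ)) N x = value (V μ) (N + 1) x := by
      ext i j; rw [value_apply, cf_gdiv]; rfl
    rw [this]; exact hV.1 μ (N + 1) x
  · simp only [cf_gdiv]; exact hV.2 (N + 1) i j

theorem g_smul_mem_gPots {V : Pot n} (hV : V ∈ gPots 𝔤 𝓕) : (fun μ => g • V μ) ∈ gPots 𝔤 𝓕 := by
  refine ⟨fun μ N x => ?_, g_smul_mem_pots hV.2⟩
  cases N with
  | zero =>
    have : value (g • V μ) 0 x = 0 := by ext i j; rw [value_apply, cf_g_smul_zero]; rfl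
    rw [this]; exact zero_mem _
  | succ N =>
    have : value (g • V μ) (N + 1) x = value (V μ) N x := by
      ext i j; rw [value_apply, cf_g_smul_succ]; rfl
    rw [this]; exact hV.1 μ N x

theorem g_smul_mem_gScalars {X : MatField n n} (hX : X ∈ gScalars 𝔤 𝓕) : g • X ∈ gScalars 𝔤 𝓕 := by
  refine ⟨fun N x => ?_, fun N i j => ?_⟩
  · cases N with
    | zero =>
      have : value (g • X) 0 x = 0 := by ext i j; rw [value_apply, cf_g_smul_zero]; rfl
      rw [this]; exact zero_mem _
    | succ N =>
      have : value (g • X) (N + 1) x = value X N x := by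
        ext i j; rw [value_apply, cf_g_smul_succ]; rfl
      rw [this]; exact hX.1 N x
  · cases N with
    | zero => rw [cf_g_smul_zero]; exact zero_mem 𝓕.cScalars
    | succ N => rw [cf_g_smul_succ]; exact hX.2 N i j

/-- The expansion of a real linear map on matrices in terms of real and imaginary parts. -/
theorem linearMap_matrix_eq {W : Type} [AddCommGroup W] [Module ℝ W] {n : ℕ}
    (L : Matrix (Fin n) (Fin n) ℂ →ₗ[ℝ] W) (M : Matrix (Fin n) (Fin n) ℂ) :
    L M = ∑ i, ∑ j, ((M i j).re • L (Matrix.single i j 1) +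
      (M i j).im • L (Matrix.single i j Complex.I)) := by
  conv_lhs => rw [Matrix.matrix_eq_sum_single M]
  rw [map_sum]
  refine Finset.sum_congr rfl fun i _ => ?_
  rw [map_sum]
  refine Finset.sum_congr rfl fun j _ => ?_
  rw [← map_smul, ← map_smul, ← map_add]
  congr 1
  rw [Matrix.smul_single, Matrix.smul_single, ← Matrix.single_add]
  congr 1
  simp

/-- A real subspace is cut out by the functionals that vanish on it. Real-linear operations such as
∂_μ and I_c therefore preserve 𝔤-valuedness as soon as they respect scalar linear relations. -/
theorem mem_carrier_of_forall {M : Matrix (Fin n) (Fin n) ℂ}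
    (h : ∀ L : Matrix (Fin n) (Fin n) ℂ →ₗ[ℝ] ℝ, (∀ X ∈ 𝔤.carrier, L X = 0) → L M = 0) :
    M ∈ 𝔤.carrier := by
  by_contra hM
  obtain ⟨L, hL, hL'⟩ := Submodule.exists_le_ker_of_notMem hM
  exact hL (h L fun X hX => hL' hX)

theorem partialD_mem_gaugeFields (μ : Fin 4) {X : MatField n n} (hX : X ∈ gaugeFields 𝔤)
    (hs : X ∈ smoothFields n n) : partialD μ X ∈ gaugeFields 𝔤 := by
  intro N x
  refine mem_carrier_of_forall fun L hL => ?_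
  have h1 : ∀ y, ∑ i, ∑ j, ((cf N X i j y).re • L (Matrix.single i j 1) +
      (cf N X i j y).im • L (Matrix.single i j Complex.I)) = 0 := fun y => by
    rw [← hL _ (hX N y), linearMap_matrix_eq L (value X N y)]
    rfl
  have hd : ∀ i j, HasFDerivAt (cf N X i j) (fderiv ℝ (cf N X i j) x) x :=
    fun i j => (cf_differentiable hs N i j x).hasFDerivAt
  have h2 : HasFDerivAt (fun y => ∑ i, ∑ j, ((cf N X i j y).re • L (Matrix.single i j 1) +
      (cf N X i j y).im • L (Matrix.single i j Complex.I)))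
      (∑ i, ∑ j, ((Complex.reCLM.comp (fderiv ℝ (cf N X i j) x)).smulRight (L (Matrix.single i j 1)) +
        (Complex.imCLM.comp (fderiv ℝ (cf N X i j) x)).smulRight (L (Matrix.single i j Complex.I)))) x :=
    HasFDerivAt.fun_sum fun i _ => HasFDerivAt.fun_sum fun j _ =>
      ((Complex.reCLM.hasFDerivAt.comp x (hd i j)).smul_const _).fun_add
        ((Complex.imCLM.hasFDerivAt.comp x (hd i j)).smul_const _)
  simp only [h1] at h2
  have h3 := congrArg (fun D => D (e μ)) (h2.unique (hasFDerivAt_const (0 : ℝ) x))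
  simp only [sum_apply, add_apply, ContinuousLinearMap.smulRight_apply,
    ContinuousLinearMap.comp_apply, Complex.reCLM_apply, Complex.imCLM_apply, zero_apply] at h3
  rw [linearMap_matrix_eq L, ← h3]
  simp only [value_apply, cf_partialD]

theorem gradient_mem_gPots {X : MatField n n} (hX : X ∈ gScalars 𝔤 𝓕) :
    (fun μ => partialD μ X) ∈ gPots 𝔤 𝓕 :=
  ⟨fun μ => partialD_mem_gaugeFields μ hX.1 (matScalars_le_smoothFields hX.2), gradient_mem_pots hX.2⟩

/-- A functional L vanishing on 𝔤 gives a real linear relation among the real and imaginary parts of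
the entries of V; the real-linear string integration carries it over to the integrals. -/
theorem stringInt_mem_gScalars {V : Pot n} (hV : V ∈ gPots 𝔤 𝓕) : stringInt c V ∈ gScalars 𝔤 𝓕 := by
  refine ⟨fun N x => mem_carrier_of_forall fun L hL => ?_, stringInt_mem hV.2⟩
  have hv := fun i j => hV.2 N i j
  have h1 : ∑ i, ∑ j, (L (Matrix.single i j 1) • (⟨_, (hv i j).1⟩ : 𝓕.vectors) +
      L (Matrix.single i j Complex.I) • (⟨_, (hv i j).2⟩ : 𝓕.vectors)) = 0 := by
    refine Subtype.ext ?_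
    funext μ y
    have := linearMap_matrix_eq L (value (V μ) N y)
    rw [hL _ (hV.1 μ N y)] at this
    simp only [Submodule.coe_sum, Submodule.coe_add, Submodule.coe_smul, Finset.sum_apply, Pi.add_apply,
      Pi.smul_apply, smul_eq_mul, Submodule.coe_zero, Pi.zero_apply]
    rw [this]
    simp only [value_apply, smul_eq_mul, mul_comm]
  have h2 := congrFun (congrArg 𝓕.realInt h1) x
  simp only [map_sum, map_add, map_smul, map_zero, Finset.sum_apply, Pi.add_apply, Pi.smul_apply,
    Pi.zero_apply] at h2
  rw [linearMap_matrix_eq L, ← h2]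
  simp only [value_apply, cf_stringInt, cInt_re (hv _ _), cInt_im (hv _ _), smul_eq_mul, mul_comm]

end GaugeValued

/-! ### The gauge action and the uniqueness of the dressing factor -/

section GaugeAction

variable {n : ℕ} {𝔤 : GaugeAlgebra n} {c : Fin 4 → Distr ℝ} {𝓕 : FieldSpace c}

/-- `V (a + i∂) V'`, where `V'` is the inverse of `V`. -/
def gact (V V' : MatField n n) (a : Pot n) : Pot n := fun μ =>
  V * a μ * V' + Complex.I • (V * partialD μ V')

/-- Left action property of the affine gauge action; the inverse is carried as a separate argument
to avoid matrix inverses. -/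
theorem gact_gact {V₁ V₁' V₂ V₂' : MatField n n} (h₁ : V₁ * V₁' = 1) (hV₁ : V₁' ∈ smoothFields n n)
    (hV₂ : V₂' ∈ smoothFields n n) (a : Pot n) :
    gact V₂ V₂' (gact V₁ V₁' a) = gact (V₂ * V₁) (V₁' * V₂') a := by
  funext μ
  have h : V₂ * partialD μ V₂' = V₂ * (V₁ * V₁') * partialD μ V₂' := by rw [h₁, mul_one]
  simp only [gact]
  rw [partialD_mul μ hV₁ hV₂, h]
  simp only [mul_add, add_mul, smul_add, mul_smul_comm, smul_mul_assoc, mul_assoc, add_assoc]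

variable (𝓕) in
/-- Matrix fields of the form `1 + O(g)` with coefficients in the space of scalar functions. -/
def IsUnip (V : MatField n n) : Prop := V - 1 ∈ 𝓕.matScalars n n ∧ Ord 1 (V - 1)

theorem IsUnip.smooth {V : MatField n n} (hV : IsUnip 𝓕 V) : V ∈ smoothFields n n := by
  have := add_mem (matScalars_le_smoothFields hV.1) one_mem_smoothFields
  simpa using this

theorem IsUnip.mul {V W : MatField n n} (hV : IsUnip 𝓕 V) (hW : IsUnip 𝓕 W) : IsUnip 𝓕 (V * W) := by
  have h : V * W - 1 = (V - 1) * (W - 1) + (V - 1) + (W - 1) := by noncomm_ring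
  rw [IsUnip, h]
  exact ⟨add_mem (add_mem (mul_mem_matScalars hV.1 hW.1) hV.1) hW.1,
    ((hV.2.mul_right _).add hV.2).add hW.2⟩

theorem IsUnip.fexp {Z : MatField n n} (hs : Z ∈ 𝓕.matScalars n n) (hZ : Ord 1 Z) :
    IsUnip 𝓕 (fexp Z) := ⟨fexp_sub_one_mem_matScalars hs, ord_fexp_sub_one hZ⟩

theorem IsUnip.partialD_eq {V : MatField n n} (hV : IsUnip 𝓕 V) (μ : Fin 4) :
    partialD μ V = partialD μ (V - 1) := by
  rw [partialD_sub μ hV.smooth one_mem_smoothFields, partialD_one, sub_zero]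

theorem IsUnip.mul_mem_pots {V : MatField n n} (hV : IsUnip 𝓕 V) {a : Pot n} (ha : a ∈ 𝓕.pots n) :
    (fun μ => V * a μ) ∈ 𝓕.pots n := by
  have := add_mem (SQFT.mul_mem_pots hV.1 ha) ha
  convert this using 1
  funext μ
  simp [sub_mul]

theorem IsUnip.mul_mem_pots' {V : MatField n n} (hV : IsUnip 𝓕 V) {a : Pot n} (ha : a ∈ 𝓕.pots n) :
    (fun μ => a μ * V) ∈ 𝓕.pots n := by
  have := add_mem (SQFT.mul_mem_pots' hV.1 ha) ha
  convert this using 1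
  funext μ
  simp [mul_sub]

theorem IsUnip.partialD_mem_pots {V : MatField n n} (hV : IsUnip 𝓕 V) :
    (fun μ => partialD μ V) ∈ 𝓕.pots n := by
  simp only [hV.partialD_eq]
  exact gradient_mem_pots hV.1

theorem gact_mem_pots {V V' : MatField n n} (hV : IsUnip 𝓕 V) (hV' : IsUnip 𝓕 V') {a : Pot n}
    (ha : a ∈ 𝓕.pots n) : gact V V' a ∈ 𝓕.pots n :=
  add_mem (hV'.mul_mem_pots' (hV.mul_mem_pots ha))
    ((𝓕.pots n).smul_mem Complex.I (hV.mul_mem_pots hV'.partialD_mem_pots))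

theorem Ord.gact {V V' : MatField n n} (hV' : IsUnip 𝓕 V') {a : Pot n} (ha : ∀ μ, Ord 1 (a μ))
    (μ : Fin 4) : Ord 1 (gact V V' a μ) := by
  refine (((ha μ).mul_left V).mul_right V').add ?_
  rw [hV'.partialD_eq]
  exact ((hV'.2.partialD μ).mul_left V).smul _

/-- With d = D - 1 = O(g^{k+1}), the transformed potential is b - i∂d + O(g^{k+2}). Its string
integral is I_c(b) + id + O(g^{k+2}), so the two vanishing integrals force d = O(g^{k+2}). -/
theorem eq_one_of_stringInt_gact (hc : IsStringFunction c) {D D' : MatField n n} (hDD : D * D' = 1)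
    (hD : IsUnip 𝓕 D) (hD' : IsUnip 𝓕 D') {b : Pot n} (hb : b ∈ 𝓕.pots n) (hbo : ∀ μ, Ord 1 (b μ))
    (h0 : stringInt c b = 0) (h1 : stringInt c (gact D D' b) = 0) : D = 1 := by
  rw [← sub_eq_zero]
  refine eq_zero_of_ord fun k => ?_
  suffices h : Ord (k + 1) (D - 1) from h.mono (Nat.le_succ k)
  induction k with
  | zero => exact hD.2
  | succ k ih =>
    set d := D - 1 with hd
    have hDd : D = 1 + d := by rw [hd]; abel
    have e1 : D' - 1 = -(d * D') := by
      rw [hd, sub_mul, hDD, one_mul]; abel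
    have o1 : Ord (k + 1) (D' - 1) := by rw [e1]; exact (ih.mul_right _).neg
    have e2 : D' - 1 + d = -(d * (D' - 1)) := by
      rw [mul_sub, mul_one, neg_sub, e1, neg_add_eq_sub]
    have o2 : Ord (k + 2) (D' - 1 + d) := by rw [e2]; exact ((ih.mul o1).mono (by omega)).neg
    have hds : d ∈ smoothFields n n := matScalars_le_smoothFields hD.1
    have hds' : D' - 1 ∈ smoothFields n n := matScalars_le_smoothFields hD'.1
    -- The error of the approximation b - i∂d of the transformed potential.
    set R : Pot n := gact D D' b - b + Complex.I • (fun μ => partialD μ d) with hR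
    have hgrad := gradient_mem_pots hD.1
    have hgact := gact_mem_pots hD hD' hb
    have hRo : ∀ μ, Ord (k + 2) (R μ) := by
      intro μ
      have : R μ = d * b μ * D' + b μ * (D' - 1) + Complex.I • (partialD μ (D' - 1 + d) +
          d * partialD μ (D' - 1)) := by
        rw [partialD_add μ hds' hds, hR]
        simp only [Pi.add_apply, Pi.sub_apply, Pi.smul_apply, gact]
        rw [hD'.partialD_eq, hDd]
        simp only [add_mul, one_mul, mul_sub, mul_one, smul_add]
        abel
      rw [this]
      refine Ord.add (Ord.add ?_ ?_) ((Ord.add (o2.partialD μ) ?_).smul _)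
      · exact ((ih.mul (hbo μ)).mul_right D').mono (by omega)
      · exact ((hbo μ).mul o1).mono (by omega)
      · exact (ih.mul (o1.partialD μ)).mono (by omega)
    have hRI : stringInt c R = -(Complex.I • d) := by
      rw [hR, stringInt_add (sub_mem hgact hb) ((𝓕.pots n).smul_mem _ hgrad),
        stringInt_sub hgact hb, stringInt_smul _ hgrad, stringInt_gradient hc hD.1, h0, h1, sub_zero, zero_add, smul_neg]
    have h2 : d = Complex.I • stringInt c R := by
      rw [hRI, smul_neg, smul_smul, Complex.I_mul_I]; simp
    rw [h2]
    exact (Ord.stringInt c hRo).smul _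

/-- The dressing factor is determined by the vanishing of the string integral of the dressed
potential. -/
theorem eq_of_stringInt_gact (hc : IsStringFunction c) {V V' W W' : MatField n n}
    (hVV : V * V' = 1) (hVV' : V' * V = 1) (hWW : W * W' = 1)
    (hV : IsUnip 𝓕 V) (hV' : IsUnip 𝓕 V') (hW : IsUnip 𝓕 W) (hW' : IsUnip 𝓕 W') {a : Pot n}
    (ha : a ∈ 𝓕.pots n) (hao : ∀ μ, Ord 1 (a μ)) (h0 : stringInt c (gact V V' a) = 0)
    (h1 : stringInt c (gact W W' a) = 0) : W = V := by
  have h2 : gact (W * V') (V * W') (gact V V' a) = gact W W' a := by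
    rw [gact_gact hVV hV'.smooth (hV.mul hW').smooth, mul_assoc, hVV', mul_one, ← mul_assoc, hVV', one_mul]
  have h3 : W * V' * (V * W') = 1 := by
    rw [mul_assoc, ← mul_assoc V', hVV', one_mul, hWW]
  have h4 := eq_one_of_stringInt_gact hc h3 (hW.mul hV') (hV.mul hW') (gact_mem_pots hV hV' ha)
    (fun μ => Ord.gact hV' hao μ) h0 (by rw [h2]; exact h1)
  calc W = W * V' * V := by rw [mul_assoc, hVV', mul_one]
    _ = V := by rw [h4, one_mul]

-- Exponential gauge factors and 𝔤-valued potentials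

theorem expDer_smul {p : ℕ} (Z Y : MatField p p) (a : ℂ) : expDer Z (a • Y) = a • expDer Z Y := by
  have : ∀ k, (adm Z)^[k] (a • Y) = a • (adm Z)^[k] Y := by
    intro k
    induction k with
    | zero => rfl
    | succ k ih => rw [Function.iterate_succ_apply', ih, adm_smul, Function.iterate_succ_apply']
  rw [expDer, expDer, fsum_smul]
  congr 1
  funext k
  rw [this, smul_comm]

/-- The inhomogeneous term i e^{iX} ∂e^{-iX} becomes a series of iterated commutators applied to ∂X,
hence 𝔤-valued. -/
theorem gact_fexp {X : MatField n n} (hX : Ord 1 X) (hs : X ∈ smoothFields n n) (a : Pot n) (μ : Fin 4) :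
    gact (fexp (Complex.I • X)) (fexp (-(Complex.I • X))) a μ =
      fexp (Complex.I • X) * a μ * fexp (-(Complex.I • X)) +
        expDer (Complex.I • X) (partialD μ X) := by
  have h := fexp_neg_mul_partialD μ (hX.smul Complex.I).neg
    (neg_mem ((smoothFields n n).smul_mem Complex.I hs))
  rw [neg_neg] at h
  have h2 : partialD μ (-(Complex.I • X)) = -Complex.I • partialD μ X := by
    rw [← partialD_smul μ _ hs, neg_smul]
  rw [gact, h, h2, expDer_smul, smul_smul, mul_neg, Complex.I_mul_I, neg_neg, one_smul]

theorem iterate_adm_mem_gPots {X : MatField n n} {V : Pot n} (hX : X ∈ gScalars 𝔤 𝓕)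
    (hV : V ∈ gPots 𝔤 𝓕) (k : ℕ) : (fun μ => (adm (Complex.I • X))^[k] (V μ)) ∈ gPots 𝔤 𝓕 := by
  induction k with
  | zero => exact hV
  | succ k ih =>
    simp only [Function.iterate_succ_apply']
    exact adm_mem_gPots hX ih

/-- The gauge algebra is only a real subspace, so the coefficients 1/k! have to be read as real
scalars. -/
theorem inv_natCast_smul (k : ℕ) (X : MatField n n) : ((k : ℂ)⁻¹) • X = ((k : ℝ)⁻¹) • X := by
  rw [real_smul_eq]; push_cast; rfl

/-- Conjugation is the series e^{ad(iX)}, each term of which is built from brackets i[X, ·]. -/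
theorem conj_mem_gPots {X : MatField n n} {V : Pot n} (hX : X ∈ gScalars 𝔤 𝓕) (hXo : Ord 1 X)
    (hV : V ∈ gPots 𝔤 𝓕) :
    (fun μ => fexp (Complex.I • X) * V μ * fexp (-(Complex.I • X))) ∈ gPots 𝔤 𝓕 := by
  simp only [fexp_conj (hXo.smul Complex.I), inv_natCast_smul]
  exact fsum_mem_gPots fun k => (gPots 𝔤 𝓕).smul_mem _ (iterate_adm_mem_gPots hX hV k)

theorem expDer_mem_gPots {X : MatField n n} {V : Pot n} (hX : X ∈ gScalars 𝔤 𝓕)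
    (hV : V ∈ gPots 𝔤 𝓕) : (fun μ => expDer (Complex.I • X) (V μ)) ∈ gPots 𝔤 𝓕 := by
  simp only [expDer, inv_natCast_smul]
  exact fsum_mem_gPots fun k => (gPots 𝔤 𝓕).smul_mem _ (iterate_adm_mem_gPots hX hV k)

theorem gScalars_smooth {X : MatField n n} (hX : X ∈ gScalars 𝔤 𝓕) : X ∈ smoothFields n n :=
  matScalars_le_smoothFields hX.2

theorem gact_fexp_mem_gPots {X : MatField n n} {a : Pot n} (hX : X ∈ gScalars 𝔤 𝓕) (hXo : Ord 1 X)
    (ha : a ∈ gPots 𝔤 𝓕) :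
    gact (fexp (Complex.I • X)) (fexp (-(Complex.I • X))) a ∈ gPots 𝔤 𝓕 := by
  have : gact (fexp (Complex.I • X)) (fexp (-(Complex.I • X))) a =
      (fun μ => fexp (Complex.I • X) * a μ * fexp (-(Complex.I • X))) +
        fun μ => expDer (Complex.I • X) (partialD μ X) :=
    funext fun μ => gact_fexp hXo (gScalars_smooth hX) a μ
  rw [this]
  exact add_mem (conj_mem_gPots hX hXo ha) (expDer_mem_gPots hX (gradient_mem_gPots hX))

theorem isUnip_fexp_I {X : MatField n n} (hX : X ∈ gScalars 𝔤 𝓕) (hXo : Ord 1 X) :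
    IsUnip 𝓕 (fexp (Complex.I • X)) :=
  IsUnip.fexp ((𝓕.matScalars n n).smul_mem _ hX.2) (hXo.smul _)

theorem isUnip_fexp_neg_I {X : MatField n n} (hX : X ∈ gScalars 𝔤 𝓕) (hXo : Ord 1 X) :
    IsUnip 𝓕 (fexp (-(Complex.I • X))) := by
  rw [← smul_neg]; exact isUnip_fexp_I (neg_mem hX) hXo.neg

theorem g_smul_add_gdiv {θ θ' : MatField n n} (hθ : IsUnip 𝓕 θ') (A : Pot n) (μ : Fin 4) :
    g • (θ * A μ * θ' + Complex.I • gdiv (θ * partialD μ θ')) = gact θ θ' (fun μ => g • A μ) μ := by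
  have h : Ord 1 (θ * partialD μ θ') := by
    rw [hθ.partialD_eq]; exact (hθ.2.partialD μ).mul_left θ
  rw [smul_add, smul_comm g Complex.I, g_smul_gdiv h, gact, mul_smul_comm, smul_mul_assoc]

theorem g_smul_gaugeA {θ : MatField n n} (hθ : IsUnip 𝓕 θ) (A : Pot n) :
    (fun μ => g • gaugeA θ A μ) = gact θ⁻¹ θ (fun μ => g • A μ) :=
  funext fun μ => g_smul_add_gdiv hθ A μ

theorem gaugeA_mem_gPots {θ : MatField n n} (hθ : IsGroupField 𝔤 𝓕 θ) {A : Pot n} (hA : A ∈ gPots 𝔤 𝓕) :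
    gaugeA θ A ∈ gPots 𝔤 𝓕 := by
  obtain ⟨X, hX, rfl⟩ := hθ
  obtain ⟨hX, hXo⟩ := isSmallScalarField_iff.mp hX
  have h1 : gaugeA (fexp (Complex.I • X)) A =
      fun μ => gdiv (gact (fexp (Complex.I • X))⁻¹ (fexp (Complex.I • X)) (fun μ => g • A μ) μ) := by
    funext μ
    rw [← g_smul_gaugeA (isUnip_fexp_I hX hXo)]
    refine g_smul_injective ?_
    rw [g_smul_gdiv (Ord.g_smul (Ord.of_zero _))]
  rw [h1]
  refine gdiv_mem_gPots ?_
  have h2 := gact_fexp_mem_gPots (neg_mem hX) hXo.neg (g_smul_mem_gPots hA)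
  rwa [smul_neg, neg_neg, ← fexp_inv (hXo.smul _)] at h2

end GaugeAction

/-! ### Functionals represented by series in the spaces `S` and `V` -/

section PowerOfG

variable {p q r : ℕ}

theorem Ord.g_pow_smul (k : ℕ) {l : ℕ} {X : MatField p q} (hX : Ord l X) : Ord (k + l) (g ^ k • X) := by
  induction k with
  | zero => simpa using hX
  | succ k ih =>
    rw [pow_succ', mul_smul]
    exact ih.g_smul.mono (by omega)

theorem ord_g_pow_smul (k : ℕ) (X : MatField p q) : Ord k (g ^ k • X) := (Ord.of_zero X).g_pow_smul k

/-- The series `∑_k g^k F_k`. -/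
def gser (F : ℕ → MatField p q) : MatField p q := fsum fun k => g ^ k • F k

theorem cf_g_pow_smul (k N : ℕ) (X : MatField p q) : cf (k + N) (g ^ k • X) = cf N X := by
  induction k with
  | zero => simp
  | succ k ih => rw [pow_succ', mul_smul, show k + 1 + N = (k + N) + 1 by omega, cf_g_smul_succ, ih]

theorem cf_gser (F : ℕ → MatField p q) (N : ℕ) :
    cf N (gser F) = ∑ k ∈ Finset.range (N + 1), cf (N - k) (F k) := by
  rw [gser, cf_fsum]
  refine Finset.sum_congr rfl fun k hk => ?_
  have : N = k + (N - k) := by have := Finset.mem_range.mp hk; omega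
  conv_lhs => rw [this, cf_g_pow_smul]

theorem gsum_eq (F : ℕ → MatField p q) : gsum F = g • gser F := by
  refine ext_cf fun N => ?_
  cases N with
  | zero => rw [cf_g_smul_zero]; ext; simp [cf_apply, gsum]
  | succ N =>
    rw [cf_g_smul_succ, cf_gser]
    ext i j : 2
    simp [cf_apply, gsum, Matrix.sum_apply]

theorem gser_mul_gser (F : ℕ → MatField p q) (G : ℕ → MatField q r) :
    gser F * gser G = gser fun N => ∑ ab ∈ antidiagonal N, F ab.1 * G ab.2 := by
  rw [gser, gser, fsum_mul_fsum (fun k => ord_g_pow_smul k _) (fun k => ord_g_pow_smul k _), gser]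
  congr 1
  funext N
  rw [Finset.smul_sum]
  refine Finset.sum_congr rfl fun ab hab => ?_
  rw [Matrix.smul_mul, Matrix.mul_smul, smul_smul, ← pow_add, mem_antidiagonal.mp hab]

theorem gser_add (F G : ℕ → MatField p q) : gser F + gser G = gser fun k => F k + G k := by
  simp only [gser, fsum_add, smul_add]

theorem gser_real_smul (a : ℝ) (F : ℕ → MatField p q) : a • gser F = gser fun k => a • F k := by
  rw [gser, fsum_real_smul, gser]
  congr 1; funext k; exact smul_comm _ _ _

theorem gser_smul (a : ℂ) (F : ℕ → MatField p q) : a • gser F = gser fun k => a • F k := by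
  rw [gser, fsum_smul, gser]
  congr 1; funext k; exact smul_comm _ _ _

theorem gser_zero : gser (fun _ => (0 : MatField p q)) = 0 := by
  refine ext_cf fun N => ?_
  simp [cf_gser]

theorem ord_gser {k : ℕ} {F : ℕ → MatField p q} (h : ∀ j < k, F j = 0) : Ord k (gser F) := by
  refine Ord.fsum fun j => ?_
  rcases lt_or_ge j k with hj | hj
  · rw [h j hj, smul_zero]; exact ord_zero k
  · exact (ord_g_pow_smul j _).mono hj

/-- The vanishing of `F j l` for l < j makes the sum over j finite for each power g^l. -/
theorem fsum_gser {F : ℕ → ℕ → MatField p q} (h : ∀ j, ∀ l < j, F j l = 0) :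
    fsum (fun j => gser (F j)) = gser fun l => ∑ j ∈ Finset.range (l + 1), F j l := by
  refine ext_cf fun N => ?_
  simp only [cf_fsum, cf_gser, map_sum]
  rw [Finset.sum_comm]
  refine Finset.sum_congr rfl fun l hl => ?_
  have hl := Finset.mem_range.mp hl
  refine (Finset.sum_subset (by intro j; simp; omega) fun j _ hj => ?_).symm
  rw [h j l (by simpa [Nat.lt_succ_iff] using hj), map_zero]

theorem g_smul_gser (F : ℕ → MatField p q) :
    g • gser F = gser fun k => match k with | 0 => 0 | k + 1 => F k := by
  refine ext_cf fun N => ?_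
  cases N with
  | zero => rw [cf_g_smul_zero, cf_gser]; simp
  | succ N => rw [cf_g_smul_succ, cf_gser, cf_gser, Finset.sum_range_succ' _ (N + 1)]; simp

theorem gser_eq_g_smul {F : ℕ → MatField p q} (h : F 0 = 0) : gser F = g • gser fun k => F (k + 1) := by
  rw [g_smul_gser]
  congr 1
  funext k
  cases k with
  | zero => exact h
  | succ k => rfl

end PowerOfG

section Represented

variable {n : ℕ} {𝔤 : GaugeAlgebra n} {c : Fin 4 → Distr ℝ} {𝓕 : FieldSpace c}

mutual

theorem IsV.mem_gPots {v : Pot n → Pot n} : IsV c v → ∀ A ∈ gPots 𝔤 𝓕, v A ∈ gPots 𝔤 𝓕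
  | .potential => fun _ hA => hA
  | .gradient _ hs => fun A hA => gradient_mem_gPots (hs.mem_gScalars A hA)
  | .ad s v hs hv => fun A hA => by
    have := adm_mem_gPots (hs.mem_gScalars A hA) (hv.mem_gPots A hA)
    simpa only [adm_I_smul] using this
  | .add _ _ hv hw => fun A hA => add_mem (hv.mem_gPots A hA) (hw.mem_gPots A hA)
  | .smul r _ hv => fun A hA => (gPots 𝔤 𝓕).smul_mem r (hv.mem_gPots A hA)

theorem IsS.mem_gScalars {s : Pot n → MatField n n} : IsS c s → ∀ A ∈ gPots 𝔤 𝓕, s A ∈ gScalars 𝔤 𝓕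
  | .string _ hv => fun A hA => stringInt_mem_gScalars (hv.mem_gPots A hA)
  | .add _ _ hs ht => fun A hA => add_mem (hs.mem_gScalars A hA) (ht.mem_gScalars A hA)
  | .smul r _ hs => fun A hA => (gScalars 𝔤 𝓕).smul_mem r (hs.mem_gScalars A hA)

end

/-- Families of functionals of the potential. -/
abbrev Fam (n : ℕ) (ι : Type) : Type := Pot n → ι → MatField n n

variable (n c) in
/-- The space of vector functionals. -/
def spaceV : Submodule ℝ (Fam n (Fin 4)) where
  carrier := {v | IsV c v}
  add_mem' hv hw := IsV.add _ _ hv hw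
  zero_mem' := by
    have := IsV.smul (c := c) (n := n) 0 _ IsV.potential
    simp only [zero_smul] at this
    exact this
  smul_mem' r _ hv := IsV.smul r _ hv

variable (n c) in
/-- The space of scalar functionals. -/
def spaceS : Submodule ℝ (Fam n Unit) where
  carrier := {s | IsS c fun A => s A ()}
  add_mem' hv hw := IsS.add _ _ hv hw
  zero_mem' := by
    have := IsS.smul (c := c) (n := n) 0 _ (IsS.string _ IsV.potential)
    simp only [zero_smul] at this
    exact this
  smul_mem' r _ hv := IsS.smul r _ hv

variable (𝔤 𝓕) in
/-- The functionals whose values on gauge potentials are given by a series `∑_{j ≥ k} g^j v_j` with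
`v_j` in the space `𝒱`. -/
def Rep {ι : Type} (𝒱 : Submodule ℝ (Fam n ι)) (k : ℕ) : Submodule ℝ (Fam n ι) where
  carrier := {F | ∃ v : ℕ → Fam n ι, (∀ j, v j ∈ 𝒱) ∧ (∀ j < k, v j = 0) ∧
    ∀ A ∈ gPots 𝔤 𝓕, ∀ i, F A i = gser fun j => v j A i}
  add_mem' := by
    rintro F G ⟨v, hv, hv0, hF⟩ ⟨w, hw, hw0, hG⟩
    refine ⟨fun j => v j + w j, fun j => add_mem (hv j) (hw j), fun j hj => ?_, fun A hA i => ?_⟩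
    · beta_reduce; rw [hv0 j hj, hw0 j hj, add_zero]
    · rw [Pi.add_apply, Pi.add_apply, hF A hA, hG A hA, gser_add]; rfl
  zero_mem' := ⟨fun _ => 0, fun _ => zero_mem _, fun _ _ => rfl, fun A _ i => gser_zero.symm⟩
  smul_mem' := by
    rintro r F ⟨v, hv, hv0, hF⟩
    refine ⟨fun j => r • v j, fun j => 𝒱.smul_mem r (hv j), fun j hj => ?_, fun A hA i => ?_⟩
    · beta_reduce; rw [hv0 j hj, smul_zero]
    · rw [Pi.smul_apply, Pi.smul_apply, hF A hA, gser_real_smul]; rfl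

-- Series with coefficients in an arbitrary space of functionals

section Generic

variable {ι : Type} {𝒱 : Submodule ℝ (Fam n ι)}

theorem rep_congr {k : ℕ} {F G : Fam n ι} (h : ∀ A ∈ gPots 𝔤 𝓕, ∀ i, F A i = G A i)
    (hF : F ∈ Rep 𝔤 𝓕 𝒱 k) : G ∈ Rep 𝔤 𝓕 𝒱 k := by
  obtain ⟨v, hv, hv0, hF⟩ := hF
  exact ⟨v, hv, hv0, fun A hA i => by rw [← h A hA, hF A hA]⟩

theorem rep_mono {k l : ℕ} (h : l ≤ k) {F : Fam n ι} (hF : F ∈ Rep 𝔤 𝓕 𝒱 k) : F ∈ Rep 𝔤 𝓕 𝒱 l := by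
  obtain ⟨v, hv, hv0, hF⟩ := hF
  exact ⟨v, hv, fun j hj => hv0 j (hj.trans_le h), hF⟩

theorem rep_ord {k : ℕ} {F : Fam n ι} (hF : F ∈ Rep 𝔤 𝓕 𝒱 k) {A : Pot n} (hA : A ∈ gPots 𝔤 𝓕) (i : ι) :
    Ord k (F A i) := by
  obtain ⟨v, hv, hv0, hF⟩ := hF
  rw [hF A hA]
  exact ord_gser fun j hj => by rw [hv0 j hj]; rfl

theorem rep_of_mem {F : Fam n ι} (hF : F ∈ 𝒱) : F ∈ Rep 𝔤 𝓕 𝒱 0 := by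
  refine ⟨fun j => if j = 0 then F else 0, fun j => ?_, by simp, fun A _ i => ?_⟩
  · dsimp only; split_ifs
    · exact hF
    · exact zero_mem _
  · rw [gser, fsum_eq_single]
    · simp
    · intro k; simp

theorem rep_g_smul {k : ℕ} {F : Fam n ι} (hF : F ∈ Rep 𝔤 𝓕 𝒱 k) :
    (fun A i => g • F A i) ∈ Rep 𝔤 𝓕 𝒱 (k + 1) := by
  obtain ⟨v, hv, hv0, hF⟩ := hF
  refine ⟨fun j => match j with | 0 => 0 | j + 1 => v j, fun j => ?_, fun j hj => ?_, fun A hA i => ?_⟩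
  · cases j with
    | zero => exact zero_mem _
    | succ j => exact hv j
  · cases j with
    | zero => rfl
    | succ j => exact hv0 j (by omega)
  · beta_reduce; rw [hF A hA, g_smul_gser]
    congr 1; funext j
    cases j <;> rfl

theorem exists_of_rep_one {F : Fam n ι} (hF : F ∈ Rep 𝔤 𝓕 𝒱 1) :
    ∃ v : ℕ → Fam n ι, (∀ j, v j ∈ 𝒱) ∧
      ∀ A ∈ gPots 𝔤 𝓕, ∀ i, F A i = gsum fun j => v j A i := by
  obtain ⟨v, hv, hv0, hF⟩ := hF
  refine ⟨fun j => v (j + 1), fun j => hv _, fun A hA i => ?_⟩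
  rw [hF A hA, gsum_eq, gser_eq_g_smul (F := fun j => v j A i) (by rw [hv0 0 one_pos]; rfl)]

theorem rep_one_of_gsum {v : ℕ → Fam n ι} (hv : ∀ j, v j ∈ 𝒱) {F : Fam n ι}
    (hF : ∀ A ∈ gPots 𝔤 𝓕, ∀ i, F A i = gsum fun j => v j A i) : F ∈ Rep 𝔤 𝓕 𝒱 1 := by
  have h : (fun A i => gser fun j => v j A i) ∈ Rep 𝔤 𝓕 𝒱 0 :=
    ⟨v, hv, fun j hj => absurd hj (Nat.not_lt_zero j), fun _ _ _ => rfl⟩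
  exact rep_congr (fun A hA i => by rw [hF A hA, gsum_eq]) (rep_g_smul h)

/-- The growing order k makes the rearranged coefficients finite sums within the space of
functionals; the uniform order m is the order of the sum. -/
theorem rep_fsum {m : ℕ} {F : ℕ → Fam n ι} (hF : ∀ k, F k ∈ Rep 𝔤 𝓕 𝒱 k) (hm : ∀ k, F k ∈ Rep 𝔤 𝓕 𝒱 m) :
    (fun A i => fsum fun k => F k A i) ∈ Rep 𝔤 𝓕 𝒱 m := by
  -- Both orders must be realized by a single choice of coefficients, hence the maximum.
  have h : ∀ k, F k ∈ Rep 𝔤 𝓕 𝒱 (max k m) := fun k => by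
    rcases max_choice k m with h | h <;> rw [h]
    exacts [hF k, hm k]
  choose v hv hv0 hF using h
  refine ⟨fun l => ∑ j ∈ Finset.range (l + 1), v j l, fun l => sum_mem fun j _ => hv j l, fun l hl => ?_,
    fun A hA i => ?_⟩
  · exact Finset.sum_eq_zero fun j _ => hv0 j l (lt_max_of_lt_right hl)
  · simp only [hF _ A hA]
    rw [fsum_gser fun j l hl => by rw [hv0 j l (lt_max_of_lt_left hl)]; rfl]
    congr 1; funext l
    rw [Finset.sum_apply, Finset.sum_apply]

end Generic

variable (𝔤 𝓕) in
/-- Vector functionals represented by series of order `g^k`. -/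
abbrev RepV (k : ℕ) (F : Pot n → Pot n) : Prop := F ∈ Rep 𝔤 𝓕 (spaceV n c) k

variable (𝔤 𝓕) in
/-- Scalar functionals represented by series of order `g^k`. -/
abbrev RepS (k : ℕ) (f : Pot n → MatField n n) : Prop := (fun A _ => f A) ∈ Rep 𝔤 𝓕 (spaceS n c) k

theorem RepV.mem_gPots {k : ℕ} {F : Pot n → Pot n} (hF : RepV 𝔤 𝓕 k F) {A : Pot n}
    (hA : A ∈ gPots 𝔤 𝓕) : F A ∈ gPots 𝔤 𝓕 := by
  obtain ⟨v, hv, -, hF⟩ := hF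
  rw [show F A = fun μ => fsum fun j => g ^ j • v j A μ from funext fun μ => hF A hA μ]
  refine fsum_mem_gPots fun j => ?_
  have : ∀ k, (fun μ => g ^ k • v j A μ) ∈ gPots 𝔤 𝓕 := fun k => by
    induction k with
    | zero => simpa using IsV.mem_gPots (hv j) A hA
    | succ k ih => simpa only [pow_succ', mul_smul] using g_smul_mem_gPots ih
  exact this _

theorem RepS.mem_gScalars {k : ℕ} {f : Pot n → MatField n n} (hf : RepS 𝔤 𝓕 k f) {A : Pot n}
    (hA : A ∈ gPots 𝔤 𝓕) : f A ∈ gScalars 𝔤 𝓕 := by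
  obtain ⟨v, hv, -, hF⟩ := hf
  rw [show f A = fsum fun j => g ^ j • v j A () from hF A hA ()]
  refine fsum_mem_gScalars fun j => ?_
  have : ∀ k, g ^ k • v j A () ∈ gScalars 𝔤 𝓕 := fun k => by
    induction k with
    | zero => simpa using IsS.mem_gScalars (hv j) A hA
    | succ k ih => simpa only [pow_succ', mul_smul] using g_smul_mem_gScalars ih
  exact this _

theorem g_pow_smul_mem_pots {V : Pot n} (hV : V ∈ 𝓕.pots n) (k : ℕ) :
    (fun μ => g ^ k • V μ) ∈ 𝓕.pots n := by
  induction k with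
  | zero => simpa using hV
  | succ k ih => simpa only [pow_succ', mul_smul] using g_smul_mem_pots ih

theorem stringInt_g_pow_smul (V : Pot n) (k : ℕ) :
    stringInt c (fun μ => g ^ k • V μ) = g ^ k • stringInt c V := by
  induction k with
  | zero => simp
  | succ k ih =>
    simp only [pow_succ', mul_smul]
    rw [stringInt_g_smul c (fun μ => g ^ k • V μ), ih]

theorem RepV.stringInt {k : ℕ} {F : Pot n → Pot n} (hF : RepV 𝔤 𝓕 k F) :
    RepS 𝔤 𝓕 k fun A => stringInt c (F A) := by
  obtain ⟨v, hv, hv0, hF⟩ := hF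
  refine ⟨fun j A _ => SQFT.stringInt c (v j A), fun j => IsS.string _ (hv j), fun j hj => ?_,
    fun A hA _ => ?_⟩
  · funext A _
    beta_reduce
    rw [hv0 j hj]
    refine eq_zero_of_ord fun k => Ord.stringInt c fun μ => ord_zero k
  · beta_reduce
    rw [show F A = fun μ => fsum fun j => g ^ j • v j A μ from funext fun μ => hF A hA μ,
      stringInt_fsum (F := fun j μ => g ^ j • v j A μ)
        fun j => g_pow_smul_mem_pots (IsV.mem_gPots (hv j) A hA).2 j]
    simp only [stringInt_g_pow_smul]
    rfl

theorem partialD_g_pow_smul (μ : Fin 4) (X : MatField n n) (k : ℕ) :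
    partialD μ (g ^ k • X) = g ^ k • partialD μ X := by
  induction k with
  | zero => simp
  | succ k ih => rw [pow_succ', mul_smul, partialD_g_smul, ih, mul_smul]

theorem RepS.gradient {k : ℕ} {f : Pot n → MatField n n} (hf : RepS 𝔤 𝓕 k f) :
    RepV 𝔤 𝓕 k fun A μ => partialD μ (f A) := by
  obtain ⟨v, hv, hv0, hF⟩ := hf
  refine ⟨fun j A μ => partialD μ (v j A ()), fun j => IsV.gradient _ (hv j), fun j hj => ?_,
    fun A hA μ => ?_⟩
  · funext A μ
    beta_reduce
    rw [hv0 j hj]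
    exact eq_zero_of_ord fun k => (ord_zero k).partialD μ
  · have hs : ∀ j, g ^ j • v j A () ∈ smoothFields n n := fun j => by
      have : RepS 𝔤 𝓕 0 fun A => v j A () := rep_of_mem (𝒱 := spaceS n c) (hv j)
      have h2 : ∀ k, g ^ k • v j A () ∈ gScalars 𝔤 𝓕 := fun k => by
        induction k with
        | zero => simpa using this.mem_gScalars hA
        | succ k ih => simpa only [pow_succ', mul_smul] using g_smul_mem_gScalars ih
      exact gScalars_smooth (h2 j)
    dsimp only
    rw [show f A = fsum fun j => g ^ j • v j A () from hF A hA (), partialD_fsum μ hs]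
    simp only [partialD_g_pow_smul]
    rfl

theorem RepS.adm {k l : ℕ} {f : Pot n → MatField n n} {F : Pot n → Pot n} (hf : RepS 𝔤 𝓕 k f)
    (hF : RepV 𝔤 𝓕 l F) : RepV 𝔤 𝓕 (k + l) fun A μ => adm (Complex.I • f A) (F A μ) := by
  obtain ⟨v, hv, hv0, hf⟩ := hf
  obtain ⟨w, hw, hw0, hF⟩ := hF
  refine ⟨fun N => ∑ ab ∈ antidiagonal N, fun A μ =>
    Complex.I • (v ab.1 A () * w ab.2 A μ - w ab.2 A μ * v ab.1 A ()), fun N => sum_mem fun ab _ =>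
      IsV.ad _ _ (hv ab.1) (hw ab.2), fun N hN => Finset.sum_eq_zero fun ab hab => ?_, fun A hA μ => ?_⟩
  · have := mem_antidiagonal.mp hab
    funext A μ
    rcases lt_or_ge ab.1 k with h | h
    · rw [hv0 _ h]; simp
    · rw [hw0 ab.2 (by omega)]; simp
  · have h1 : gser (fun j => v j A ()) * gser (fun j => w j A μ) = gser fun N =>
      ∑ ab ∈ antidiagonal N, v ab.1 A () * w ab.2 A μ := gser_mul_gser _ _
    have h2 : gser (fun j => w j A μ) * gser (fun j => v j A ()) = gser fun N =>
        ∑ ab ∈ antidiagonal N, w ab.2 A μ * v ab.1 A () := by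
      rw [gser_mul_gser]
      congr 1; funext N
      rw [← Finset.Nat.sum_antidiagonal_swap]
      rfl
    dsimp only
    rw [adm_I_smul, hF A hA, show f A = gser fun j => v j A () from hf A hA (), h1, h2, sub_eq_add_neg,
      ← neg_one_smul ℂ (gser _), gser_smul, gser_add, gser_smul]
    congr 1; funext N
    rw [Finset.sum_apply, Finset.sum_apply, neg_one_smul, ← sub_eq_add_neg, ← Finset.sum_sub_distrib,
      Finset.smul_sum]

end Represented

/-! ### Existence and uniqueness of the dressing exponent -/

section Existence

variable {n : ℕ} {𝔤 : GaugeAlgebra n} {c : Fin 4 → Distr ℝ} {𝓕 : FieldSpace c}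

theorem RepV.iterate_adm {l : ℕ} {f : Pot n → MatField n n} {F : Pot n → Pot n} (hf : RepS 𝔤 𝓕 1 f)
    (hF : RepV 𝔤 𝓕 l F) (k : ℕ) : RepV 𝔤 𝓕 (k + l) fun A μ => (adm (Complex.I • f A))^[k] (F A μ) := by
  induction k with
  | zero => simpa using hF
  | succ k ih =>
    simp only [Function.iterate_succ_apply']
    exact rep_mono (by omega) (hf.adm ih)

theorem RepV.inv_natCast_smul {l : ℕ} {F : Pot n → Pot n} (k : ℕ) (hF : RepV 𝔤 𝓕 l F) :
    RepV 𝔤 𝓕 l fun A μ => ((k : ℂ)⁻¹) • F A μ := by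
  simp only [SQFT.inv_natCast_smul]
  exact (Rep 𝔤 𝓕 (spaceV n c) l).smul_mem _ hF

theorem RepV.conj {l : ℕ} {f : Pot n → MatField n n} {F : Pot n → Pot n} (hf : RepS 𝔤 𝓕 1 f)
    (hF : RepV 𝔤 𝓕 l F) :
    RepV 𝔤 𝓕 l fun A μ => fexp (Complex.I • f A) * F A μ * fexp (-(Complex.I • f A)) := by
  have h := fun k => RepV.inv_natCast_smul k.factorial (RepV.iterate_adm hf hF k)
  refine rep_congr (fun A hA μ => (fexp_conj ((rep_ord hf hA ()).smul Complex.I) _).symm) ?_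
  exact rep_fsum (fun k => rep_mono (by omega) (h k)) (fun k => rep_mono (by omega) (h k))

theorem RepV.expDer {l : ℕ} {f : Pot n → MatField n n} {F : Pot n → Pot n} (hf : RepS 𝔤 𝓕 1 f)
    (hF : RepV 𝔤 𝓕 l F) : RepV 𝔤 𝓕 l fun A μ => SQFT.expDer (Complex.I • f A) (F A μ) := by
  have h := fun k => RepV.inv_natCast_smul (k + 1).factorial (RepV.iterate_adm hf hF k)
  exact rep_fsum (fun k => rep_mono (by omega) (h k)) (fun k => rep_mono (by omega) (h k))

/-- Telescoping: each step produces ad_{f} of the previous difference plus ad_{f - f'} of an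
iterate, and both gain an order. -/
theorem RepV.iterate_adm_sub {d l : ℕ} {f f' : Pot n → MatField n n} {F : Pot n → Pot n}
    (hf : RepS 𝔤 𝓕 1 f) (hf' : RepS 𝔤 𝓕 1 f') (hff : RepS 𝔤 𝓕 (d + 1) fun A => f A - f' A)
    (hF : RepV 𝔤 𝓕 l F) (k : ℕ) : RepV 𝔤 𝓕 (d + l + k) fun A μ =>
      (adm (Complex.I • f A))^[k] (F A μ) - (adm (Complex.I • f' A))^[k] (F A μ) := by
  induction k with
  | zero =>
    simp only [Function.iterate_zero, id, sub_self]
    exact zero_mem (Rep 𝔤 𝓕 (spaceV n c) (d + l + 0))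
  | succ k ih =>
    have h1 := rep_mono (l := d + l + (k + 1)) (by omega) (hf.adm ih)
    have h2 := rep_mono (l := d + l + (k + 1)) (by omega) (hff.adm (RepV.iterate_adm hf' hF k))
    refine rep_congr (fun A hA μ => ?_) (add_mem h1 h2)
    simp only [Pi.add_apply, Function.iterate_succ_apply', adm, smul_sub, sub_mul, mul_sub, smul_mul_assoc,
      mul_smul_comm]
    abel

theorem sub_fsum (F G : ℕ → MatField n n) : fsum F - fsum G = fsum fun k => F k - G k := by
  refine ext_cf fun N => ?_
  simp [cf_fsum]

variable (c) in
/-- The dressing exponents are the fixed points of this map. -/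
def exponentStep (A : Pot n) (X : MatField n n) : MatField n n :=
  stringInt c fun μ => fexp (Complex.I • X) * (g • A μ) * fexp (-(Complex.I • X)) +
    (expDer (Complex.I • X) (partialD μ X) - partialD μ X)

theorem RepV.potential : RepV 𝔤 𝓕 0 (fun A : Pot n => A) := rep_of_mem (𝒱 := spaceV n c) IsV.potential

theorem RepV.g_smul_potential : RepV 𝔤 𝓕 1 (fun (A : Pot n) μ => g • A μ) :=
  rep_g_smul (RepV.potential (𝔤 := 𝔤) (𝓕 := 𝓕))

theorem RepS.exponentStep {f : Pot n → MatField n n} (hf : RepS 𝔤 𝓕 1 f) :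
    RepS 𝔤 𝓕 1 fun A => exponentStep c A (f A) :=
  RepV.stringInt (add_mem (RepV.conj hf RepV.g_smul_potential)
    (sub_mem (RepV.expDer hf hf.gradient) hf.gradient))

theorem exponentStep_mem {A : Pot n} (hA : A ∈ gPots 𝔤 𝓕) {X : MatField n n} (hX : X ∈ gScalars 𝔤 𝓕)
    (hXo : Ord 1 X) :
    (fun μ => fexp (Complex.I • X) * (g • A μ) * fexp (-(Complex.I • X)) +
      (SQFT.expDer (Complex.I • X) (partialD μ X) - partialD μ X)) ∈ 𝓕.pots n :=
  (add_mem (conj_mem_gPots hX hXo (g_smul_mem_gPots hA)) (sub_mem (expDer_mem_gPots hX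
    (gradient_mem_gPots hX)) (gradient_mem_gPots hX))).2

/-- The contraction property: X enters `exponentStep` only through commutators with gA or with ∂X,
both O(g), because the linear term ∂X has been subtracted. -/
theorem RepS.exponentStep_sub {d : ℕ} {f f' : Pot n → MatField n n} (hf : RepS 𝔤 𝓕 1 f)
    (hf' : RepS 𝔤 𝓕 1 f') (hff : RepS 𝔤 𝓕 (d + 1) fun A => f A - f' A) :
    RepS 𝔤 𝓕 (d + 2) fun A => SQFT.exponentStep c A (f A) - SQFT.exponentStep c A (f' A) := by
  set T : ℕ → Pot n → Pot n := fun k A μ => ((k.factorial : ℂ)⁻¹) •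
    ((SQFT.adm (Complex.I • f A))^[k] (g • A μ) - (SQFT.adm (Complex.I • f' A))^[k] (g • A μ))
  set U : ℕ → Pot n → Pot n := fun k A μ => ((((k + 1).factorial : ℕ) : ℂ)⁻¹) •
    ((SQFT.adm (Complex.I • f A))^[k] (partialD μ (f A)) - (SQFT.adm (Complex.I • f' A))^[k] (partialD μ (f' A)))
  -- The term k = 0 of U is the difference of the gradients, of order d + 1 only; it is exactly what
  -- the subtraction of ∂X in `exponentStep` removes.
  set U' : ℕ → Pot n → Pot n := fun k => if k = 0 then 0 else U k with hU'
  have hT : ∀ k, RepV 𝔤 𝓕 (d + 1 + k) (T k) := fun k =>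
    RepV.inv_natCast_smul k.factorial (RepV.iterate_adm_sub hf hf' hff RepV.g_smul_potential k)
  have hT' : ∀ k, RepV 𝔤 𝓕 (d + 2) (T k) := fun k => by
    rcases Nat.eq_zero_or_pos k with rfl | hk
    · have : T 0 = 0 := by funext A μ; simp [T]
      rw [this]; exact zero_mem (Rep 𝔤 𝓕 (spaceV n c) (d + 2))
    · exact rep_mono (by omega) (hT k)
  have hU : ∀ k, RepV 𝔤 𝓕 (d + 1 + k) (U k) := fun k => by
    refine RepV.inv_natCast_smul (k + 1).factorial ?_
    refine rep_congr (fun A hA μ => ?_) (add_mem (RepV.iterate_adm_sub hf hf' hff hf.gradient k)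
      (rep_mono (l := d + 1 + k) (by omega) (RepV.iterate_adm hf' hff.gradient k)))
    have hlin : ∀ (Z B C : MatField n n), (SQFT.adm Z)^[k] (B - C) = (SQFT.adm Z)^[k] B - (SQFT.adm Z)^[k] C := by
      intro Z B C
      induction k with
      | zero => rfl
      | succ k ih => simp only [Function.iterate_succ_apply', ih, SQFT.adm, mul_sub, sub_mul]; abel
    simp only [Pi.add_apply]
    rw [partialD_sub μ (gScalars_smooth (RepS.mem_gScalars hf hA))
      (gScalars_smooth (RepS.mem_gScalars hf' hA)), hlin]
    abel
  have hU1 : ∀ k, RepV 𝔤 𝓕 (d + 1 + k) (U' k) := fun k => by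
    rcases Nat.eq_zero_or_pos k with rfl | hk
    · exact zero_mem (Rep 𝔤 𝓕 (spaceV n c) (d + 1 + 0))
    · rw [hU']; simp only [hk.ne', if_false]; exact hU k
  have hU2 : ∀ k, RepV 𝔤 𝓕 (d + 2) (U' k) := fun k => by
    rcases Nat.eq_zero_or_pos k with rfl | hk
    · exact zero_mem (Rep 𝔤 𝓕 (spaceV n c) (d + 2))
    · exact rep_mono (by omega) (hU1 k)
  have h1 := rep_fsum (fun k => rep_mono (by omega) (hT k)) hT'
  have h2 := rep_fsum (fun k => rep_mono (by omega) (hU1 k)) hU2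
  refine rep_congr (fun A hA _ => ?_) (RepV.stringInt (add_mem h1 h2))
  have hX := RepS.mem_gScalars hf hA
  have hX' := RepS.mem_gScalars hf' hA
  have ho := rep_ord hf hA ()
  have ho' := rep_ord hf' hA ()
  beta_reduce
  rw [SQFT.exponentStep, SQFT.exponentStep, ← stringInt_sub (exponentStep_mem hA hX ho)
    (exponentStep_mem hA hX' ho')]
  congr 1
  funext μ
  have e1 : fexp (Complex.I • f A) * (g • A μ) * fexp (-(Complex.I • f A)) -
      fexp (Complex.I • f' A) * (g • A μ) * fexp (-(Complex.I • f' A)) = fsum fun k => T k A μ := by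
    rw [fexp_conj (ho.smul _), fexp_conj (ho'.smul _), sub_fsum]
    simp only [T, smul_sub]
  have e2 : (SQFT.expDer (Complex.I • f A) (partialD μ (f A)) - partialD μ (f A)) -
      (SQFT.expDer (Complex.I • f' A) (partialD μ (f' A)) - partialD μ (f' A)) =
        fsum fun k => U' k A μ := by
    have e3 : fsum (fun k => U k A μ) = fsum (fun k => U' k A μ) +
        (partialD μ (f A) - partialD μ (f' A)) := by
      refine ext_cf fun N => ?_
      rw [map_add, cf_fsum, cf_fsum, Finset.sum_range_succ', Finset.sum_range_succ']
      simp [U', U]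
    rw [← sub_eq_iff_eq_add.mpr e3]
    simp only [U, smul_sub, ← sub_fsum]
    rw [SQFT.expDer, SQFT.expDer]
    abel
  simp only [Pi.add_apply, Pi.sub_apply]
  rw [← e1, ← e2]
  abel

variable (n 𝔤 𝓕) in
-- Banach iteration from 0 in the g-adic topology. The limit is the telescoping series of
-- differences, so that it is again represented by functionals in S.
theorem exists_fixedPoint : ∃ f : Pot n → MatField n n, RepS 𝔤 𝓕 1 f ∧
    ∀ A ∈ gPots 𝔤 𝓕, exponentStep c A (f A) = f A := by
  set γ : ℕ → Pot n → MatField n n := fun j A => (exponentStep c A)^[j] 0 with hγ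
  have hs : ∀ j A, γ (j + 1) A = exponentStep c A (γ j A) := fun j A =>
    Function.iterate_succ_apply' _ _ _
  have h1 : ∀ j, RepS 𝔤 𝓕 1 (γ j) := fun j => by
    induction j with
    | zero => exact zero_mem (Rep 𝔤 𝓕 (spaceS n c) 1)
    | succ j ih => exact rep_congr (fun A _ _ => (hs j A).symm) ih.exponentStep
  have h2 : ∀ j, RepS 𝔤 𝓕 (j + 1) fun A => γ (j + 1) A - γ j A := fun j => by
    induction j with
    | zero => exact sub_mem (h1 1) (h1 0)
    | succ j ih =>
      have := RepS.exponentStep_sub (h1 (j + 1)) (h1 j) ih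
      simpa only [← hs] using this
  set f : Pot n → MatField n n := fun A => fsum fun j => γ (j + 1) A - γ j A with hf
  have hf1 : RepS 𝔤 𝓕 1 f := rep_fsum (fun j => rep_mono (by omega) (h2 j))
    (fun j => rep_mono (by omega) (h2 j))
  -- The remainder after J steps is the same series with its first J terms set to zero.
  have h3 : ∀ J, RepS 𝔤 𝓕 (J + 1) fun A => f A - γ J A := fun J => by
    have hF : ∀ j m, m ≤ max j J + 1 →
        RepS 𝔤 𝓕 m fun A => if j < J then 0 else γ (j + 1) A - γ j A := fun j m hm => by
      by_cases hj : j < J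
      · simp only [hj, if_true]; exact zero_mem (Rep 𝔤 𝓕 (spaceS n c) m)
      · simp only [hj, if_false]; exact rep_mono (by omega) (h2 j)
    refine rep_congr (fun A hA _ => ?_) (rep_fsum (fun j => hF j j (by omega))
      (fun j => hF j (J + 1) (by omega)))
    have hord : ∀ k, Ord k (γ (k + 1) A - γ k A) := fun k => (rep_ord (h2 k) hA ()).mono (by omega)
    have hord' : ∀ k, Ord k (if k < J then 0 else γ (k + 1) A - γ k A) := fun k => by
      split_ifs
      exacts [ord_zero k, hord k]
    refine ext_cf fun N => ?_
    have hγJ : γ J A = ∑ j ∈ Finset.range J, (γ (j + 1) A - γ j A) := by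
      rw [Finset.sum_range_sub (fun j => γ j A)]; simp [hγ]
    have hle : N ≤ J + N := by omega
    rw [map_sub, hf, cf_fsum_of_le hord hle, cf_fsum_of_le hord' hle, hγJ, map_sum, eq_sub_iff_add_eq,
      add_assoc J, Finset.sum_range_add _ J (N + 1),
      Finset.sum_range_add _ J (N + 1), Finset.sum_eq_zero, zero_add, add_comm]
    · simp
    · intro k hk
      rw [if_pos (Finset.mem_range.mp hk), map_zero]
  refine ⟨f, hf1, fun A hA => ?_⟩
  rw [← sub_eq_zero]
  refine eq_zero_of_ord fun J => ?_
  have h4 := rep_ord (RepS.exponentStep_sub hf1 (h1 J) (h3 J)) hA ()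
  have h5 := rep_ord (h3 (J + 1)) hA ()
  -- Step(f) - f is the difference of Step(f) - Step(γ_J) and f - γ_{J+1}, both of arbitrarily high
  -- order.
  have h6 := (h4.mono (l := J) (by omega)).sub (h5.mono (l := J) (by omega))
  simpa only [hs, sub_sub_sub_cancel_right, sub_sub_sub_cancel_left] using h6

/-- The linear part ∂X of the dressed potential integrates to -X, which turns the defining condition
into a fixed point equation. -/
theorem stringInt_gact_fexp (hc : IsStringFunction c) {A : Pot n} (hA : A ∈ gPots 𝔤 𝓕) {X : MatField n n}
    (hX : X ∈ gScalars 𝔤 𝓕) (hXo : Ord 1 X) :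
    stringInt c (gact (fexp (Complex.I • X)) (fexp (-(Complex.I • X))) fun μ => g • A μ) =
      exponentStep c A X - X := by
  rw [sub_eq_add_neg, exponentStep, ← stringInt_gradient hc hX.2,
    ← stringInt_add (exponentStep_mem hA hX hXo) (gradient_mem_pots hX.2)]
  congr 1
  funext μ
  rw [gact_fexp hXo (gScalars_smooth hX), Pi.add_apply]
  abel

theorem gact_dressingFactor {γ : Pot n → MatField n n} {A : Pot n} (hγ : Ord 1 (γ A)) (μ : Fin 4) :
    g • (dressingFactor γ A * A μ * (dressingFactor γ A)⁻¹) +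
      Complex.I • (dressingFactor γ A * partialD μ (dressingFactor γ A)⁻¹) =
    gact (fexp (Complex.I • γ A)) (fexp (-(Complex.I • γ A))) (fun μ => g • A μ) μ := by
  rw [dressingFactor, fexp_inv (hγ.smul _), gact, mul_smul_comm, smul_mul_assoc]

variable (n 𝔤 𝓕) in
theorem exists_isDressingExponent (hc : IsStringFunction c) :
    ∃ γ : Pot n → MatField n n, IsDressingExponent 𝔤 𝓕 γ := by
  obtain ⟨f, hf, hfix⟩ := exists_fixedPoint n 𝔤 𝓕
  obtain ⟨v, hv, hfv⟩ := exists_of_rep_one hf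
  -- Membership in g S[[g]] is demanded at every A, whereas f agrees with its series only on gauge
  -- potentials; therefore the series itself is taken as γ.
  refine ⟨fun A => gsum fun j => v j A (), ⟨fun j A => v j A (), hv, fun _ => rfl⟩, fun A hA => ?_⟩
  have hA := mem_gPots_iff.mpr hA
  have h1 : (gsum fun j => v j A ()) = f A := (hfv A hA ()).symm
  have ho := rep_ord hf hA ()
  simp only [gact_dressingFactor (γ := fun A => gsum fun j => v j A ()) (A := A) (by rw [h1]; exact ho)]
  rw [h1]
  refine (stringInt_gact_fexp hc hA (RepS.mem_gScalars hf hA) ho).trans ?_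
  rw [hfix A hA, sub_self]

theorem IsDressingExponent.repS {γ : Pot n → MatField n n} (h : IsDressingExponent 𝔤 𝓕 γ) :
    RepS 𝔤 𝓕 1 γ := by
  obtain ⟨s, hs, hγ⟩ := h.mem
  exact rep_one_of_gsum (𝒱 := spaceS n c) (v := fun j A _ => s j A) hs fun A _ _ => hγ A

theorem IsDressingExponent.mem_gScalars {γ : Pot n → MatField n n} (h : IsDressingExponent 𝔤 𝓕 γ)
    {A : Pot n} (hA : A ∈ gPots 𝔤 𝓕) : γ A ∈ gScalars 𝔤 𝓕 := RepS.mem_gScalars h.repS hA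

theorem IsDressingExponent.ord {γ : Pot n → MatField n n} (h : IsDressingExponent 𝔤 𝓕 γ)
    {A : Pot n} (hA : A ∈ gPots 𝔤 𝓕) : Ord 1 (γ A) := rep_ord h.repS hA ()

theorem IsDressingExponent.stringInt_gact {γ : Pot n → MatField n n} (h : IsDressingExponent 𝔤 𝓕 γ)
    {A : Pot n} (hA : A ∈ gPots 𝔤 𝓕) :
    stringInt c (gact (fexp (Complex.I • γ A)) (fexp (-(Complex.I • γ A))) fun μ => g • A μ) = 0 := by
  have := h.string_eq A (mem_gPots_iff.mp hA)
  simp only [gact_dressingFactor (h.ord hA)] at this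
  exact this

/-- The dressing factor is characterized by its equation. -/
theorem IsDressingExponent.eq_fexp (hc : IsStringFunction c) {γ : Pot n → MatField n n}
    (h : IsDressingExponent 𝔤 𝓕 γ) {A : Pot n} (hA : A ∈ gPots 𝔤 𝓕) {V V' : MatField n n}
    (hV : IsUnip 𝓕 V) (hV' : IsUnip 𝓕 V') (hVV : V * V' = 1)
    (h0 : stringInt c (gact V V' fun μ => g • A μ) = 0) : V = fexp (Complex.I • γ A) :=
  eq_of_stringInt_gact hc (fexp_mul_fexp_neg ((h.ord hA).smul _)) (fexp_neg_mul_fexp ((h.ord hA).smul _))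
    hVV (isUnip_fexp_I (h.mem_gScalars hA) (h.ord hA)) (isUnip_fexp_neg_I (h.mem_gScalars hA) (h.ord hA))
    hV hV' (g_smul_mem_gPots hA).2 (fun _ => Ord.g_smul (Ord.of_zero _)) (h.stringInt_gact hA) h0

theorem I_smul_injective {X Y : MatField n n} (h : Complex.I • X = Complex.I • Y) : X = Y := by
  have := congrArg (Complex.I • ·) h
  simpa [smul_smul] using this

theorem IsDressingExponent.eq_of_fexp (hc : IsStringFunction c) {γ : Pot n → MatField n n}
    (h : IsDressingExponent 𝔤 𝓕 γ) {A : Pot n} (hA : A ∈ gPots 𝔤 𝓕) {X : MatField n n}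
    (hX : X ∈ gScalars 𝔤 𝓕) (hXo : Ord 1 X)
    (h0 : stringInt c (gact (fexp (Complex.I • X)) (fexp (-(Complex.I • X))) fun μ => g • A μ) = 0) :
    X = γ A :=
  I_smul_injective (fexp_injective (hXo.smul _) ((h.ord hA).smul _)
    (h.eq_fexp hc hA (isUnip_fexp_I hX hXo) (isUnip_fexp_neg_I hX hXo) (fexp_mul_fexp_neg (hXo.smul _)) h0))

theorem IsDressingExponent.unique (hc : IsStringFunction c) {γ γ' : Pot n → MatField n n}
    (h : IsDressingExponent 𝔤 𝓕 γ) (h' : IsDressingExponent 𝔤 𝓕 γ') {A : Pot n}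
    (hA : IsVectorField 𝔤 𝓕 A) : γ A = γ' A :=
  have hA := mem_gPots_iff.mpr hA
  h'.eq_of_fexp hc hA (h.mem_gScalars hA) (h.ord hA) (h.stringInt_gact hA)

theorem IsGroupField.exists {θ : MatField n n} (hθ : IsGroupField 𝔤 𝓕 θ) :
    ∃ X ∈ gScalars 𝔤 𝓕, Ord 1 X ∧ θ = fexp (Complex.I • X) ∧ θ⁻¹ = fexp (-(Complex.I • X)) := by
  obtain ⟨X, hX, rfl⟩ := hθ
  obtain ⟨hX, ho⟩ := isSmallScalarField_iff.mp hX
  exact ⟨X, hX, ho, rfl, fexp_inv (ho.smul _)⟩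

theorem isGroupField_fexp {X : MatField n n} (hX : X ∈ gScalars 𝔤 𝓕) (ho : Ord 1 X) :
    IsGroupField 𝔤 𝓕 (fexp (Complex.I • X)) := ⟨X, isSmallScalarField_iff.mpr ⟨hX, ho⟩, rfl⟩

/-- The dressing factor of a gauge transformed potential. -/
theorem IsDressingExponent.fexp_gaugeA (hc : IsStringFunction c) {γ : Pot n → MatField n n}
    (h : IsDressingExponent 𝔤 𝓕 γ) {A : Pot n} (hA : A ∈ gPots 𝔤 𝓕) {θ : MatField n n}
    (hθ : IsGroupField 𝔤 𝓕 θ) :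
    fexp (Complex.I • γ (gaugeA θ A)) = fexp (Complex.I • γ A) * θ := by
  have hA' := gaugeA_mem_gPots hθ hA
  obtain ⟨X, hX, ho, rfl, hinv⟩ := hθ.exists
  have hX1 := isUnip_fexp_I hX ho
  have hX2 := isUnip_fexp_neg_I hX ho
  have hW1 := isUnip_fexp_I (h.mem_gScalars hA) (h.ord hA)
  have hW2 := isUnip_fexp_neg_I (h.mem_gScalars hA) (h.ord hA)
  have e1 := fexp_mul_fexp_neg (ho.smul Complex.I)
  have e2 := fexp_mul_fexp_neg ((h.ord hA).smul Complex.I)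
  have e3 := fexp_neg_mul_fexp (ho.smul Complex.I)
  -- W[A]θ takes A^θ to the same dressed potential as W[A] takes A. Uniqueness holds among all
  -- factors 1 + O(g), so the product need not be known to be an exponential.
  refine (h.eq_fexp hc hA' (hW1.mul hX1) (hX2.mul hW2) ?_ ?_).symm
  · rw [mul_assoc, ← mul_assoc _ _ (fexp (-(Complex.I • γ A))), e1, one_mul, e2]
  · rw [g_smul_gaugeA hX1, hinv, gact_gact e3 hX1.smooth (hX2.mul hW2).smooth, mul_assoc, e1, mul_one,
      ← mul_assoc, e1, one_mul]
    exact h.stringInt_gact hA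

theorem isDressingField_inv (hc : IsStringFunction c) {γ : Pot n → MatField n n}
    (h : IsDressingExponent 𝔤 𝓕 γ) : IsDressingField 𝔤 𝓕 fun A => (dressingFactor γ A)⁻¹ := by
  intro A hA
  have hA := mem_gPots_iff.mpr hA
  refine ⟨?_, fun θ hθ => ⟨mem_gPots_iff.mp (gaugeA_mem_gPots hθ hA), ?_⟩⟩
  · beta_reduce
    rw [dressingFactor, fexp_inv ((h.ord hA).smul _), ← smul_neg]
    exact isGroupField_fexp (neg_mem (h.mem_gScalars hA)) (h.ord hA).neg
  · beta_reduce
    rw [dressingFactor, dressingFactor, h.fexp_gaugeA hc hA hθ, Matrix.mul_inv_rev]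

end Existence

/-! ### The Euler derivation `g d/dg` -/

section Euler

variable {p q r : ℕ}

/-- The Euler derivation `g d/dg`. -/
def euler (X : MatField p q) : MatField p q :=
  Matrix.of fun i j => PowerSeries.mk fun N => (N : ℂ) • PowerSeries.coeff N (X i j)

theorem cf_euler (X : MatField p q) (N : ℕ) : cf N (euler X) = (N : ℂ) • cf N X := by
  ext i j : 2
  simp [cf_apply, euler]

theorem euler_add (X Y : MatField p q) : euler (X + Y) = euler X + euler Y :=
  ext_cf fun N => by simp only [cf_euler, map_add, smul_add]

theorem euler_smul (a : ℂ) (X : MatField p q) : euler (a • X) = a • euler X :=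
  ext_cf fun N => by simp only [cf_euler, map_smul, smul_comm a]

theorem euler_mul (X : MatField p q) (Y : MatField q r) : euler (X * Y) = euler X * Y + X * euler Y := by
  refine ext_cf fun N => ?_
  rw [cf_euler, map_add, cf_mul, cf_mul, cf_mul, Finset.smul_sum, ← Finset.sum_add_distrib]
  refine Finset.sum_congr rfl fun ab hab => ?_
  rw [cf_euler, cf_euler, Matrix.smul_mul, Matrix.mul_smul, ← add_smul, ← mem_antidiagonal.mp hab]
  push_cast; rfl

theorem euler_one : euler (1 : MatField p p) = 0 := by
  refine ext_cf fun N => ?_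
  cases N with
  | zero => simp [cf_euler]
  | succ N => rw [cf_euler, cf_one_succ, smul_zero, map_zero]

theorem Ord.euler {k : ℕ} {X : MatField p q} (hX : Ord k X) : Ord k (euler X) := fun N hN => by
  rw [cf_euler, hX N hN, smul_zero]

theorem euler_fsum (F : ℕ → MatField p q) : euler (fsum F) = fsum fun k => euler (F k) :=
  ext_cf fun N => by simp only [cf_euler, cf_fsum, Finset.smul_sum]

theorem fexp_neg_mul_euler {Z : MatField p p} (hZ : Ord 1 Z) :
    fexp (-Z) * euler (fexp Z) = expDer (-Z) (euler Z) := by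
  rw [fexp_eq Z, euler_fsum]
  refine fexp_neg_mul_deriv hZ hZ.euler ?_ fun k => ?_
  · rw [expTerm_zero, euler_one]
  · rw [← euler_smul, succ_smul_expTerm', euler_mul]

/-- Since M = O(g), the right-hand side has one order more than D, while g d/dg multiplies the order
g^N by N ≠ 0. This is uniqueness for a linear differential equation in g. -/
theorem eq_zero_of_euler {D M : MatField p p} (hD : Ord 1 D) (hM : Ord 1 M) (h : euler D = D * M) :
    D = 0 := by
  refine eq_zero_of_ord fun k => ?_
  suffices h : Ord (k + 1) D from h.mono (Nat.le_succ k)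
  induction k with
  | zero => exact hD
  | succ k ih =>
    intro N hN
    have h1 : Ord (k + 2) (euler D) := by rw [h]; exact ih.mul hM
    rcases Nat.eq_zero_or_pos N with rfl | hN0
    · exact hD 0 one_pos
    · have h2 := h1 N hN
      rw [cf_euler] at h2
      exact (smul_eq_zero.mp h2).resolve_left (Nat.cast_ne_zero.mpr hN0.ne')

/-- `-i e^{-iX} δ e^{iX}`, where `δ` is the Euler derivation. -/
def logDer (X : MatField p p) : MatField p p := expDer (Complex.I • -X) (euler X)

theorem euler_fexp {X : MatField p p} (hX : Ord 1 X) :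
    euler (fexp (Complex.I • X)) = fexp (Complex.I • X) * (Complex.I • logDer X) := by
  have h := fexp_neg_mul_euler (hX.smul Complex.I)
  rw [euler_smul, expDer_smul, ← smul_neg] at h
  rw [logDer, ← h, ← mul_assoc, smul_neg, fexp_mul_fexp_neg (hX.smul _), one_mul]

theorem Ord.logDer {X : MatField p p} (hX : Ord 1 X) : Ord 1 (logDer X) :=
  Ord.expDer (hX.neg.smul _) hX.euler

theorem mul_smul_conj {A : Type} [Ring A] [Algebra ℂ A] {b b' : A} (h : b * b' = 1) (a l : A) (t : ℂ) :
    a * (t • l) * b = a * b * (t • (b' * l * b)) := by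
  have : b * (b' * l * b) = l * b := by rw [← mul_assoc, ← mul_assoc, h, one_mul]
  rw [mul_smul_comm, mul_smul_comm, smul_mul_assoc, mul_assoc a b, this, mul_assoc]

/-- Product rule for the logarithmic derivative with respect to g. -/
theorem logDer_of_mul {X Y Z : MatField p p} (hX : Ord 1 X) (hY : Ord 1 Y) (hZ : Ord 1 Z)
    (h : fexp (Complex.I • X) * fexp (Complex.I • Y) = fexp (Complex.I • Z)) :
    logDer Z = fexp (Complex.I • -Y) * logDer X * fexp (-(Complex.I • -Y)) + logDer Y := by
  have h1 : euler (fexp (Complex.I • Z)) = fexp (Complex.I • Z) * (Complex.I •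
      (fexp (Complex.I • -Y) * logDer X * fexp (-(Complex.I • -Y)) + logDer Y)) := by
    rw [← h, euler_mul, euler_fexp hX, euler_fexp hY, smul_neg, neg_neg, smul_add, mul_add]
    congr 1
    · exact mul_smul_conj (fexp_mul_fexp_neg (hY.smul _)) _ _ _
    · rw [mul_assoc]
  rw [euler_fexp hZ] at h1
  have h2 := congrArg (fexp (-(Complex.I • Z)) * ·) h1
  simp only [← mul_assoc, fexp_neg_mul_fexp (hZ.smul Complex.I), one_mul] at h2
  exact I_smul_injective h2

/-- Both sides solve the same linear equation δE = E · (i δ-logarithm of Z) and agree at order g^0,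
so `eq_zero_of_euler` applies to their difference. -/
theorem fexp_mul_of_logDer {X Y Z : MatField p p} (hX : Ord 1 X) (hY : Ord 1 Y) (hZ : Ord 1 Z)
    (h : logDer Z = fexp (Complex.I • -Y) * logDer X * fexp (-(Complex.I • -Y)) + logDer Y) :
    fexp (Complex.I • X) * fexp (Complex.I • Y) = fexp (Complex.I • Z) := by
  have hX' := hX.smul Complex.I
  have hY' := hY.smul Complex.I
  have hZ' := hZ.smul Complex.I
  rw [← sub_eq_zero]
  refine eq_zero_of_euler (M := Complex.I • logDer Z) ?_ (hZ.logDer.smul _) ?_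
  · have e : fexp (Complex.I • X) * fexp (Complex.I • Y) - fexp (Complex.I • Z) =
      (fexp (Complex.I • X) - 1) * fexp (Complex.I • Y) + (fexp (Complex.I • Y) - 1) -
        (fexp (Complex.I • Z) - 1) := by noncomm_ring
    rw [e]
    exact (((ord_fexp_sub_one hX').mul_right _).add (ord_fexp_sub_one hY')).sub (ord_fexp_sub_one hZ')
  · rw [sub_eq_add_neg, ← neg_one_smul ℂ (fexp (Complex.I • Z)), euler_add, euler_smul, euler_fexp hZ,
      euler_mul, euler_fexp hX, euler_fexp hY, add_mul, smul_mul_assoc]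
    congr 1
    rw [h, smul_neg, neg_neg, smul_add, mul_add]
    congr 1
    · exact mul_smul_conj (fexp_mul_fexp_neg hY') _ _ _
    · rw [mul_assoc]

end Euler

/-! ### Representations of fields -/

section Representation

variable {n m : ℕ} {𝔤 : GaugeAlgebra n} {c : Fin 4 → Distr ℝ} {𝓕 : FieldSpace c} (π : UnitaryRep 𝔤 m)

/-- A linear extension of π to all matrices removes the case distinction in `lieRep`; linearity and
smoothness then transfer pointwise. -/
theorem exists_extension : ∃ L : Matrix (Fin n) (Fin n) ℂ →ₗ[ℝ] Matrix (Fin m) (Fin m) ℂ,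
    (∀ X : 𝔤.carrier, L X = π.toLin X) ∧
    ∀ X ∈ gaugeFields 𝔤, ∀ N x, value (lieRep π X) N x = L (value X N x) := by
  obtain ⟨L, hL⟩ := LinearMap.exists_extend π.toLin
  have h : ∀ X : 𝔤.carrier, L X = π.toLin X := fun X => LinearMap.congr_fun hL X
  refine ⟨L, h, fun X hX N x => ?_⟩
  rw [show value X N x = ((⟨value X N x, hX N x⟩ : 𝔤.carrier) : Matrix (Fin n) (Fin n) ℂ) from rfl, h]
  ext i j
  simp [value_apply, cf_apply, lieRep, hX N x]

theorem ext_value {p q : ℕ} {X Y : MatField p q} (h : ∀ N x, value X N x = value Y N x) : X = Y := by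
  refine ext_cf fun N => ?_
  ext i j x
  exact congrFun (congrFun (h N x) i) j

theorem value_add {p q : ℕ} (X Y : MatField p q) (N : ℕ) (x : Spacetime) :
    value (X + Y) N x = value X N x + value Y N x := by
  ext i j; simp [value_apply]

theorem value_real_smul {p q : ℕ} (r : ℝ) (X : MatField p q) (N : ℕ) (x : Spacetime) :
    value (r • X) N x = r • value X N x := by
  ext i j; rw [value_apply, cf_real_smul]; simp [value_apply]

theorem value_fsum {p q : ℕ} (F : ℕ → MatField p q) (N : ℕ) (x : Spacetime) :
    value (fsum F) N x = ∑ k ∈ Finset.range (N + 1), value (F k) N x := by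
  ext i j; simp [value_apply, cf_fsum, Matrix.sum_apply]

theorem value_euler {p q : ℕ} (X : MatField p q) (N : ℕ) (x : Spacetime) :
    value (euler X) N x = (N : ℝ) • value X N x := by
  ext i j; rw [value_apply, cf_euler]; simp [value_apply]

theorem euler_mem_gaugeFields {X : MatField n n} (hX : X ∈ gaugeFields 𝔤) : euler X ∈ gaugeFields 𝔤 :=
  fun N x => by rw [value_euler]; exact 𝔤.carrier.smul_mem _ (hX N x)

theorem lieRep_add {X Y : MatField n n} (hX : X ∈ gaugeFields 𝔤) (hY : Y ∈ gaugeFields 𝔤) :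
    lieRep π (X + Y) = lieRep π X + lieRep π Y := by
  obtain ⟨L, -, hL⟩ := exists_extension π
  refine ext_value fun N x => ?_
  rw [hL _ (add_mem hX hY), value_add, value_add, map_add, hL X hX, hL Y hY]

theorem lieRep_real_smul (r : ℝ) {X : MatField n n} (hX : X ∈ gaugeFields 𝔤) :
    lieRep π (r • X) = r • lieRep π X := by
  obtain ⟨L, -, hL⟩ := exists_extension π
  refine ext_value fun N x => ?_
  rw [hL _ ((gaugeFields 𝔤).smul_mem r hX), value_real_smul, value_real_smul, map_smul, hL X hX]

theorem lieRep_neg {X : MatField n n} (hX : X ∈ gaugeFields 𝔤) : lieRep π (-X) = -lieRep π X := by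
  rw [← neg_one_smul ℝ X, lieRep_real_smul π _ hX, neg_one_smul]

theorem lieRep_fsum {F : ℕ → MatField n n} (hF : ∀ k, F k ∈ gaugeFields 𝔤) :
    lieRep π (fsum F) = fsum fun k => lieRep π (F k) := by
  obtain ⟨L, -, hL⟩ := exists_extension π
  refine ext_value fun N x => ?_
  rw [hL _ (fsum_mem_gaugeFields hF), value_fsum, value_fsum, map_sum]
  exact Finset.sum_congr rfl fun k _ => (hL _ (hF k) N x).symm

theorem lieRep_euler {X : MatField n n} (hX : X ∈ gaugeFields 𝔤) :
    lieRep π (euler X) = euler (lieRep π X) := by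
  obtain ⟨L, -, hL⟩ := exists_extension π
  refine ext_value fun N x => ?_
  rw [hL _ (euler_mem_gaugeFields hX), value_euler, value_euler, map_smul, hL X hX]

theorem lieRep_adm {X Y : MatField n n} (hX : X ∈ gaugeFields 𝔤) (hY : Y ∈ gaugeFields 𝔤) :
    lieRep π (adm (Complex.I • X) Y) = adm (Complex.I • lieRep π X) (lieRep π Y) := by
  obtain ⟨L, hL', hL⟩ := exists_extension π
  refine ext_value fun N x => ?_
  rw [hL _ (adm_mem_gaugeFields hX hY), value_adm, value_adm, map_sum]
  refine Finset.sum_congr rfl fun ab _ => ?_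
  rw [hL X hX, hL Y hY]
  have := π.map_bracket ⟨_, hX ab.1 x⟩ ⟨_, hY ab.2 x⟩
  rw [← hL', ← hL', ← hL'] at this
  exact this

theorem Ord.lieRep {k : ℕ} {X : MatField n n} (hX : X ∈ gaugeFields 𝔤) (ho : Ord k X) :
    Ord k (lieRep π X) := by
  obtain ⟨L, -, hL⟩ := exists_extension π
  intro N hN
  ext i j x
  have h := congrFun (congrFun (hL X hX N x) i) j
  have h0 : value X N x = 0 := by ext i j; rw [value_apply, ho N hN]; rfl
  rw [h0, map_zero] at h
  exact h

theorem iterate_adm_mem_gaugeFields {X Y : MatField n n} (hX : X ∈ gaugeFields 𝔤)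
    (hY : Y ∈ gaugeFields 𝔤) (k : ℕ) : (adm (Complex.I • X))^[k] Y ∈ gaugeFields 𝔤 := by
  induction k with
  | zero => exact hY
  | succ k ih => rw [Function.iterate_succ_apply']; exact adm_mem_gaugeFields hX ih

theorem lieRep_iterate_adm {X Y : MatField n n} (hX : X ∈ gaugeFields 𝔤) (hY : Y ∈ gaugeFields 𝔤)
    (k : ℕ) : lieRep π ((adm (Complex.I • X))^[k] Y) =
      (adm (Complex.I • lieRep π X))^[k] (lieRep π Y) := by
  induction k with
  | zero => rfl
  | succ k ih =>
    rw [Function.iterate_succ_apply', Function.iterate_succ_apply',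
      lieRep_adm π hX (iterate_adm_mem_gaugeFields hX hY k), ih]

theorem lieRep_fsum_iterate_adm {X Y : MatField n n} (hX : X ∈ gaugeFields 𝔤) (hY : Y ∈ gaugeFields 𝔤)
    (a : ℕ → ℕ) : lieRep π (fsum fun k => ((a k : ℂ)⁻¹) • (adm (Complex.I • X))^[k] Y) =
      fsum fun k => ((a k : ℂ)⁻¹) • (adm (Complex.I • lieRep π X))^[k] (lieRep π Y) := by
  simp only [inv_natCast_smul]
  rw [lieRep_fsum π fun k => (gaugeFields 𝔤).smul_mem _ (iterate_adm_mem_gaugeFields hX hY k)]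
  congr 1; funext k
  rw [lieRep_real_smul π _ (iterate_adm_mem_gaugeFields hX hY k), lieRep_iterate_adm π hX hY]

theorem expDer_mem_gaugeFields {X Y : MatField n n} (hX : X ∈ gaugeFields 𝔤) (hY : Y ∈ gaugeFields 𝔤) :
    expDer (Complex.I • X) Y ∈ gaugeFields 𝔤 := by
  simp only [expDer, inv_natCast_smul]
  exact fsum_mem_gaugeFields fun k => (gaugeFields 𝔤).smul_mem _ (iterate_adm_mem_gaugeFields hX hY k)

theorem logDer_mem_gaugeFields {X : MatField n n} (hX : X ∈ gaugeFields 𝔤) : logDer X ∈ gaugeFields 𝔤 :=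
  expDer_mem_gaugeFields (neg_mem hX) (euler_mem_gaugeFields hX)

/-- The logarithmic derivative is a series of brackets with real coefficients, all of which π
respects. -/
theorem lieRep_logDer {X : MatField n n} (hX : X ∈ gaugeFields 𝔤) :
    lieRep π (logDer X) = logDer (lieRep π X) := by
  rw [logDer, expDer, lieRep_fsum_iterate_adm π (neg_mem hX) (euler_mem_gaugeFields hX) fun k => (k + 1).factorial,
    lieRep_neg π hX, lieRep_euler π hX]
  rfl

theorem conj_mem_gaugeFields {X Y : MatField n n} (hX : X ∈ gaugeFields 𝔤) (ho : Ord 1 X)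
    (hY : Y ∈ gaugeFields 𝔤) : fexp (Complex.I • X) * Y * fexp (-(Complex.I • X)) ∈ gaugeFields 𝔤 := by
  rw [fexp_conj (ho.smul _)]
  simp only [inv_natCast_smul]
  exact fsum_mem_gaugeFields fun k => (gaugeFields 𝔤).smul_mem _ (iterate_adm_mem_gaugeFields hX hY k)

theorem lieRep_conj {X Y : MatField n n} (hX : X ∈ gaugeFields 𝔤) (ho : Ord 1 X)
    (hY : Y ∈ gaugeFields 𝔤) : lieRep π (fexp (Complex.I • X) * Y * fexp (-(Complex.I • X))) =
      fexp (Complex.I • lieRep π X) * lieRep π Y * fexp (-(Complex.I • lieRep π X)) := by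
  rw [fexp_conj (ho.smul _), fexp_conj ((ho.lieRep π hX).smul _),
    lieRep_fsum_iterate_adm π hX hY fun k => k.factorial]

/-- The representation of the formal gauge group is multiplicative. -/
theorem fexp_lieRep_mul {X Y Z : MatField n n} (hX : X ∈ gaugeFields 𝔤) (hY : Y ∈ gaugeFields 𝔤)
    (hZ : Z ∈ gaugeFields 𝔤) (oX : Ord 1 X) (oY : Ord 1 Y) (oZ : Ord 1 Z)
    (h : fexp (Complex.I • X) * fexp (Complex.I • Y) = fexp (Complex.I • Z)) :
    fexp (Complex.I • lieRep π X) * fexp (Complex.I • lieRep π Y) = fexp (Complex.I • lieRep π Z) := by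
  refine fexp_mul_of_logDer (oX.lieRep π hX) (oY.lieRep π hY) (oZ.lieRep π hZ) ?_
  rw [← lieRep_logDer π hX, ← lieRep_logDer π hY, ← lieRep_logDer π hZ, ← lieRep_neg π hY,
    ← lieRep_conj π (neg_mem hY) oY.neg (logDer_mem_gaugeFields hX),
    ← lieRep_add π (conj_mem_gaugeFields (neg_mem hY) oY.neg (logDer_mem_gaugeFields hX))
      (logDer_mem_gaugeFields hY), logDer_of_mul oX oY oZ h]

/-- Injectivity of the formal exponential makes the exponent chosen in `groupRep` the given one. -/
theorem groupRep_fexp {X : MatField n n} (hX : X ∈ gScalars 𝔤 𝓕) (ho : Ord 1 X) :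
    groupRep 𝓕 π (fexp (Complex.I • X)) = fexp (Complex.I • lieRep π X) := by
  have h : ∃ Y, IsSmallScalarField 𝔤 𝓕 Y ∧ fexp (Complex.I • X) = fexp (Complex.I • Y) :=
    ⟨X, isSmallScalarField_iff.mpr ⟨hX, ho⟩, rfl⟩
  rw [groupRep, dif_pos h]
  have h1 := isSmallScalarField_iff.mp h.choose_spec.1
  rw [← I_smul_injective (fexp_injective (ho.smul _) (h1.2.smul _) h.choose_spec.2)]

theorem lieRep_mem_smoothFields {X : MatField n n} (hX : X ∈ gaugeFields 𝔤) (hs : X ∈ smoothFields n n) :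
    lieRep π X ∈ smoothFields m m := by
  obtain ⟨L, -, hL⟩ := exists_extension π
  intro N a b
  have h1 : cf N (lieRep π X) a b = fun y => ∑ i, ∑ j, ((cf N X i j y).re • L (Matrix.single i j 1) a b +
      (cf N X i j y).im • L (Matrix.single i j Complex.I) a b) := by
    funext y
    have := congrFun (congrFun (hL X hX N y) a) b
    rw [value_apply, linearMap_matrix_eq L] at this
    rw [this]
    simp [Matrix.sum_apply, value_apply]
  rw [h1]
  refine ContDiff.sum fun i _ => ContDiff.sum fun j _ => ?_
  exact ((Complex.reCLM.contDiff.comp (hs N i j)).smul contDiff_const).add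
    ((Complex.imCLM.contDiff.comp (hs N i j)).smul contDiff_const)

end Representation

/-! ### A power series identity for the logarithm -/

section Logarithm

open PowerSeries

/-- The power series `-log(1 + X) / X`. -/
def logQuot : PowerSeries ℝ := PowerSeries.mk fun k => (-1) ^ (k + 1) / ((k : ℝ) + 1)

/-- The derivative of -log(1 + X) is -1/(1 + X). -/
theorem one_add_X_mul_derivative : (1 + X) * d⁄dX ℝ (X * logQuot) = -1 := by
  have h : ∀ k, coeff k (d⁄dX ℝ (X * logQuot)) = (-1) ^ (k + 1) := fun k => by
    rw [coeff_derivative, coeff_succ_X_mul, logQuot, coeff_mk]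
    field_simp
  ext k
  rw [add_mul, one_mul, map_add, h]
  cases k with
  | zero => simp
  | succ k => rw [coeff_succ_X_mul, h, map_neg, coeff_one]; simp [pow_succ]

/-- The partial sums of the exponential series of `-log(1 + X)`. -/
def expLog (N : ℕ) : PowerSeries ℝ :=
  ∑ k ∈ Finset.range (N + 1), ((k.factorial : ℝ)⁻¹) • (X * logQuot) ^ k

theorem derivative_expLog (N : ℕ) :
    d⁄dX ℝ (expLog (N + 1)) = d⁄dX ℝ (X * logQuot) * expLog N := by
  rw [expLog, Finset.sum_range_succ', expLog, map_add, map_sum, Finset.mul_sum]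
  simp only [Nat.factorial_zero, pow_zero, Nat.cast_one, inv_one, one_smul, Derivation.map_one_eq_zero,
    add_zero]
  refine Finset.sum_congr rfl fun k _ => ?_
  rw [Derivation.map_smul, Derivation.leibniz_pow, Nat.add_sub_cancel, smul_eq_mul, ← Nat.cast_smul_eq_nsmul ℝ,
    smul_smul, mul_smul_comm]
  congr 1
  · rw [Nat.factorial_succ]
    push_cast
    have : (k.factorial : ℝ) ≠ 0 := Nat.cast_ne_zero.mpr k.factorial_ne_zero
    field_simp
  · exact mul_comm _ _

/-- The identity (1 + X) e^{-log(1 + X)} = 1 up to order N: the derivative of the truncated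
left-hand side reduces to the last term of the exponential sum, which is divisible by X^N when the
sum runs up to N. -/
theorem coeff_one_add_X_mul_expLog {N k : ℕ} (hk : k ≤ N) :
    coeff k ((1 + X) * expLog N) = coeff k (1 : PowerSeries ℝ) := by
  have h0 : coeff 0 ((1 + X) * expLog N) = 1 := by
    simp [expLog, Finset.sum_range_succ']
  cases k with
  | zero => rw [h0]; simp
  | succ k =>
    obtain ⟨N, rfl⟩ : ∃ M, N = M + 1 := ⟨N - 1, by omega⟩
    have h1 : d⁄dX ℝ ((1 + X) * expLog (N + 1)) =
        (((N + 1).factorial : ℝ)⁻¹) • (X * logQuot) ^ (N + 1) := by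
      have h : expLog (N + 1) = expLog N + (((N + 1).factorial : ℝ)⁻¹) • (X * logQuot) ^ (N + 1) :=
        Finset.sum_range_succ _ _
      rw [Derivation.leibniz, derivative_expLog, smul_eq_mul, smul_eq_mul, ← mul_assoc,
        one_add_X_mul_derivative, map_add, derivative_X, Derivation.map_one_eq_zero, zero_add, mul_one, h]
      ring
    have h2 := congrArg (coeff k) h1
    rw [coeff_derivative, mul_pow, coeff_smul, coeff_X_pow_mul', if_neg (by omega), smul_zero] at h2
    rw [(mul_eq_zero.mp h2).resolve_right (by positivity), coeff_one, if_neg (Nat.succ_ne_zero k)]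

/-- With φ = `logQuot`, the sum times X is (1 + X)(e^{Xφ} - 1) up to truncation, that is -X. This is
the equation for φ that makes e^ω map A(c) to the dressed potential. -/
theorem coeff_sum_logQuot {N k : ℕ} (hk : k < N) :
    coeff k (∑ j ∈ Finset.range N, (((j + 1).factorial : ℝ)⁻¹) •
      ((X * logQuot) ^ j * ((1 + X) * logQuot))) = coeff k (-1 : PowerSeries ℝ) := by
  rw [← coeff_succ_X_mul]
  have h : X * (∑ j ∈ Finset.range N, (((j + 1).factorial : ℝ)⁻¹) •
      ((X * logQuot) ^ j * ((1 + X) * logQuot))) = (1 + X) * expLog N - (1 + X) := by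
    rw [expLog, Finset.sum_range_succ', Finset.mul_sum, mul_add, Finset.mul_sum]
    simp only [Nat.factorial_zero, pow_zero, Nat.cast_one, inv_one, one_smul, mul_one, add_sub_cancel_right]
    refine Finset.sum_congr rfl fun k _ => ?_
    rw [mul_smul_comm, mul_smul_comm]
    congr 1
    ring
  rw [h, map_sub, coeff_one_add_X_mul_expLog hk, map_add, sub_add_cancel_left, coeff_X, map_neg,
    coeff_one]
  simp

end Logarithm

/-! ### Power series of operators that raise the order in `g` -/

section OperatorCalculus

variable {n : ℕ} {𝔤 : GaugeAlgebra n} {c : Fin 4 → Distr ℝ} {𝓕 : FieldSpace c}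

/-- Potentials of order `g^k`. -/
def POrd (k : ℕ) (B : gPots 𝔤 𝓕) : Prop := ∀ μ, Ord k (B.1 μ)

/-- The sum of a series of potentials of increasing order. -/
def psum (F : ℕ → gPots 𝔤 𝓕) : gPots 𝔤 𝓕 :=
  ⟨fun μ => fsum fun k => (F k).1 μ, fsum_mem_gPots fun k => (F k).2⟩

theorem POrd.mono {k l : ℕ} {B : gPots 𝔤 𝓕} (hB : POrd k B) (h : l ≤ k) : POrd l B :=
  fun μ => (hB μ).mono h

theorem POrd.smul {k : ℕ} {B : gPots 𝔤 𝓕} (hB : POrd k B) (a : ℝ) : POrd k (a • B) :=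
  fun μ => (hB μ).real_smul a

theorem POrd.psum {m : ℕ} {F : ℕ → gPots 𝔤 𝓕} (hF : ∀ k, POrd m (F k)) : POrd m (psum F) :=
  fun μ => Ord.fsum fun k => hF k μ

theorem coe_sum_apply (s : Finset ℕ) (F : ℕ → gPots 𝔤 𝓕) (μ : Fin 4) :
    (∑ k ∈ s, F k).1 μ = ∑ k ∈ s, (F k).1 μ := by
  rw [AddSubmonoidClass.coe_finsetSum, Finset.sum_apply]

/-- A linear operator that does not lower the order is g-adically continuous. -/
theorem map_psum (y : Module.End ℝ (gPots 𝔤 𝓕)) (hy : ∀ k B, POrd k B → POrd k (y B))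
    {F : ℕ → gPots 𝔤 𝓕} (hF : ∀ k, POrd k (F k)) : y (psum F) = psum fun k => y (F k) := by
  refine Subtype.ext (funext fun μ => eq_fsum fun N => ?_)
  have h : POrd (N + 1) (psum F - ∑ k ∈ Finset.range (N + 1), F k) := fun ν => by
    have := ord_fsum_sub (fun k => hF k ν) N
    rw [← coe_sum_apply] at this
    exact this
  have := hy _ _ h μ
  rw [map_sub, map_sum] at this
  rw [← coe_sum_apply]
  exact this

/-- Operators that raise the order in `g`. -/
def Raising (x : Module.End ℝ (gPots 𝔤 𝓕)) : Prop := ∀ k B, POrd k B → POrd (k + 1) (x B)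

variable {x : Module.End ℝ (gPots 𝔤 𝓕)}

theorem Raising.pow (hx : Raising x) (j : ℕ) {k : ℕ} {B : gPots 𝔤 𝓕} (hB : POrd k B) :
    POrd (j + k) ((x ^ j) B) := by
  induction j with
  | zero => simpa using hB
  | succ j ih => rw [pow_succ', Module.End.mul_apply]; exact (hx _ _ ih).mono (by omega)

variable (x) in
/-- The operator `φ(x)`. -/
def opSeries (φ : PowerSeries ℝ) (B : gPots 𝔤 𝓕) : gPots 𝔤 𝓕 :=
  psum fun k => PowerSeries.coeff k φ • (x ^ k) B

theorem Raising.ord_opSeries (hx : Raising x) {φ : PowerSeries ℝ} {N l : ℕ}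
    (hφ : ∀ k < N, PowerSeries.coeff k φ = 0) {B : gPots 𝔤 𝓕} (hB : POrd l B) :
    POrd (N + l) (opSeries x φ B) := by
  refine POrd.psum fun k => ?_
  rcases lt_or_ge k N with h | h
  · rw [hφ k h, zero_smul]; exact fun μ => ord_zero _
  · exact ((hx.pow k hB).mono (by omega)).smul _

theorem opSeries_add (φ ψ : PowerSeries ℝ) (B : gPots 𝔤 𝓕) :
    opSeries x (φ + ψ) B = opSeries x φ B + opSeries x ψ B := by
  refine Subtype.ext (funext fun μ => ?_)
  simp only [opSeries, map_add, add_smul]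
  exact (fsum_add _ _).symm

theorem opSeries_smul (a : ℝ) (φ : PowerSeries ℝ) (B : gPots 𝔤 𝓕) :
    opSeries x (a • φ) B = a • opSeries x φ B := by
  refine Subtype.ext (funext fun μ => ?_)
  simp only [opSeries, PowerSeries.coeff_smul, smul_assoc]
  exact (fsum_real_smul _ _).symm

variable (x) in
/-- `φ ↦ φ(x) B` as a linear map. -/
def opSeriesLin (B : gPots 𝔤 𝓕) : PowerSeries ℝ →ₗ[ℝ] gPots 𝔤 𝓕 where
  toFun φ := opSeries x φ B
  map_add' φ ψ := opSeries_add φ ψ B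
  map_smul' a φ := opSeries_smul a φ B

theorem opSeries_add_right (φ : PowerSeries ℝ) (B C : gPots 𝔤 𝓕) :
    opSeries x φ (B + C) = opSeries x φ B + opSeries x φ C := by
  refine Subtype.ext (funext fun μ => ?_)
  simp only [opSeries, map_add, smul_add]
  exact (fsum_add _ _).symm

theorem opSeries_smul_right (a : ℝ) (φ : PowerSeries ℝ) (B : gPots 𝔤 𝓕) :
    opSeries x φ (a • B) = a • opSeries x φ B := by
  refine Subtype.ext (funext fun μ => ?_)
  simp only [opSeries, map_smul, smul_comm _ a]
  exact (fsum_real_smul _ _).symm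

theorem opSeries_one (B : gPots 𝔤 𝓕) : opSeries x 1 B = B := by
  refine Subtype.ext (funext fun μ => ?_)
  refine (fsum_eq_single fun k => ?_).trans ?_
  · beta_reduce
    rw [PowerSeries.coeff_one, if_neg (Nat.succ_ne_zero k), zero_smul]; rfl
  · simp

/-- Functional calculus: x^k passes through the inner series by continuity, and the double series is
regrouped into the Cauchy product. -/
theorem Raising.opSeries_mul (hx : Raising x) (φ ψ : PowerSeries ℝ) (B : gPots 𝔤 𝓕) :
    opSeries x (φ * ψ) B = opSeries x φ (opSeries x ψ B) := by
  have hB : ∀ k, POrd k ((x ^ k) B) := fun k => hx.pow k fun μ => Ord.of_zero _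
  have h1 : ∀ k, (x ^ k) (opSeries x ψ B) =
      psum fun l => PowerSeries.coeff l ψ • (x ^ (k + l)) B := fun k => by
    rw [opSeries, map_psum (x ^ k) (fun l B hB => (hx.pow k hB).mono (by omega)) fun l => (hB l).smul _]
    congr 1; funext l
    rw [map_smul, pow_add, Module.End.mul_apply]
  refine Subtype.ext (funext fun μ => ?_)
  have h2 : ∀ k l, Ord (k + l)
      ((PowerSeries.coeff k φ • PowerSeries.coeff l ψ • (x ^ (k + l)) B).1 μ) := fun k l =>
    (((hB (k + l)).smul _).smul _) μ
  have h3 : (opSeries x φ (opSeries x ψ B)).1 μ = fsum fun k => fsum fun l =>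
      (PowerSeries.coeff k φ • PowerSeries.coeff l ψ • (x ^ (k + l)) B).1 μ := by
    simp only [opSeries] at h1 ⊢
    simp only [h1]
    change (fsum fun k => PowerSeries.coeff k φ • fsum fun l => _) = _
    simp only [fsum_real_smul]
    rfl
  rw [h3, fsum_fsum h2]
  change (fsum fun k => _) = _
  congr 1
  funext N
  beta_reduce
  rw [PowerSeries.coeff_mul, Finset.sum_smul, AddSubmonoidClass.coe_finsetSum, Finset.sum_apply]
  refine Finset.sum_congr rfl fun ab hab => ?_
  rw [mem_antidiagonal.mp hab, smul_smul]

theorem Raising.opSeries_X_mul (hx : Raising x) (φ : PowerSeries ℝ) (B : gPots 𝔤 𝓕) :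
    opSeries x (PowerSeries.X * φ) B = x (opSeries x φ B) := by
  have hB : ∀ k, POrd k ((x ^ k) B) := fun k => hx.pow k fun μ => Ord.of_zero _
  rw [opSeries, opSeries, map_psum x (fun k B hB => (hx k B hB).mono (Nat.le_succ k))
    fun k => (hB k).smul _]
  refine Subtype.ext (funext fun μ => ?_)
  refine (fsum_shift ?_ fun k => ((hB k).smul _) μ).trans ?_
  · rw [PowerSeries.coeff_zero_X_mul, zero_smul]; rfl
  · refine congrArg fsum (funext fun k => ?_)
    beta_reduce
    rw [PowerSeries.coeff_succ_X_mul, map_smul, pow_succ', Module.End.mul_apply]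

end OperatorCalculus

/-! ### The direction of the obstruction map in the space of potentials -/

section Direction

variable {n : ℕ} {𝔤 : GaugeAlgebra n} {c : Fin 4 → Distr ℝ} {𝓕 : FieldSpace c}

variable (c) in
/-- The potential `B_μ + ∂_μ I_c(B)` in the axial gauge defined by the string. -/
def axial (B : Pot n) : Pot n := fun μ => B μ + partialD μ (stringInt c B)

theorem axial_mem_gPots {B : Pot n} (hB : B ∈ gPots 𝔤 𝓕) : axial c B ∈ gPots 𝔤 𝓕 :=
  add_mem hB (gradient_mem_gPots (stringInt_mem_gScalars hB))

theorem stringInt_smooth {B : Pot n} (hB : B ∈ 𝓕.pots n) : stringInt c B ∈ smoothFields n n :=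
  matScalars_le_smoothFields (stringInt_mem hB)

variable (𝔤 𝓕) in
/-- `axial` as a linear operator. -/
def axialLin : Module.End ℝ (gPots 𝔤 𝓕) where
  toFun B := ⟨axial c B.1, axial_mem_gPots B.2⟩
  map_add' B C := by
    refine Subtype.ext (funext fun μ => ?_)
    have h : stringInt c (B.1 + C.1) = stringInt c B.1 + stringInt c C.1 := stringInt_add B.2.2 C.2.2
    simp only [Submodule.coe_add, axial, Pi.add_apply]
    rw [h, partialD_add μ (stringInt_smooth B.2.2) (stringInt_smooth C.2.2)]
    abel
  map_smul' r B := by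
    refine Subtype.ext (funext fun μ => ?_)
    have h : stringInt c (r • B.1) = r • stringInt c B.1 := stringInt_real_smul r B.2.2
    simp only [Submodule.coe_smul, axial, Pi.smul_apply, RingHom.id_apply]
    rw [h, real_smul_eq r (stringInt c B.1), partialD_smul μ _ (stringInt_smooth B.2.2), smul_add,
      ← real_smul_eq]

theorem stringInt_axialLin (hc : IsStringFunction c) (B : gPots 𝔤 𝓕) :
    stringInt c (axialLin 𝔤 𝓕 B).1 = 0 := by
  have h := gradient_mem_gPots (stringInt_mem_gScalars B.2)
  change stringInt c (B.1 + fun μ => partialD μ (stringInt c B.1)) = 0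
  rw [stringInt_add B.2.2 h.2, stringInt_gradient hc (stringInt_mem B.2.2), add_neg_cancel]

theorem axialLin_eq_self {B : gPots 𝔤 𝓕} (hB : stringInt c B.1 = 0) : axialLin 𝔤 𝓕 B = B := by
  refine Subtype.ext (funext fun μ => ?_)
  have : partialD μ (0 : MatField n n) = 0 := eq_zero_of_ord fun k => (ord_zero k).partialD μ
  change B.1 μ + partialD μ (stringInt c B.1) = B.1 μ
  rw [hB, this, add_zero]

theorem POrd.axialLin {k : ℕ} {B : gPots 𝔤 𝓕} (hB : POrd k B) : POrd k (axialLin 𝔤 𝓕 B) := fun μ =>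
  (hB μ).add ((Ord.stringInt c hB).partialD μ)

variable (𝔤 𝓕) in
/-- `𝔤`-valued scalar fields of order `g`. -/
abbrev SmallField : Type := {X : MatField n n // X ∈ gScalars 𝔤 𝓕 ∧ Ord 1 X}

/-- The small field `-X`. -/
def SmallField.neg (X : SmallField 𝔤 𝓕) : SmallField 𝔤 𝓕 := ⟨-X.1, neg_mem X.2.1, X.2.2.neg⟩

/-- Conjugation by `e^{iX}`. -/
def conjLin (X : SmallField 𝔤 𝓕) : Module.End ℝ (gPots 𝔤 𝓕) where
  toFun B := ⟨fun μ => fexp (Complex.I • X.1) * B.1 μ * fexp (-(Complex.I • X.1)),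
    conj_mem_gPots X.2.1 X.2.2 B.2⟩
  map_add' B C := by
    refine Subtype.ext (funext fun μ => ?_)
    simp only [Submodule.coe_add, Pi.add_apply, mul_add, add_mul]
  map_smul' r B := by
    refine Subtype.ext (funext fun μ => ?_)
    simp only [Submodule.coe_smul, Pi.smul_apply, RingHom.id_apply, real_smul_eq, mul_smul_comm,
      smul_mul_assoc]

theorem conjLin_apply (X : SmallField 𝔤 𝓕) (B : gPots 𝔤 𝓕) (μ : Fin 4) :
    (conjLin X B).1 μ = fexp (Complex.I • X.1) * B.1 μ * fexp (-(Complex.I • X.1)) := rfl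

theorem conjLin_conjLin_neg (X : SmallField 𝔤 𝓕) (B : gPots 𝔤 𝓕) : conjLin X (conjLin X.neg B) = B := by
  refine Subtype.ext (funext fun μ => ?_)
  have h := fexp_mul_fexp_neg (X.2.2.smul Complex.I)
  rw [conjLin_apply, conjLin_apply, SmallField.neg, smul_neg, neg_neg, mul_assoc, mul_assoc, mul_assoc, h,
    mul_one, ← mul_assoc, h, one_mul]

/-- The operator `B ↦ P(e^{-iX} B e^{iX} - B)`, where `P` is the projection to the axial gauge. -/
def shiftOp (X : SmallField 𝔤 𝓕) : Module.End ℝ (gPots 𝔤 𝓕) := axialLin 𝔤 𝓕 * (conjLin X.neg - 1)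

/-- Conjugation by 1 + O(g) changes B only by terms of one order more, and the axial projection
preserves orders. -/
theorem raising_shiftOp (X : SmallField 𝔤 𝓕) : Raising (shiftOp X) := by
  intro k B hB
  refine POrd.axialLin fun μ => ?_
  have h1 := X.neg.2.2.smul Complex.I
  have e : (conjLin X.neg B - B).1 μ = (fexp (Complex.I • X.neg.1) - 1) * B.1 μ *
      fexp (-(Complex.I • X.neg.1)) + B.1 μ * (fexp (-(Complex.I • X.neg.1)) - 1) := by
    rw [sub_mul, sub_mul, mul_sub, mul_one, one_mul, sub_add_sub_cancel]; rfl
  have h2 : Ord (k + 1) ((conjLin X.neg B - B).1 μ) := by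
    rw [e]
    exact ((((ord_fexp_sub_one h1).mul (hB μ)).mono (by omega)).mul_right _).add
      ((hB μ).mul (ord_fexp_sub_one h1.neg))
  exact h2

/-- For k ≥ 1 the operator x^k ends with the axial projection, whose image has vanishing string
integral; the term k = 0 is the hypothesis on B. -/
theorem stringInt_opSeries (hc : IsStringFunction c) (X : SmallField 𝔤 𝓕) (φ : PowerSeries ℝ)
    {B : gPots 𝔤 𝓕} (hB : stringInt c B.1 = 0) : stringInt c (opSeries (shiftOp X) φ B).1 = 0 := by
  have h : ∀ k, stringInt c (PowerSeries.coeff k φ • (shiftOp X ^ k) B).1 = 0 := fun k => by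
    have : stringInt c ((shiftOp X ^ k) B).1 = 0 := by
      cases k with
      | zero => exact hB
      | succ k => rw [pow_succ']; exact stringInt_axialLin hc _
    rw [Submodule.coe_smul, stringInt_real_smul _ ((shiftOp X ^ k) B).2.2, this, smul_zero]
  refine (stringInt_fsum fun k => (PowerSeries.coeff k φ • (shiftOp X ^ k) B).2.2).trans ?_
  refine eq_zero_of_ord fun m => Ord.fsum fun k => ?_
  have := h k
  rw [this]
  exact ord_zero m

variable {γ : Pot n → MatField n n} (h : IsDressingExponent 𝔤 𝓕 γ)

/-- The value of the dressing exponent. -/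
def IsDressingExponent.small (A : gPots 𝔤 𝓕) : SmallField 𝔤 𝓕 := ⟨γ A.1, h.mem_gScalars A.2, h.ord A.2⟩

/-- Multiplication by `g`. -/
def gmul : Module.End ℝ (gPots 𝔤 𝓕) where
  toFun A := ⟨fun μ => g • A.1 μ, g_smul_mem_gPots A.2⟩
  map_add' _ _ := Subtype.ext (funext fun _ => smul_add _ _ _)
  map_smul' r B := Subtype.ext (funext fun μ => smul_comm g r (B.1 μ))

/-- The dressed potential `g A^u = W (g A + i∂) W⁻¹`. -/
def IsDressingExponent.dressedPot (A : gPots 𝔤 𝓕) : gPots 𝔤 𝓕 :=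
  ⟨gact (fexp (Complex.I • γ A.1)) (fexp (-(Complex.I • γ A.1))) fun μ => g • A.1 μ,
    gact_fexp_mem_gPots (h.mem_gScalars A.2) (h.ord A.2) (g_smul_mem_gPots A.2)⟩

/-- The difference of the axial potential and the dressed potential, times `g`. -/
def IsDressingExponent.gap (A : gPots 𝔤 𝓕) : gPots 𝔤 𝓕 := axialLin 𝔤 𝓕 (gmul A) - h.dressedPot A

/-- The change of the dressed potential under the obstruction map, times `g`. -/
def IsDressingExponent.gen (A : gPots 𝔤 𝓕) : gPots 𝔤 𝓕 := opSeries (shiftOp (h.small A)) logQuot (h.gap A)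

/-- The value `g α` of the obstruction map on `g A`. -/
def IsDressingExponent.dir (A : gPots 𝔤 𝓕) : gPots 𝔤 𝓕 := conjLin (h.small A).neg (h.gen A)

theorem IsDressingExponent.stringInt_gap (hc : IsStringFunction c) (A : gPots 𝔤 𝓕) :
    stringInt c (h.gap A).1 = 0 := by
  have h1 : stringInt c (h.dressedPot A).1 = 0 := h.stringInt_gact A.2
  change stringInt c ((axialLin 𝔤 𝓕 (gmul A)).1 - (h.dressedPot A).1) = 0
  rw [stringInt_sub (axialLin 𝔤 𝓕 (gmul A)).2.2 (h.dressedPot A).2.2, stringInt_axialLin hc, h1, sub_zero]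

theorem IsDressingExponent.stringInt_gen (hc : IsStringFunction c) (A : gPots 𝔤 𝓕) :
    stringInt c (h.gen A).1 = 0 := stringInt_opSeries hc _ _ (h.stringInt_gap hc A)

/-- Since P Y = Y for Y = `h.gen A`, the axial part of W⁻¹YW is Y + xY. -/
theorem IsDressingExponent.axialLin_dir (hc : IsStringFunction c) (A : gPots 𝔤 𝓕) :
    axialLin 𝔤 𝓕 (h.dir A) =
      opSeries (shiftOp (h.small A)) ((1 + PowerSeries.X) * logQuot) (h.gap A) := by
  have h1 : axialLin 𝔤 𝓕 (h.dir A) = axialLin 𝔤 𝓕 (h.gen A) + shiftOp (h.small A) (h.gen A) := by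
    rw [shiftOp, Module.End.mul_apply, ← map_add, LinearMap.sub_apply, Module.End.one_apply,
      add_sub_cancel]; rfl
  rw [h1, axialLin_eq_self (h.stringInt_gen hc A), add_mul, one_mul, opSeries_add,
    (raising_shiftOp _).opSeries_X_mul]
  rfl

-- Exact change of the exponent and of the gap along the direction α

section Translation

variable (hc : IsStringFunction c) {A α : gPots 𝔤 𝓕} (hα : gmul α = h.dir A) (t : ℝ)

include hα

/-- For a fixed factor W the gauge action is affine in the potential, and W(gα)W⁻¹ = `h.gen A` by
the choice of the direction. -/
theorem IsDressingExponent.gact_add :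
    gact (fexp (Complex.I • γ A.1)) (fexp (-(Complex.I • γ A.1))) (gmul (A + t • α)).1 =
      (h.dressedPot A + t • h.gen A).1 := by
  have h1 : conjLin (h.small A) (gmul (t • α)) = t • h.gen A := by
    rw [map_smul, map_smul, hα, IsDressingExponent.dir, conjLin_conjLin_neg]
  rw [← h1, map_add gmul]
  funext μ
  change fexp (Complex.I • γ A.1) * ((gmul A).1 μ + (gmul (t • α)).1 μ) * fexp (-(Complex.I • γ A.1)) + _ =
    fexp (Complex.I • γ A.1) * (gmul A).1 μ * fexp (-(Complex.I • γ A.1)) + _ +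
      fexp (Complex.I • γ A.1) * (gmul (t • α)).1 μ * fexp (-(Complex.I • γ A.1))
  rw [mul_add, add_mul, add_right_comm]

include hc

/-- The old dressing factor still gives a potential with vanishing string integral, because the
added term does; uniqueness then identifies it with the new factor. -/
theorem IsDressingExponent.apply_add : γ (A + t • α).1 = γ A.1 := by
  refine (h.eq_of_fexp hc (A + t • α).2 (h.mem_gScalars A.2) (h.ord A.2) ?_).symm
  have h1 := h.gact_add hα t
  have h2 : stringInt c ((h.dressedPot A).1 + (t • h.gen A).1) = 0 := by
    rw [stringInt_add (h.dressedPot A).2.2 (t • h.gen A).2.2, Submodule.coe_smul,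
      stringInt_real_smul _ (h.gen A).2.2, h.stringInt_gen hc, smul_zero, add_zero]
    exact h.stringInt_gact A.2
  rw [← Submodule.coe_add, ← h1] at h2
  exact h2

theorem IsDressingExponent.small_add : h.small (A + t • α) = h.small A :=
  Subtype.ext (h.apply_add hc hα t)

/-- The axial potential changes by (1 + x)Y and the dressed potential by Y, so the gap changes by
xY, exactly and linearly in t. -/
theorem IsDressingExponent.gap_add : h.gap (A + t • α) =
    h.gap A + t • opSeries (shiftOp (h.small A)) (PowerSeries.X * logQuot) (h.gap A) := by
  have h1 : h.dressedPot (A + t • α) = h.dressedPot A + t • h.gen A := by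
    refine Subtype.ext ?_
    rw [← h.gact_add hα t, ← h.apply_add hc hα t]
    rfl
  have h2 : opSeries (shiftOp (h.small A)) ((1 + PowerSeries.X) * logQuot) (h.gap A) =
      h.gen A + opSeries (shiftOp (h.small A)) (PowerSeries.X * logQuot) (h.gap A) := by
    rw [add_mul, one_mul]
    exact opSeries_add _ _ _
  have h3 : axialLin 𝔤 𝓕 (gmul (A + t • α)) = axialLin 𝔤 𝓕 (gmul A) + (t • h.gen A +
      t • opSeries (shiftOp (h.small A)) (PowerSeries.X * logQuot) (h.gap A)) := by
    rw [map_add, map_add, map_smul, map_smul, hα, h.axialLin_dir hc, h2, smul_add]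
  have key : ∀ p d G O : gPots 𝔤 𝓕, p + (G + O) - (d + G) = (p - d) + O := by intros; abel
  have h4 : h.gap (A + t • α) = axialLin 𝔤 𝓕 (gmul (A + t • α)) - h.dressedPot (A + t • α) := rfl
  rw [h4, h3, h1, key]
  rfl

/-- As x depends only on γ, it does not vary: one application of ω multiplies the symbol φ by X ·
`logQuot`. -/
theorem IsDressingExponent.opSeries_gap_add (φ : PowerSeries ℝ) :
    opSeries (shiftOp (h.small (A + t • α))) φ (h.gap (A + t • α)) =
      opSeries (shiftOp (h.small A)) φ (h.gap A) +
        t • opSeries (shiftOp (h.small A)) (φ * (PowerSeries.X * logQuot)) (h.gap A) := by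
  rw [h.small_add hc hα, h.gap_add hc hα, opSeries_add_right, opSeries_smul_right,
    (raising_shiftOp _).opSeries_mul φ]

end Translation

/-! ### Representation of the direction by a series of functionals -/

/-- One power of g is the factor multiplying α, the other one is the order g at which the series of
α must begin. -/
theorem exists_of_rep_two {F : Pot n → Pot n} (hF : RepV 𝔤 𝓕 2 F) :
    ∃ α : Pot n → Pot n, InGV c α ∧ ∀ A ∈ gPots 𝔤 𝓕, ∀ μ, g • α A μ = F A μ := by
  obtain ⟨v, hv, hv0, hF⟩ := hF
  refine ⟨fun A μ => gsum fun j => v (j + 2) A μ, ⟨fun j => v (j + 2), fun j => hv _, fun _ _ => rfl⟩,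
    fun A hA μ => ?_⟩
  beta_reduce
  rw [hF A hA, gsum_eq, gser_eq_g_smul (F := fun j => v j A μ) (by rw [hv0 0 (by omega)]; rfl),
    gser_eq_g_smul (F := fun j => v (j + 1) A μ) (by rw [hv0 1 (by omega)]; rfl)]

theorem RepV.axial {k : ℕ} {F : Pot n → Pot n} (hF : RepV 𝔤 𝓕 k F) :
    RepV 𝔤 𝓕 k fun A => SQFT.axial c (F A) := add_mem hF (RepV.stringInt hF).gradient

/-- Removing the term without commutator leaves terms that each contain at least one factor f =
O(g). -/
theorem RepV.fsum_adm_sub {k : ℕ} {f : Pot n → MatField n n} (hf : RepS 𝔤 𝓕 1 f) {F : Pot n → Pot n}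
    (hF : RepV 𝔤 𝓕 k F) {a : ℕ → ℕ} (ha : a 0 = 1) : RepV 𝔤 𝓕 (k + 1) fun A μ =>
      fsum (fun j => ((a j : ℂ)⁻¹) • (SQFT.adm (Complex.I • f A))^[j] (F A μ)) - F A μ := by
  set T : ℕ → Pot n → Pot n := fun j => if j = 0 then 0 else
    fun A μ => ((a j : ℂ)⁻¹) • (SQFT.adm (Complex.I • f A))^[j] (F A μ) with hT
  have h1 : ∀ j m, m ≤ j ∨ m ≤ k + 1 → RepV 𝔤 𝓕 m (T j) := fun j m hm => by
    by_cases hj : j = 0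
    · simp only [hT, hj, if_true]; exact zero_mem (Rep 𝔤 𝓕 (spaceV n c) m)
    · simp only [hT, hj, if_false]
      exact rep_mono (by omega) (RepV.inv_natCast_smul (a j) (RepV.iterate_adm hf hF j))
  refine rep_congr (fun A hA μ => ?_) (rep_fsum (fun j => h1 j j (by omega))
    (fun j => h1 j (k + 1) (by omega)))
  rw [eq_sub_iff_add_eq]
  refine ext_cf fun N => ?_
  rw [map_add, cf_fsum, cf_fsum, Finset.sum_range_succ', Finset.sum_range_succ']
  simp [T, ha]

theorem RepV.conj_sub {k : ℕ} {f : Pot n → MatField n n} (hf : RepS 𝔤 𝓕 1 f) {F : Pot n → Pot n}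
    (hF : RepV 𝔤 𝓕 k F) : RepV 𝔤 𝓕 (k + 1) fun A μ =>
      fexp (Complex.I • f A) * F A μ * fexp (-(Complex.I • f A)) - F A μ := by
  refine rep_congr (fun A hA μ => ?_) (RepV.fsum_adm_sub hf hF Nat.factorial_zero)
  rw [fexp_conj ((rep_ord hf hA ()).smul _)]

theorem RepV.expDer_sub {k : ℕ} {f : Pot n → MatField n n} (hf : RepS 𝔤 𝓕 1 f) {F : Pot n → Pot n}
    (hF : RepV 𝔤 𝓕 k F) : RepV 𝔤 𝓕 (k + 1) fun A μ =>
      SQFT.expDer (Complex.I • f A) (F A μ) - F A μ :=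
  RepV.fsum_adm_sub hf hF (a := fun j => (j + 1).factorial) rfl

include h

theorem IsDressingExponent.rep_neg : RepS 𝔤 𝓕 1 fun A => -γ A :=
  (Rep 𝔤 𝓕 (spaceS n c) 1).neg_mem h.repS

theorem rep_shiftOp {k : ℕ} {F : gPots 𝔤 𝓕 → gPots 𝔤 𝓕} {F' : Pot n → Pot n}
    (hF : RepV 𝔤 𝓕 k F') (hFF : ∀ A, (F A).1 = F' A.1) :
    ∃ G' : Pot n → Pot n, RepV 𝔤 𝓕 (k + 1) G' ∧ ∀ A, (shiftOp (h.small A) (F A)).1 = G' A.1 := by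
  refine ⟨_, (RepV.conj_sub h.rep_neg hF).axial, fun A => ?_⟩
  rw [← hFF]
  rfl

theorem rep_shiftOp_pow {k : ℕ} {F : gPots 𝔤 𝓕 → gPots 𝔤 𝓕} {F' : Pot n → Pot n}
    (hF : RepV 𝔤 𝓕 k F') (hFF : ∀ A, (F A).1 = F' A.1) (j : ℕ) :
    ∃ G' : Pot n → Pot n, RepV 𝔤 𝓕 (k + j) G' ∧ ∀ A, ((shiftOp (h.small A) ^ j) (F A)).1 = G' A.1 := by
  induction j with
  | zero => exact ⟨F', hF, hFF⟩
  | succ j ih =>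
    obtain ⟨G', h1, h2⟩ := ih
    obtain ⟨G'', h3, h4⟩ := rep_shiftOp h (F := fun A => (shiftOp (h.small A) ^ j) (F A)) h1 h2
    exact ⟨G'', h3, fun A => by rw [pow_succ']; exact h4 A⟩

theorem exponentStep_eq (hc : IsStringFunction c) {A : Pot n} (hA : A ∈ gPots 𝔤 𝓕) :
    exponentStep c A (γ A) = γ A := by
  have := stringInt_gact_fexp hc hA (h.mem_gScalars hA) (h.ord hA)
  rw [h.stringInt_gact hA] at this
  exact sub_eq_zero.mp this.symm

omit h in
theorem fexp_zero {p : ℕ} : fexp (0 : MatField p p) = 1 := by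
  rw [fexp_eq, fsum_eq_single, expTerm_zero]
  intro k
  rw [expTerm, zero_pow (Nat.succ_ne_zero k), smul_zero]

omit h in
theorem expDer_zero_right {p : ℕ} (Z : MatField p p) : expDer Z 0 = 0 := by
  have := expDer_smul Z 0 0
  rwa [zero_smul, zero_smul] at this

/-- At order g one has γ = I_c(gA), so the dressed potential begins with gA + ∂I_c(gA), which is the
axial potential. The remainder consists of commutators and of ∂(γ - I_c(gA)), all O(g²). -/
theorem rep_gap (hc : IsStringFunction c) :
    ∃ F' : Pot n → Pot n, RepV 𝔤 𝓕 2 F' ∧ ∀ A, (h.gap A).1 = F' A.1 := by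
  have h0 : RepS 𝔤 𝓕 1 fun _ : Pot n => (0 : MatField n n) := zero_mem (Rep 𝔤 𝓕 (spaceS n c) 1)
  -- Comparison with the first iterate, `exponentStep c A 0` = I_c(gA).
  have h1 : RepS 𝔤 𝓕 2 fun A => exponentStep c A (γ A) - exponentStep c A 0 :=
    RepS.exponentStep_sub (d := 0) h.repS h0 (sub_mem h.repS h0)
  have hpd : ∀ μ, partialD μ (0 : MatField n n) = 0 := fun μ =>
    eq_zero_of_ord fun k => (ord_zero k).partialD μ
  have h2 : RepS 𝔤 𝓕 2 fun A => γ A - stringInt c (fun μ => g • A μ) := by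
    refine rep_congr (fun A hA _ => ?_) h1
    beta_reduce
    rw [exponentStep_eq h hc hA, exponentStep]
    simp [hpd, expDer_zero_right, fexp_zero]
  have h3 := RepV.conj_sub h.repS (RepV.g_smul_potential (c := c) (𝔤 := 𝔤) (𝓕 := 𝓕))
  have h4 := RepV.expDer_sub h.repS h.repS.gradient
  refine ⟨_, neg_mem (add_mem (add_mem h3 h4) h2.gradient), fun A => funext fun μ => ?_⟩
  have h5 : (h.gap A).1 μ = g • A.1 μ + partialD μ (stringInt c fun μ => g • A.1 μ) -
      gact (fexp (Complex.I • γ A.1)) (fexp (-(Complex.I • γ A.1))) (fun μ => g • A.1 μ) μ := rfl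
  rw [h5, gact_fexp (h.ord A.2) (gScalars_smooth (h.mem_gScalars A.2))]
  simp only [Pi.neg_apply, Pi.add_apply]
  rw [partialD_sub μ (gScalars_smooth (h.mem_gScalars A.2)) (stringInt_smooth (g_smul_mem_gPots A.2).2)]
  abel

/-- The coefficients of `logQuot` are real and each power of x gains an order, so the series stays
in the represented functionals of order g². -/
theorem rep_dir (hc : IsStringFunction c) :
    ∃ F' : Pot n → Pot n, RepV 𝔤 𝓕 2 F' ∧ ∀ A, (h.dir A).1 = F' A.1 := by
  obtain ⟨w, hw, hw'⟩ := rep_gap h hc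
  choose G hG hG' using rep_shiftOp_pow h hw hw'
  have h1 : RepV 𝔤 𝓕 2 fun A μ => fsum fun k => (PowerSeries.coeff k logQuot • G k) A μ :=
    rep_fsum (fun k => (Rep 𝔤 𝓕 (spaceV n c) k).smul_mem _ (rep_mono (by omega) (hG k)))
      (fun k => (Rep 𝔤 𝓕 (spaceV n c) 2).smul_mem _ (rep_mono (by omega) (hG k)))
  refine ⟨_, RepV.conj h.rep_neg h1, fun A => ?_⟩
  funext μ
  simp only [Pi.smul_apply, ← hG']
  rfl

end Direction

/-! ### The obstruction map and the dressed fields -/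

section Obstruction

variable {n m : ℕ} {𝔤 : GaugeAlgebra n} {c : Fin 4 → Distr ℝ} {𝓕 : FieldSpace c} (Q : FreeFields)
  (π : UnitaryRep 𝔤 m)

theorem cf_of_pairing {p q : ℕ} (T : Fin p → Fin q → Fin 4 → Distr ℂ) (v : Fin p → Fin q → Fin 4 → Series)
    (N : ℕ) (i : Fin p) (j : Fin q) : cf N (Matrix.of fun i j => pairing (T i j) (v i j)) i j =
      pairingComplex (T i j) fun ν => PowerSeries.coeff N (v i j ν) := by
  simp [cf_apply, pairing]

theorem obstrGen_fst {α : Pot n → Pot n} {β : Pot n → MatField n n} {Φ : Config n m}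
    (hα : ∀ μ, α Φ.1 μ ∈ smoothFields n n) : (obstrGen Q π α β Φ).1 = α Φ.1 := by
  funext κ
  refine ext_cf fun N => ?_
  ext i j x
  have h0 : cf N ((obstrGen Q π α β Φ).1 κ) i j = η κ • pairingComplex
      (fun ν => Complex.I • obstrFA Q.T₀ ν κ) (fun ν => cf N (α Φ.1 ν) i j) := by
    rw [obstrGen, cf_real_smul, Matrix.smul_apply]
    exact congrArg _ (cf_of_pairing (fun _ _ ν => Complex.I • obstrFA Q.T₀ ν κ)
      (fun i j ν => α Φ.1 ν i j) N i j)
  rw [h0, Pi.smul_apply, pairingComplex_of_delta (fun ν h => obstrFA_eq Q.gluon ν κ h)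
      (fun ν => hα ν N i j)]
  simp only [ite_mul, zero_mul, Finset.sum_ite_eq', Finset.mem_univ, if_true]
  rw [Complex.real_smul, ← mul_assoc, ← Complex.ofReal_mul, η_mul_self, Complex.ofReal_one, one_mul]

theorem obstrGen_snd {α : Pot n → Pot n} {β : Pot n → MatField n n} {Φ : Config n m}
    (hψ : lieRep π (β Φ.1) * Φ.2 ∈ smoothFields m 4) :
    (obstrGen Q π α β Φ).2 = Complex.I • (lieRep π (β Φ.1) * Φ.2) := by
  refine ext_cf fun N => ?_
  ext a j x
  have h0 : cf N (obstrGen Q π α β Φ).2 a j = pairingComplex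
      (fun i => Complex.I • obstrDirac Q.Γ Q.M Q.T j i) (fun i => cf N (lieRep π (β Φ.1) * Φ.2) a i) :=
    cf_of_pairing (fun _ j i => Complex.I • obstrDirac Q.Γ Q.M Q.T j i)
      (fun a _ i => (lieRep π (β Φ.1) * Φ.2) a i) N a j
  rw [h0, map_smul, Matrix.smul_apply, Pi.smul_apply, pairingComplex_of_delta (fun i h => obstrDirac_eq Q.dirac Q.quark j i h)
      (fun i => hψ N a i)]
  simp only [ite_mul, zero_mul, Finset.sum_ite_eq', Finset.mem_univ, if_true]
  rfl

variable {Q π}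

/-- Along the line in the direction of ω the functional is affine in t, so its derivative is the
slope. This is the only way in which functional derivatives are evaluated. -/
theorem g_smul_obstr {α : Pot n → Pot n} {β : Pot n → MatField n n} {p q : ℕ}
    {X : Config n m → MatField p q} {Φ : Config n m} {Z : MatField p q}
    (hX : ∀ t : ℝ, g • X (Φ + t • obstrGen Q π α β Φ) = g • X Φ + t • Z) :
    g • obstr Q π α β X Φ = Z := by
  refine ext_cf fun N => ?_
  cases N with
  | zero =>
    -- At order g^0 both multiples of g vanish, so t = 1 forces Z to have no such term.
    have := congrArg (cf 0) (hX 1)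
    rw [map_add, cf_g_smul_zero, cf_g_smul_zero, one_smul, zero_add] at this
    rw [cf_g_smul_zero, this]
  | succ N =>
    rw [cf_g_smul_succ]
    ext i j x
    have h : (fun t : ℝ => PowerSeries.coeff N (X (Φ + t • obstrGen Q π α β Φ) i j) x) =
        fun t : ℝ => cf N (X Φ) i j x + t • cf (N + 1) Z i j x := by
      funext t
      have := congrFun (congrFun (congrFun (congrArg (cf (N + 1)) (hX t)) i) j) x
      rw [map_add, cf_g_smul_succ, cf_g_smul_succ, cf_real_smul] at this
      exact this
    have h2 : HasDerivAt (fun t : ℝ => cf N (X Φ) i j x + t • cf (N + 1) Z i j x)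
        ((1 : ℝ) • cf (N + 1) Z i j x) 0 :=
      ((hasDerivAt_id (0 : ℝ)).smul_const _).const_add _
    have h3 := h2.deriv
    rw [← h, one_smul] at h3
    rw [← h3]
    simp [cf_apply, obstr]

theorem obstr_eq {α : Pot n → Pot n} {β : Pot n → MatField n n} {p q : ℕ}
    {X : Config n m → MatField p q} {Φ : Config n m} {Y : MatField p q}
    (hX : ∀ t : ℝ, X (Φ + t • obstrGen Q π α β Φ) = X Φ + t • Y) : obstr Q π α β X Φ = Y :=
  g_smul_injective (g_smul_obstr fun t => by rw [hX, smul_add, smul_comm])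

theorem cf_dressed (α : Pot n → Pot n) (β : Pot n → MatField n n) {p q : ℕ}
    (X : Config n m → MatField p q) (Φ : Config n m) (N : ℕ) :
    cf N (dressed Q π α β X Φ) = ∑ k ∈ Finset.range (N + 1),
      ((k.factorial : ℂ)⁻¹) • cf N ((obstr Q π α β)^[k] X Φ) := by
  ext i j : 2
  simp [cf_apply, dressed, Matrix.sum_apply]

theorem isConfig_iff {Φ : Config n m} :
    IsConfig 𝓕 𝔤 Φ ↔ Φ.1 ∈ gPots 𝔤 𝓕 ∧ Φ.2 ∈ smoothFields m 4 :=
  and_congr mem_gPots_iff.symm ⟨fun h N i j => h i j N, fun h i j N => h N i j⟩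

/-- String integration commutes with ∂_μ, and I_c^ν(∂_ν A_μ) = -A_μ; hence A_μ(c) = A_μ + ∂_μ
I_c(A). -/
theorem g_smul_stringPot (hc : IsStringFunction c) {Φ : Config n m} (hA : Φ.1 ∈ gPots 𝔤 𝓕) (μ : Fin 4) :
    g • stringPot c μ Φ = (axialLin 𝔤 𝓕 (gmul ⟨Φ.1, hA⟩)).1 μ := by
  have h1 := deriv_mem_pots hA.2 μ
  have h2 := gradient_mem_pots (component_mem_matScalars hA.2 μ)
  have h3 : stringPot c μ Φ = Φ.1 μ + partialD μ (stringInt c Φ.1) := by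
    have : stringPot c μ Φ =
        stringInt c ((fun ν => partialD μ (Φ.1 ν)) - fun ν => partialD ν (Φ.1 μ)) := rfl
    rw [this, stringInt_sub h1 h2, stringInt_gradient hc (component_mem_matScalars hA.2 μ),
      partialD_stringInt hA.2, sub_neg_eq_add, add_comm]
  have h4 : (axialLin 𝔤 𝓕 (gmul ⟨Φ.1, hA⟩)).1 μ =
    g • Φ.1 μ + partialD μ (stringInt c fun ν => g • Φ.1 ν) := rfl
  rw [h3, h4, stringInt_g_smul, partialD_g_smul, smul_add]

variable {γ : Pot n → MatField n n} (h : IsDressingExponent 𝔤 𝓕 γ)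

theorem lieRep_exponent_smooth (A : gPots 𝔤 𝓕) (h : IsDressingExponent 𝔤 𝓕 γ) :
    lieRep π (γ A.1) ∈ smoothFields m m :=
  lieRep_mem_smoothFields π (h.mem_gScalars A.2).1 (gScalars_smooth (h.mem_gScalars A.2))

-- Iterating the obstruction map and summing its exponential

section Flow

variable (hc : IsStringFunction c) {α : Pot n → Pot n}
  (hα : ∀ A : gPots 𝔤 𝓕, α A.1 ∈ gPots 𝔤 𝓕) (hdir : ∀ A : gPots 𝔤 𝓕, ∀ μ, g • α A.1 μ = (h.dir A).1 μ)

include hα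

theorem obstrGen_eq {Φ : Config n m} (hA : Φ.1 ∈ gPots 𝔤 𝓕) (hψ : Φ.2 ∈ smoothFields m 4)
    (h : IsDressingExponent 𝔤 𝓕 γ) :
    obstrGen Q π α γ Φ = (α Φ.1, Complex.I • (lieRep π (γ Φ.1) * Φ.2)) :=
  Prod.ext (obstrGen_fst Q π fun μ =>
      matScalars_le_smoothFields (component_mem_matScalars (hα ⟨Φ.1, hA⟩).2 μ))
    (obstrGen_snd Q π (mul_mem_smoothFields (lieRep_exponent_smooth ⟨Φ.1, hA⟩ h) hψ))

include hc hdir h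

theorem apply_flow {A : gPots 𝔤 𝓕} (t : ℝ) : γ (A.1 + t • α A.1) = γ A.1 :=
  h.apply_add hc (α := ⟨α A.1, hα A⟩) (Subtype.ext (funext (hdir A))) t

/-- Since γ is constant along α, only the factor ψ is varied, and each variation inserts iπ(γ). The
induction covers all configurations, as ω evaluates the previous iterate at displaced ones. -/
theorem iterate_obstr_quark (k : ℕ) {Φ : Config n m} (hA : Φ.1 ∈ gPots 𝔤 𝓕)
    (hψ : Φ.2 ∈ smoothFields m 4) :
    (obstr Q π α γ)^[k] quark Φ = (Complex.I • lieRep π (γ Φ.1)) ^ k * Φ.2 := by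
  induction k generalizing Φ with
  | zero => simp [quark]
  | succ k ih =>
    rw [Function.iterate_succ_apply']
    refine obstr_eq fun t => ?_
    have hL := lieRep_exponent_smooth (π := π) ⟨Φ.1, hA⟩ h
    have hs : Complex.I • (lieRep π (γ Φ.1) * Φ.2) ∈ smoothFields m 4 :=
      (smoothFields m 4).smul_mem _ (mul_mem_smoothFields hL hψ)
    rw [obstrGen_eq hα hA hψ h]
    rw [ih (Φ := Φ + t • (α Φ.1, Complex.I • (lieRep π (γ Φ.1) * Φ.2)))
      (add_mem hA ((gPots 𝔤 𝓕).smul_mem t (hα ⟨Φ.1, hA⟩)))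
      (add_mem hψ (by rw [Prod.smul_snd, real_smul_eq]; exact (smoothFields m 4).smul_mem _ hs)), ih hA hψ]
    have h1 := apply_flow h hc hα hdir (A := ⟨Φ.1, hA⟩) t
    simp only [Prod.fst_add, Prod.snd_add, Prod.smul_fst, Prod.smul_snd]
    rw [h1, Matrix.mul_add, pow_succ, real_smul_eq, real_smul_eq, Matrix.mul_smul, Matrix.mul_smul,
      Matrix.mul_assoc, Matrix.smul_mul, Matrix.mul_smul]

theorem dressed_quark {Φ : Config n m} (hA : Φ.1 ∈ gPots 𝔤 𝓕) (hψ : Φ.2 ∈ smoothFields m 4) :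
    dressed Q π α γ quark Φ = fexp (Complex.I • lieRep π (γ Φ.1)) * Φ.2 := by
  have ho : Ord 1 (Complex.I • lieRep π (γ Φ.1)) := ((h.ord hA).lieRep π (h.mem_gScalars hA).1).smul _
  refine ext_cf fun N => ?_
  rw [cf_dressed, fexp_eq, fsum_mul _ (ord_expTerm ho), cf_fsum]
  refine Finset.sum_congr rfl fun k _ => ?_
  rw [iterate_obstr_quark h hc hα hdir k hA hψ, expTerm, Matrix.smul_mul, map_smul]

/-- The first application of ω gives (1 + x)φ(x)G; by `IsDressingExponent.opSeries_gap_add` each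
further one multiplies the symbol by xφ(x). -/
theorem iterate_obstr_stringPot (μ : Fin 4) (k : ℕ) {Φ : Config n m} (hA : Φ.1 ∈ gPots 𝔤 𝓕)
    (hψ : Φ.2 ∈ smoothFields m 4) :
    g • (obstr Q π α γ)^[k + 1] (stringPot c μ) Φ = (opSeries (shiftOp (h.small ⟨Φ.1, hA⟩))
      ((PowerSeries.X * logQuot) ^ k * ((1 + PowerSeries.X) * logQuot)) (h.gap ⟨Φ.1, hA⟩)).1 μ := by
  induction k generalizing Φ with
  | zero =>
    rw [zero_add, Function.iterate_one, pow_zero, one_mul, ← h.axialLin_dir hc]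
    refine g_smul_obstr fun t => ?_
    rw [obstrGen_eq hα hA hψ h, g_smul_stringPot hc hA]
    have hA' : (Φ + t • (α Φ.1, Complex.I • (lieRep π (γ Φ.1) * Φ.2))).1 ∈ gPots 𝔤 𝓕 :=
      add_mem hA ((gPots 𝔤 𝓕).smul_mem t (hα ⟨Φ.1, hA⟩))
    rw [g_smul_stringPot hc hA']
    have h1 : gmul (⟨_, hA'⟩ : gPots 𝔤 𝓕) = gmul ⟨Φ.1, hA⟩ + t • h.dir ⟨Φ.1, hA⟩ := by
      refine Subtype.ext (funext fun ν => ?_)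
      have := hdir ⟨Φ.1, hA⟩ ν
      rw [Submodule.coe_add, Pi.add_apply, Submodule.coe_smul, Pi.smul_apply, ← this]
      change g • (Φ.1 ν + t • α Φ.1 ν) = _
      rw [smul_add, smul_comm]
      rfl
    rw [h1, map_add, map_smul]
    rfl
  | succ k ih =>
    rw [Function.iterate_succ_apply']
    refine g_smul_obstr fun t => ?_
    have hL := lieRep_exponent_smooth (π := π) ⟨Φ.1, hA⟩ h
    have hs : Complex.I • (lieRep π (γ Φ.1) * Φ.2) ∈ smoothFields m 4 :=
      (smoothFields m 4).smul_mem _ (mul_mem_smoothFields hL hψ)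
    rw [obstrGen_eq hα hA hψ h]
    rw [ih (Φ := Φ + t • (α Φ.1, Complex.I • (lieRep π (γ Φ.1) * Φ.2)))
      (add_mem hA ((gPots 𝔤 𝓕).smul_mem t (hα ⟨Φ.1, hA⟩)))
      (add_mem hψ (by rw [Prod.smul_snd, real_smul_eq]; exact (smoothFields m 4).smul_mem _ hs)), ih hA hψ]
    have h1 := h.opSeries_gap_add hc (α := ⟨α Φ.1, hα ⟨Φ.1, hA⟩⟩)
      (Subtype.ext (funext (hdir ⟨Φ.1, hA⟩))) t
      ((PowerSeries.X * logQuot) ^ k * ((1 + PowerSeries.X) * logQuot))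
    rw [pow_succ, mul_right_comm]
    exact congrFun (congrArg Subtype.val h1) μ

/-- The exponential series of ω adds to gA(c) the operator Σ (xφ)^k (1 + x)φ / (k+1)! applied to the
gap, which is -1 by `coeff_sum_logQuot`; then gA(c) - G is the dressed potential. -/
theorem dressed_stringPot (μ : Fin 4) {Φ : Config n m} (hA : Φ.1 ∈ gPots 𝔤 𝓕)
    (hψ : Φ.2 ∈ smoothFields m 4) :
    g • dressed Q π α γ (stringPot c μ) Φ = (h.dressedPot ⟨Φ.1, hA⟩).1 μ := by
  set A : gPots 𝔤 𝓕 := ⟨Φ.1, hA⟩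
  have hgap : POrd 2 (h.gap A) := by
    obtain ⟨F', hF, hF'⟩ := rep_gap h hc
    intro ν
    rw [hF']
    exact rep_ord hF A.2 ν
  have hdp : Ord 1 ((h.dressedPot A).1 μ) := by
    refine Ord.gact (𝓕 := 𝓕) ?_ (fun μ => Ord.g_smul (Ord.of_zero _)) μ
    exact isUnip_fexp_neg_I (h.mem_gScalars A.2) (h.ord A.2)
  refine ext_cf fun N => ?_
  cases N with
  | zero => rw [cf_g_smul_zero, hdp 0 one_pos]
  | succ N =>
    -- The order g^N of e^ω involves k ≤ N; the term k = 0 is A(c) itself, so N terms remain.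
    set S := ∑ j ∈ Finset.range N, (((j + 1).factorial : ℝ)⁻¹) •
      ((PowerSeries.X * logQuot) ^ j * ((1 + PowerSeries.X) * logQuot)) with hS
    have h1 : (opSeries (shiftOp (h.small A)) S (h.gap A)).1 μ = ∑ k ∈ Finset.range N,
        (((k + 1).factorial : ℂ)⁻¹) • (g • (obstr Q π α γ)^[k + 1] (stringPot c μ) Φ) := by
      have : opSeries (shiftOp (h.small A)) S (h.gap A) =
        opSeriesLin (shiftOp (h.small A)) (h.gap A) S := rfl
      rw [this, hS, map_sum, coe_sum_apply]
      refine Finset.sum_congr rfl fun k _ => ?_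
      rw [map_smul, Submodule.coe_smul, Pi.smul_apply, inv_natCast_smul,
        iterate_obstr_stringPot h hc hα hdir μ k hA hψ]
      rfl
    have h2 : cf (N + 1) ((opSeries (shiftOp (h.small A)) S (h.gap A)).1 μ) =
        cf (N + 1) (-(h.gap A).1 μ) := by
      have e1 : opSeries (shiftOp (h.small A)) S (h.gap A) =
          -(h.gap A) + opSeries (shiftOp (h.small A)) (S - (-1)) (h.gap A) := by
        have e2 : opSeries (shiftOp (h.small A)) (-1) (h.gap A) = -(h.gap A) := by
          rw [← neg_one_smul ℝ (1 : PowerSeries ℝ), opSeries_smul, opSeries_one]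
          exact neg_one_smul ℝ (h.gap A)
        rw [← e2, ← opSeries_add, add_sub_cancel]
      -- S + 1 has no coefficients below X^N and the gap is O(g²), so the truncation error is
      -- O(g^{N+2}), beyond the order N + 1 under comparison.
      have e3 := (raising_shiftOp (h.small A)).ord_opSeries (N := N) (φ := S - (-1)) (fun k hk => by
        rw [map_sub, hS, coeff_sum_logQuot hk, sub_self]) hgap μ
      rw [e1, Submodule.coe_add, Pi.add_apply, map_add, e3 (N + 1) (by omega), add_zero]
      rfl
    have h3 : cf (N + 1) (g • dressed Q π α γ (stringPot c μ) Φ) =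
        cf (N + 1) ((axialLin 𝔤 𝓕 (gmul A)).1 μ +
          (opSeries (shiftOp (h.small A)) S (h.gap A)).1 μ) := by
      rw [cf_g_smul_succ, cf_dressed, Finset.sum_range_succ', h1, map_add, map_sum, add_comm,
        ← g_smul_stringPot hc hA, cf_g_smul_succ]
      simp only [map_smul, cf_g_smul_succ]
      simp
    rw [h3, map_add, h2, ← map_add]
    congr 1
    have h4 : (h.gap A).1 μ = (axialLin 𝔤 𝓕 (gmul A)).1 μ - (h.dressedPot A).1 μ := rfl
    rw [h4, neg_sub, add_sub_cancel]

end Flow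

end Obstruction

/-! ### The main theorem -/

section Main

variable {n m : ℕ} {𝔤 : GaugeAlgebra n} {c : Fin 4 → Distr ℝ} {𝓕 : FieldSpace c} {Q : FreeFields}
  {π : UnitaryRep 𝔤 m} {γ : Pot n → MatField n n} (h : IsDressingExponent 𝔤 𝓕 γ)

theorem gauge_smooth {θ : MatField n n} (hθ : IsGroupField 𝔤 𝓕 θ) {ψ : MatField m 4}
    (hψ : ψ ∈ smoothFields m 4) : gaugePsi 𝓕 π θ ψ ∈ smoothFields m 4 := by
  obtain ⟨X, hX, oX, rfl, -⟩ := hθ.exists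
  rw [gaugePsi, groupRep_fexp π hX oX, fexp_inv ((oX.lieRep π hX.1).smul _)]
  exact mul_mem_smoothFields (fexp_mem_smoothFields (neg_mem ((smoothFields m m).smul_mem _
    (lieRep_mem_smoothFields π hX.1 (gScalars_smooth hX))))) hψ

include h

theorem exists_direction (hc : IsStringFunction c) : ∃ α : Pot n → Pot n, InGV c α ∧
    (∀ A : gPots 𝔤 𝓕, α A.1 ∈ gPots 𝔤 𝓕) ∧ ∀ A : gPots 𝔤 𝓕, ∀ μ, g • α A.1 μ = (h.dir A).1 μ := by
  obtain ⟨F', hF, hF'⟩ := rep_dir h hc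
  obtain ⟨α, hα, hαF⟩ := exists_of_rep_two hF
  refine ⟨α, hα, fun A => ?_, fun A μ => by rw [hαF A.1 A.2, hF']⟩
  obtain ⟨v, hv, hvα⟩ := hα
  exact RepV.mem_gPots (rep_one_of_gsum hv fun A _ i => hvα A i) A.2

theorem g_smul_dressed_formula {A : Pot n} (hA : A ∈ gPots 𝔤 𝓕) (μ : Fin 4) :
    g • (dressingFactor γ A * A μ * (dressingFactor γ A)⁻¹ +
      Complex.I • gdiv (dressingFactor γ A * partialD μ (dressingFactor γ A)⁻¹)) =
    (h.dressedPot ⟨A, hA⟩).1 μ := by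
  rw [dressingFactor, fexp_inv ((h.ord hA).smul _)]
  exact g_smul_add_gdiv (isUnip_fexp_neg_I (h.mem_gScalars hA) (h.ord hA)) A μ

theorem inv_inv_dressingFactor {A : Pot n} (hA : A ∈ gPots 𝔤 𝓕) :
    ((dressingFactor γ A)⁻¹)⁻¹ = dressingFactor γ A := by
  rw [dressingFactor, fexp_inv ((h.ord hA).smul _), fexp_inv ((h.ord hA).smul _).neg, neg_neg]

/-- From W[A^θ] = W[A]θ, the action of W[A^θ] on A^θ first undoes θ and then applies W[A]. -/
theorem dressedPot_gaugeA (hc : IsStringFunction c) {A : Pot n} (hA : A ∈ gPots 𝔤 𝓕) {θ : MatField n n}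
    (hθ : IsGroupField 𝔤 𝓕 θ) :
    h.dressedPot ⟨gaugeA θ A, gaugeA_mem_gPots hθ hA⟩ = h.dressedPot ⟨A, hA⟩ := by
  refine Subtype.ext ?_
  have hW := h.fexp_gaugeA hc hA hθ
  have ho := (h.ord (gaugeA_mem_gPots hθ hA)).smul Complex.I
  obtain ⟨X, hX, oX, rfl, hinv⟩ := hθ.exists
  have hW' := congrArg (·⁻¹) hW
  simp only [Matrix.mul_inv_rev] at hW'
  rw [fexp_inv ho, hinv, fexp_inv ((h.ord hA).smul _)] at hW'
  have hX1 := isUnip_fexp_I hX oX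
  have hX2 := isUnip_fexp_neg_I hX oX
  have hW2 := isUnip_fexp_neg_I (h.mem_gScalars hA) (h.ord hA)
  have e1 := fexp_mul_fexp_neg (oX.smul Complex.I)
  change gact (fexp (Complex.I • γ (gaugeA _ A))) (fexp (-(Complex.I • γ (gaugeA _ A))))
    (fun μ => g • gaugeA _ A μ) = gact _ _ _
  rw [hW, hW', g_smul_gaugeA hX1, hinv, gact_gact (fexp_neg_mul_fexp (oX.smul _)) hX1.smooth
    (hX2.mul hW2).smooth, mul_assoc, e1, mul_one, ← mul_assoc, e1, one_mul]

/-- Multiplicativity of π on W[A]θ = W[A^θ] lets π(θ) cancel against the transformation of ψ. -/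
theorem fexp_lieRep_mul_gaugePsi (hc : IsStringFunction c) {A : Pot n} (hA : A ∈ gPots 𝔤 𝓕)
    {θ : MatField n n} (hθ : IsGroupField 𝔤 𝓕 θ) (ψ : MatField m 4) :
    fexp (Complex.I • lieRep π (γ (gaugeA θ A))) * gaugePsi 𝓕 π θ ψ =
      fexp (Complex.I • lieRep π (γ A)) * ψ := by
  have hA' := gaugeA_mem_gPots hθ hA
  have hW := h.fexp_gaugeA hc hA hθ
  obtain ⟨X, hX, oX, rfl, -⟩ := hθ.exists
  have oX' := (oX.lieRep π hX.1).smul Complex.I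
  rw [gaugePsi, groupRep_fexp π hX oX, fexp_inv oX', ← fexp_lieRep_mul π (h.mem_gScalars hA).1 hX.1
    (h.mem_gScalars hA').1 (h.ord hA) oX (h.ord hA') hW.symm, ← Matrix.mul_assoc,
    Matrix.mul_assoc (fexp (Complex.I • lieRep π (γ A))), fexp_mul_fexp_neg oX', Matrix.mul_one]

theorem groupRep_dressingFactor {A : Pot n} (hA : A ∈ gPots 𝔤 𝓕) :
    groupRep 𝓕 π (dressingFactor γ A) = fexp (Complex.I • lieRep π (γ A)) :=
  groupRep_fexp π (h.mem_gScalars hA) (h.ord hA)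

theorem gaugePsi_inv_dressingFactor {A : Pot n} (hA : A ∈ gPots 𝔤 𝓕) (ψ : MatField m 4) :
    gaugePsi 𝓕 π (dressingFactor γ A)⁻¹ ψ = fexp (Complex.I • lieRep π (γ A)) * ψ := by
  have hX := h.mem_gScalars hA
  have hL := ((h.ord hA).lieRep π hX.1).smul Complex.I
  rw [gaugePsi, dressingFactor, fexp_inv ((h.ord hA).smul _), ← smul_neg,
    groupRep_fexp π (neg_mem hX) (h.ord hA).neg, lieRep_neg π hX.1, smul_neg, fexp_inv hL.neg, neg_neg]

end Main

end SQFT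

end

theorem corollaryc {n m : ℕ} (𝔤 : SQFT.GaugeAlgebra n) (π : SQFT.UnitaryRep 𝔤 m)
    (c : Fin 4 → SQFT.Distr ℝ) (hc : SQFT.IsStringFunction c) (𝓕 : SQFT.FieldSpace c)
    (Q : SQFT.FreeFields) :
    (∃ γ, SQFT.IsDressingExponent 𝔤 𝓕 γ) ∧
    (∀ γ γ', SQFT.IsDressingExponent 𝔤 𝓕 γ → SQFT.IsDressingExponent 𝔤 𝓕 γ' →
      ∀ A, SQFT.IsVectorField 𝔤 𝓕 A → γ A = γ' A) ∧
    ∀ γ, SQFT.IsDressingExponent 𝔤 𝓕 γ →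
      ∀ W u : SQFT.Pot n → SQFT.MatField n n,
      (W = fun A => SQFT.dressingFactor γ A) → (u = fun A => (W A)⁻¹) →
      SQFT.IsDressingField 𝔤 𝓕 u ∧
      ∃ α β, SQFT.InGV c α ∧ SQFT.InGS c β ∧
        (∀ Φ : SQFT.Config n m, SQFT.IsConfig 𝓕 𝔤 Φ →
          (∀ μ, SQFT.dressed Q π α β (SQFT.stringPot c μ) Φ =
            W Φ.1 * Φ.1 μ * (W Φ.1)⁻¹ +
              Complex.I • SQFT.gdiv (W Φ.1 * SQFT.partialD μ (W Φ.1)⁻¹)) ∧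
          (∀ μ, SQFT.dressed Q π α β (SQFT.stringPot c μ) Φ = SQFT.gaugeA (u Φ.1) Φ.1 μ) ∧
          SQFT.dressed Q π α β SQFT.quark Φ = SQFT.groupRep 𝓕 π (W Φ.1) * Φ.2 ∧
          SQFT.dressed Q π α β SQFT.quark Φ = SQFT.gaugePsi 𝓕 π (u Φ.1) Φ.2) ∧
        (∀ μ, SQFT.IsGaugeInvariant 𝓕 π (SQFT.dressed Q π α β (SQFT.stringPot c μ))) ∧
        SQFT.IsGaugeInvariant 𝓕 π (SQFT.dressed Q π α β SQFT.quark) := by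
  refine ⟨SQFT.exists_isDressingExponent n 𝔤 𝓕 hc, fun γ γ' h h' A hA => h.unique hc h' hA, ?_⟩
  rintro γ h W u rfl rfl
  -- The direction α is constructed from γ; for the quark mediator field β = γ is taken below.
  obtain ⟨α, hα, hαm, hdir⟩ := SQFT.exists_direction h hc
  have hpot : ∀ Φ : SQFT.Config n m, SQFT.IsConfig 𝓕 𝔤 Φ → ∀ μ,
      SQFT.dressed Q π α γ (SQFT.stringPot c μ) Φ =
        SQFT.dressingFactor γ Φ.1 * Φ.1 μ * (SQFT.dressingFactor γ Φ.1)⁻¹ +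
          Complex.I • SQFT.gdiv (SQFT.dressingFactor γ Φ.1 *
            SQFT.partialD μ (SQFT.dressingFactor γ Φ.1)⁻¹) := fun Φ hΦ μ => by
    obtain ⟨hA, hψ⟩ := SQFT.isConfig_iff.mp hΦ
    refine SQFT.g_smul_injective ?_
    rw [SQFT.dressed_stringPot h hc hαm hdir μ hA hψ, SQFT.g_smul_dressed_formula h hA]
  refine ⟨SQFT.isDressingField_inv hc h, α, γ, hα, h.mem, fun Φ hΦ => ⟨hpot Φ hΦ, fun μ => ?_, ?_, ?_⟩,
    fun μ Φ hΦ θ hθ => ?_, fun Φ hΦ θ hθ => ?_⟩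
  all_goals obtain ⟨hA, hψ⟩ := SQFT.isConfig_iff.mp hΦ
  · rw [hpot Φ hΦ]
    simp only [SQFT.gaugeA, SQFT.inv_inv_dressingFactor h hA]
  · rw [SQFT.dressed_quark h hc hαm hdir hA hψ, SQFT.groupRep_dressingFactor h hA]
  · rw [SQFT.dressed_quark h hc hαm hdir hA hψ, SQFT.gaugePsi_inv_dressingFactor h hA]
  · refine SQFT.g_smul_injective ?_
    rw [SQFT.dressed_stringPot h hc hαm hdir μ hA hψ, SQFT.dressed_stringPot h hc hαm hdir μ
      (Φ := SQFT.gauge 𝓕 π θ Φ) (SQFT.gaugeA_mem_gPots hθ hA) (SQFT.gauge_smooth hθ hψ)]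
    exact congrFun (congrArg Subtype.val (SQFT.dressedPot_gaugeA h hc hA hθ)) μ
  · rw [SQFT.dressed_quark h hc hαm hdir hA hψ, SQFT.dressed_quark h hc hαm hdir
      (Φ := SQFT.gauge 𝓕 π θ Φ) (SQFT.gaugeA_mem_gPots hθ hA) (SQFT.gauge_smooth hθ hψ)]
    exact SQFT.fexp_lieRep_mul_gaugePsi h hc hA hθ Φ.2
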